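/- **Conventions.** A finite lattice $\mathcal L$ is *geometric* if it is well-ranked (for each $F$ all maximal chains from $\hat 0$ to $F$ have the same length, $\mathrm{rk}\,F$), atomic (every element is a join of atoms) and satisfies $\mathrm{rk}(F\wedge G)+\mathrm{rk}(F\vee G)\le \mathrm{rk}\,F+\mathrm{rk}\,G$; it is non-trivial if it has more than one element. An element $F$ is *modular* if equality holds here for every $G$. An *embedding* is an injective join-preserving map sending atoms to atoms. A *modular diagram* of $\mathcal L$ is a triple $\Gamma=(\mathcal E,\iota,J)$ with $\mathcal E$ a geometric lattice, $\iota:\mathcal L\to\mathcal E$ an embedding with image $[\hat 0,F_\iota]$ where $F_\iota$ is modular in $\mathcal E$, and $J=(H_1,\dots,H_n)$ a finite word of atoms of $\mathcal E$. Its degree is $n-2\big(\mathrm{rk}\bigvee J-\mathrm{rk}((\bigvee J)\wedge F_\iota)\big)$. $\mathcal{MD}(\mathcal L)$ is the $\mathbb Q$-vector space spanned by the modular diagrams modulo the relations: 1. exchanging two letters of $J$ changes the sign; 2. $(\mathcal E,\iota,J)\sim(\mathcal E',\varphi\circ\iota,\varphi(J))$ for every embedding $\varphi:\mathcal E\to\mathcal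 E'$ with $\mathrm{rk}\,\mathcal E=\mathrm{rk}\,\mathcal E'$; 3. $(\mathcal E,\iota,J)\sim0$ if $F_\iota\vee\bigvee J<\hat1$; 4. $(\mathcal E,\iota,J)\sim0$ if $\mathcal E\cong\mathcal E_1\times\mathcal E_2$ with $\mathcal E_1,\mathcal E_2$ non-trivial geometric lattices and $F_\iota\in\mathcal E_1\times\{\hat0\}$; 5. $(\mathcal E,\iota,J)\sim0$ if for some modular $F\ge F_\iota$ exactly two letters of $J$ are not below $F$. An atom $H\in J$ is a *bridge* if it is the only atom of $J$ not below some flat $F\ge F_\iota$; it is *contractible* if it is not a bridge and $H\not\le F_\iota$. If $J$ has no repeated letter and $H_i$ is contractible, put $\Gamma/H_i=\big([H_i,\hat1],\,H_i\vee\iota,\,(H_i\vee H_j)_{j\ne i}\big)$. For $\Gamma_k=(\mathcal E_k,\iota_k,J_k)$, $k=1,2$, the *pushout* (generalized parallel connection) $\mathcal E_1\cup_{\mathcal L}\mathcal E_2$ is the subposet of $\mathcal E_1\times\mathcal E_2$ of pairs $(F_1,F_2)$ with $\iota_1^{-1}(F_1\wedge F_{\iota_1})=\iota_2^{-1}(F_2\wedge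 F_{\iota_2})$, with $\iota_{12}=(\iota_1,\iota_2):\mathcal L\to\mathcal E_1\cup_{\mathcal L}\mathcal E_2$, and $J_1\cup J_2$ is the concatenated word, where $H\in J_1$ is identified with $(H,\iota_2\iota_1^{-1}(H\wedge F_{\iota_1}))$ and symmetrically for $J_2$. $\mathrm{OS}(\mathcal L)$ is the quotient of the exterior $\mathbb Q$-algebra on degree one generators $e_H$, $H$ an atom of $\mathcal L$, by the ideal generated by the $\delta e_C$, where $C$ runs over the circuits (sets of atoms with $\mathrm{rk}\,C=\#C-1=\mathrm{rk}(C\setminus c)$ for all $c\in C$), $e_C=\pm\prod_{H\in C}e_H$ and $\delta$ is the derivation with $\delta e_H=1$. For a word $K$ of atoms of $\mathcal L$, $e_K$ is the product of the corresponding generators in order. **Proposition.** Let $\mathcal L$ be a non-trivial geometric lattice. The contractions $\Gamma/H_i$ (for $J$ without repeated letters and $H_i$ contractible) and the triples $(\mathcal E_1\cup_{\mathcal L}\mathcal E_2,\iota_{12},J_1\cup J_2)$ are modular diagrams. A diagram whose word has a repeated letter is zero in $\mathcal{MD}(\mathcal L)$. There are a well-defined linear map $d$ and a well-defined bilinear product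 $\bullet$ on $\mathcal{MD}(\mathcal L)$ with $$d\Gamma=\sum_{H_i\ \text{contractible}}(-1)^{i+1}\,\Gamma/H_i\quad(J\text{ without repeated letters}),\qquad \Gamma_1\bullet\Gamma_2=(\mathcal E_1\cup_{\mathcal L}\mathcal E_2,\iota_{12},J_1\cup J_2),$$ and with these $\mathcal{MD}(\mathcal L)$, graded by the degree, is a unital commutative differential graded algebra over $\mathbb Q$: it is the direct sum of its homogeneous parts, $\bullet$ is homogeneous of degree $0$, associative and graded commutative with unit $(\mathcal L,\mathrm{id},\emptyset)$, $d$ has degree $+1$, $d^2=0$, and $d(\Gamma_1\bullet\Gamma_2)=d\Gamma_1\bullet\Gamma_2+(-1)^{\deg\Gamma_1}\Gamma_1\bullet d\Gamma_2$. Likewise $\mathrm{OS}(\mathcal L)$ with zero differential is a commutative differential graded algebra, and there is a morphism of cdgas $$\mathbb I_{\mathcal L}:\mathcal{MD}(\mathcal L)\to(\mathrm{OS}(\mathcal L),0)$$ such that $\mathbb I_{\mathcal L}(\mathcal E,\iota,J)=0$ if $J$ has a contractible atom, and $\mathbb I_{\mathcal L}(\mathcal E,\iota,J)=e_{\iota^{-1}(J)}$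 if $J$ has no contractible atom and $F_\iota=\hat1$ (i.e. $\iota$ is an isomorphism). A diagram without contractible atom and with $F_\iota\ne\hat1$ is already zero in $\mathcal{MD}(\mathcal L)$. -/

import Mathlib

universe u

namespace ModDiag

/-! ### Geometric lattices -/

/-- The rank of an element of a finite poset: the maximal length of a chain ending at it. -/
noncomputable def rk {E : Type u} [Lattice E] (x : E) : ℕ := (Order.height x).toNat

/-- Geometric lattices. Condition `graded` says that the lattice is well-ranked, i.e. that for
every `x` all maximal chains from `⊥` to `x` have the same length, namely `rk x`. -/
structure IsGeometric (E : Type u) [Lattice E] [BoundedOrder E] : Prop where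
  finite : Finite E
  graded : ∀ x y : E, x ⋖ y → rk y = rk x + 1
  atomistic : IsAtomistic E
  semimodular : ∀ x y : E, rk (x ⊓ y) + rk (x ⊔ y) ≤ rk x + rk y

/-- The atoms of a lattice. -/
abbrev At (L : Type u) [Lattice L] [BoundedOrder L] : Type u := {H : L // IsAtom H}

/-- Modular elements. -/
def IsModularElt {E : Type u} [Lattice E] (F : E) : Prop :=
  ∀ G : E, rk (F ⊓ G) + rk (F ⊔ G) = rk F + rk G

/-- Embeddings of geometric lattices: injective maps that are compatible with joins and send atoms
to atoms. -/
structure IsEmbedding {E E' : Type u} [Lattice E] [BoundedOrder E] [Lattice E'] [BoundedOrder E']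
    (φ : E → E') : Prop where
  injective : Function.Injective φ
  map_sup : ∀ x y, φ (x ⊔ y) = φ x ⊔ φ y
  map_atom : ∀ x, IsAtom x → IsAtom (φ x)

/-- Modular extensions: embeddings of `L` onto an interval `[⊥, F]` with `F` modular.
Necessarily `F = ι ⊤`. -/
structure IsModularExtension {L E : Type u} [Lattice L] [BoundedOrder L] [Lattice E]
    [BoundedOrder E] (ι : L → E) : Prop where
  embedding : IsEmbedding ι
  range_eq : Set.range ι = Set.Iic (ι ⊤)
  modular : IsModularElt (ι ⊤)

/-! ### Modular diagrams -/

/-- The data of a triple `(E, ι, J)`: a bounded lattice, a map `L → E` and a word in `E`. -/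
structure Diagram (L : Type u) where
  E : Type u
  [lattice : Lattice E]
  [bounded : BoundedOrder E]
  ι : L → E
  J : List E

attribute [instance] Diagram.lattice Diagram.bounded

variable {L : Type u} [Lattice L] [BoundedOrder L]

/-- `(E, ι, J)` is a modular diagram: `E` is a geometric lattice, `ι` is a modular extension
and `J` is a word (linearly ordered multiset) of atoms of `E`. -/
structure Diagram.IsModular (Γ : Diagram L) : Prop where
  geometric : IsGeometric Γ.E
  extension : IsModularExtension Γ.ι
  atoms : ∀ H ∈ Γ.J, IsAtom H

/-- The flat `F_ι = ι ⊤`. -/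
def Diagram.F (Γ : Diagram L) : Γ.E := Γ.ι ⊤

/-- The join of the elements of `J`. -/
def Diagram.join (Γ : Diagram L) : Γ.E := (Γ.J : Multiset Γ.E).sup

/-- The degree `|J| - 2 (rk (⋁ J) - rk ((⋁ J) ∧ F_ι))`. -/
noncomputable def Diagram.deg (Γ : Diagram L) : ℤ :=
  (Γ.J.length : ℤ) - 2 * ((rk Γ.join : ℤ) - (rk (Γ.join ⊓ Γ.F) : ℤ))

/-- `H` is a bridge: it is the only atom of `J` that is not below some flat `G ≥ F_ι`. -/
def Diagram.IsBridge (Γ : Diagram L) (H : Γ.E) : Prop :=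
  H ∈ Γ.J ∧ ∃ G : Γ.E, Γ.F ≤ G ∧ ¬ H ≤ G ∧ ∀ K ∈ Γ.J, K ≠ H → K ≤ G

/-- `H` is contractible: it is an atom of `J` that is not a bridge and is not below `F_ι`. -/
def Diagram.IsContractible (Γ : Diagram L) (H : Γ.E) : Prop :=
  H ∈ Γ.J ∧ ¬ Γ.IsBridge H ∧ ¬ H ≤ Γ.F

/-- The contraction `([H, ⊤], H ∨ ι, H ∨ (J ∖ H))` at the letter `H` of `J` in position `i`. -/
def Diagram.contract (Γ : Diagram L) (i : Fin Γ.J.length) : Diagram L where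
  E := Set.Ici (Γ.J.get i)
  ι x := ⟨Γ.J.get i ⊔ Γ.ι x, le_sup_left⟩
  J := (Γ.J.eraseIdx i).map fun K => ⟨Γ.J.get i ⊔ K, le_sup_left⟩

/-- The same extension with another word. -/
def Diagram.withWord (Γ : Diagram L) (J : List Γ.E) : Diagram L where
  E := Γ.E
  ι := Γ.ι
  J := J

variable (L) in
/-- Modular diagrams of `L`. -/
def ModularDiagram : Type (u + 1) := {Γ : Diagram L // Γ.IsModular}

/-- The diagram `(L, id, ∅)`. -/
def unit (hL : IsGeometric L) : ModularDiagram L :=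
  ⟨{ E := L, ι := id, J := [] },
    { geometric := hL
      extension :=
        { embedding := ⟨Function.injective_id, fun _ _ => rfl, fun _ h => h⟩
          range_eq := by simp
          modular := fun G => by simp [add_comm] }
      atoms := by simp }⟩

/-! ### Pushouts (generalized parallel connections) -/

section Extension

variable {E : Type u} [Lattice E] [BoundedOrder E] {ι : L → E}

theorem IsModularExtension.le_iff (h : IsModularExtension ι) {x y : L} :
    ι x ≤ ι y ↔ x ≤ y := by
  rw [← sup_eq_right, ← h.embedding.map_sup, h.embedding.injective.eq_iff, sup_eq_right]

theorem IsModularExtension.exists_trace (h : IsModularExtension ι) (G : E) :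
    ∃ x : L, ι x = G ⊓ ι ⊤ := by
  have : G ⊓ ι ⊤ ∈ Set.range ι := by
    rw [h.range_eq]
    exact inf_le_right
  exact this

theorem IsModularExtension.map_inf (h : IsModularExtension ι) (x y : L) :
    ι (x ⊓ y) = ι x ⊓ ι y := by
  have hy : ι y ≤ ι ⊤ := h.le_iff.2 le_top
  obtain ⟨z, hz⟩ := h.exists_trace (ι x ⊓ ι y)
  rw [inf_eq_left.2 (inf_le_right.trans hy)] at hz
  refine le_antisymm (le_inf (h.le_iff.2 inf_le_left) (h.le_iff.2 inf_le_right)) ?_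
  rw [← hz, h.le_iff]
  exact le_inf (h.le_iff.1 (hz.le.trans inf_le_left)) (h.le_iff.1 (hz.le.trans inf_le_right))

theorem IsModularExtension.map_bot (h : IsModularExtension ι) : ι ⊥ = ⊥ := by
  have : (⊥ : E) ∈ Set.range ι := by
    rw [h.range_eq]
    exact bot_le
  obtain ⟨z, hz⟩ := this
  exact le_bot_iff.1 (hz ▸ h.le_iff.2 bot_le)

end Extension

/-- The flat `ι⁻¹(G ∧ F_ι)` of `L`. -/
noncomputable def ModularDiagram.trace (Γ : ModularDiagram L) (G : Γ.1.E) : L :=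
  (Γ.2.extension.exists_trace G).choose

theorem ModularDiagram.trace_spec (Γ : ModularDiagram L) (G : Γ.1.E) :
    Γ.1.ι (Γ.trace G) = G ⊓ Γ.1.F :=
  (Γ.2.extension.exists_trace G).choose_spec

theorem ModularDiagram.trace_eq_iff (Γ : ModularDiagram L) {G : Γ.1.E} {x : L} :
    Γ.trace G = x ↔ Γ.1.ι x = G ⊓ Γ.1.F := by
  rw [← Γ.trace_spec, Γ.2.extension.embedding.injective.eq_iff, eq_comm]

/-- The subposet of `E₁ × E₂` of the pairs `(F₁, F₂)` with
`ι₁⁻¹(F₁ ∧ F_ι₁) = ι₂⁻¹(F₂ ∧ F_ι₂)`. -/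
def Pushout (Γ₁ Γ₂ : ModularDiagram L) : Type u :=
  {p : Γ₁.1.E × Γ₂.1.E // Γ₁.trace p.1 = Γ₂.trace p.2}

namespace Pushout

variable (Γ₁ Γ₂ : ModularDiagram L)

noncomputable instance : SemilatticeInf (Pushout Γ₁ Γ₂) :=
  Subtype.semilatticeInf (P := fun p : Γ₁.1.E × Γ₂.1.E => Γ₁.trace p.1 = Γ₂.trace p.2) (by
    have key : ∀ (Γ : ModularDiagram L) (G G' : Γ.1.E),
        Γ.trace (G ⊓ G') = Γ.trace G ⊓ Γ.trace G' := by
      intro Γ G G'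
      rw [Γ.trace_eq_iff, Γ.2.extension.map_inf, Γ.trace_spec, Γ.trace_spec, inf_inf_inf_comm,
        inf_idem]
    intro p q hp hq
    change Γ₁.trace (p.1 ⊓ q.1) = Γ₂.trace (p.2 ⊓ q.2)
    rw [key, key, hp, hq])

noncomputable instance : BoundedOrder (Pushout Γ₁ Γ₂) where
  top := ⟨(⊤, ⊤), by
    have key : ∀ Γ : ModularDiagram L, Γ.trace ⊤ = ⊤ := fun Γ => by
      rw [Γ.trace_eq_iff, top_inf_eq]
      rfl
    simp only [key]⟩
  bot := ⟨(⊥, ⊥), by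
    have key : ∀ Γ : ModularDiagram L, Γ.trace ⊥ = ⊥ := fun Γ => by
      rw [Γ.trace_eq_iff, bot_inf_eq, Γ.2.extension.map_bot]
    simp only [key]⟩
  le_top p := ⟨le_top, le_top⟩
  bot_le p := ⟨bot_le, bot_le⟩

theorem finite : Finite (Pushout Γ₁ Γ₂) := by
  have := Γ₁.2.geometric.finite
  have := Γ₂.2.geometric.finite
  exact Subtype.finite

/-- Joins exist since the poset is finite, has a greatest element and has meets. -/
theorem exists_isLUB (p q : Pushout Γ₁ Γ₂) : ∃ r, IsLUB {p, q} r := by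
  have := finite Γ₁ Γ₂
  have hs := Set.toFinite (upperBounds {p, q})
  refine ⟨hs.toFinset.inf id, ?_, ?_⟩
  · intro a ha
    refine Finset.le_inf fun r hr => ?_
    exact (hs.mem_toFinset.1 hr) ha
  · intro r hr
    exact Finset.inf_le (f := id) (hs.mem_toFinset.2 hr)

noncomputable instance : Lattice (Pushout Γ₁ Γ₂) where
  sup p q := (exists_isLUB Γ₁ Γ₂ p q).choose
  le_sup_left p q := (exists_isLUB Γ₁ Γ₂ p q).choose_spec.1 (by simp)
  le_sup_right p q := (exists_isLUB Γ₁ Γ₂ p q).choose_spec.1 (by simp)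
  sup_le p q r hp hq := (exists_isLUB Γ₁ Γ₂ p q).choose_spec.2 (by
    rintro a (rfl | rfl)
    · exact hp
    · exact hq)

end Pushout

theorem ModularDiagram.trace_ι (Γ : ModularDiagram L) (x : L) : Γ.trace (Γ.1.ι x) = x := by
  rw [Γ.trace_eq_iff, eq_comm, inf_eq_left]
  exact Γ.2.extension.le_iff.2 le_top

/-- The product `(E₁ ∪_L E₂, ι₁₂, J₁ ∪ J₂)`. A flat `G` of `E₁` is identified with the element
`(G, ι₂ ι₁⁻¹(G ∧ F_ι₁))` of the pushout, and symmetrically for `E₂`; the words are concatenated. -/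
noncomputable def pushout (Γ₁ Γ₂ : ModularDiagram L) : Diagram L where
  E := Pushout Γ₁ Γ₂
  ι x := ⟨(Γ₁.1.ι x, Γ₂.1.ι x), by simp only [ModularDiagram.trace_ι]⟩
  J := (Γ₁.1.J.map fun G => ⟨(G, Γ₂.1.ι (Γ₁.trace G)), by simp only [ModularDiagram.trace_ι]⟩) ++
    (Γ₂.1.J.map fun G => ⟨(Γ₁.1.ι (Γ₂.trace G), G), by simp only [ModularDiagram.trace_ι]⟩)

/-! ### The space of modular diagrams -/

open Classical in
/-- The relations between modular diagrams. -/
inductive Relator : (ModularDiagram L →₀ ℚ) → Prop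
  /-- Exchanging two neighbours in the word changes the sign. -/
  | swap (Γ Γ' : ModularDiagram L) (l₁ l₂ : List Γ.1.E) (a b : Γ.1.E)
      (hJ : Γ.1.J = l₁ ++ a :: b :: l₂)
      (hΓ' : Γ'.1 = Γ.1.withWord (l₁ ++ b :: a :: l₂)) :
      Relator (Finsupp.single Γ 1 + Finsupp.single Γ' 1)
  /-- Diagrams related by an embedding of full rank are identified. -/
  | embed (Γ Γ' : ModularDiagram L) (φ : Γ.1.E → Γ'.1.E) (hφ : IsEmbedding φ)
      (hrk : rk (⊤ : Γ.1.E) = rk (⊤ : Γ'.1.E)) (hι : Γ'.1.ι = φ ∘ Γ.1.ι)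
      (hJ : Γ'.1.J = Γ.1.J.map φ) :
      Relator (Finsupp.single Γ 1 - Finsupp.single Γ' 1)
  /-- The extension is generated by `L` and `J`. -/
  | span (Γ : ModularDiagram L) (h : Γ.1.F ⊔ Γ.1.join < ⊤) :
      Relator (Finsupp.single Γ 1)
  /-- Products of non-trivial lattices with `L` contained in one factor. -/
  | prod (Γ : ModularDiagram L) (E₁ E₂ : Type u) [Lattice E₁] [BoundedOrder E₁] [Lattice E₂]
      [BoundedOrder E₂] [Nontrivial E₁] [Nontrivial E₂] (h₁ : IsGeometric E₁)
      (h₂ : IsGeometric E₂) (e : Γ.1.E ≃o E₁ × E₂) (h : (e Γ.1.F).2 = ⊥) :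
      Relator (Finsupp.single Γ 1)
  /-- Exactly two letters of `J` are not below some modular flat `G ≥ F_ι`. -/
  | two (Γ : ModularDiagram L) (G : Γ.1.E) (hG : IsModularElt G) (hF : Γ.1.F ≤ G)
      (h : (Γ.1.J.filter fun H => ¬ H ≤ G).length = 2) :
      Relator (Finsupp.single Γ 1)

variable (L) in
/-- The rational vector space of modular diagrams of `L`. -/
abbrev MD : Type (u + 1) :=
  (ModularDiagram L →₀ ℚ) ⧸ Submodule.span ℚ {x : ModularDiagram L →₀ ℚ | Relator x}

/-- The class of a modular diagram. -/
noncomputable def cls (Γ : ModularDiagram L) : MD L := Submodule.Quotient.mk (Finsupp.single Γ 1)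

variable (L) in
/-- The homogeneous parts of the space of modular diagrams. -/
noncomputable def MD.grading (k : ℤ) : Submodule ℚ (MD L) :=
  Submodule.span ℚ {x | ∃ Γ : ModularDiagram L, Γ.1.deg = k ∧ x = cls Γ}

/-! ### Orlik–Solomon algebras -/

variable (L) in
/-- The exterior algebra on generators `e_H`, one for each atom `H`. -/
abbrev Ext : Type u := ExteriorAlgebra ℚ (At L →₀ ℚ)

/-- The product of the generators along a word of atoms. -/
noncomputable def Ext.e (J : List (At L)) : Ext L :=
  (J.map fun H => ExteriorAlgebra.ι ℚ (Finsupp.single H (1 : ℚ))).prod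

variable (L) in
/-- The (odd) derivation of the exterior algebra with `e_H ↦ 1` for all `H`, i.e. the contraction
with the linear form that takes the value `1` on all generators. -/
noncomputable def Ext.δ : Ext L →ₗ[ℚ] Ext L :=
  CliffordAlgebra.contractLeft (Q := (0 : QuadraticForm ℚ (At L →₀ ℚ)))
    (Finsupp.linearCombination ℚ fun _ : At L => (1 : ℚ))

/-- The rank of a finite set of atoms. -/
noncomputable def rkSet (C : Finset (At L)) : ℕ := rk (C.sup fun H => (H : L))

open Classical in
/-- Circuits: `rk C = #C - 1` and `rk (C ∖ c) = #C - 1` for all `c ∈ C`. -/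
def IsCircuit (C : Finset (At L)) : Prop :=
  rkSet C + 1 = C.card ∧ ∀ c ∈ C, rkSet (C.erase c) + 1 = C.card

/-- The relations `δ e_C = 0` for circuits `C`. -/
inductive OSRel : Ext L → Ext L → Prop
  | circuit (C : Finset (At L)) (hC : IsCircuit C) : OSRel (Ext.δ L (Ext.e C.toList)) 0

variable (L) in
/-- The Orlik–Solomon algebra. -/
abbrev OS : Type u := RingQuot (OSRel (L := L))

/-- The element `e_J` of the Orlik–Solomon algebra, for a word `J` of atoms. -/
noncomputable def OS.e (J : List (At L)) : OS L := RingQuot.mkAlgHom ℚ OSRel (Ext.e J)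

variable (L) in
/-- The homogeneous parts of the Orlik–Solomon algebra. -/
noncomputable def OS.grading (k : ℤ) : Submodule ℚ (OS L) :=
  Submodule.span ℚ {x | ∃ J : List (At L), (J.length : ℤ) = k ∧ x = OS.e J}

/-! ### Commutative differential graded algebras -/

/-- The subspaces `𝒜 i`, the element `one`, the product `mul` and the differential `d` make `A` a
(cohomologically graded, graded-commutative, unital) commutative dg-algebra over `ℚ`. -/
structure IsCDGA {A : Type*} [AddCommGroup A] [Module ℚ A] (𝒜 : ℤ → Submodule ℚ A) (one : A)
    (mul : A →ₗ[ℚ] A →ₗ[ℚ] A) (d : A →ₗ[ℚ] A) : Prop where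
  internal : DirectSum.IsInternal 𝒜
  one_mem : one ∈ 𝒜 0
  mul_mem : ∀ i j, ∀ a ∈ 𝒜 i, ∀ b ∈ 𝒜 j, mul a b ∈ 𝒜 (i + j)
  d_mem : ∀ i, ∀ a ∈ 𝒜 i, d a ∈ 𝒜 (i + 1)
  one_mul : ∀ a, mul one a = a
  mul_one : ∀ a, mul a one = a
  mul_assoc : ∀ a b c, mul (mul a b) c = mul a (mul b c)
  mul_comm : ∀ i j, ∀ a ∈ 𝒜 i, ∀ b ∈ 𝒜 j, mul a b = ((-1 : ℚ) ^ (i * j)) • mul b a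
  d_d : ∀ a, d (d a) = 0
  leibniz : ∀ i, ∀ a ∈ 𝒜 i, ∀ b,
    d (mul a b) = mul (d a) b + ((-1 : ℚ) ^ i) • mul a (d b)

/-- `f` is a morphism of commutative dg-algebras. -/
structure IsCDGAHom {A B : Type*} [AddCommGroup A] [Module ℚ A] [AddCommGroup B] [Module ℚ B]
    (𝒜 : ℤ → Submodule ℚ A) (oneA : A) (mulA : A →ₗ[ℚ] A →ₗ[ℚ] A) (dA : A →ₗ[ℚ] A)
    (ℬ : ℤ → Submodule ℚ B) (oneB : B) (mulB : B →ₗ[ℚ] B →ₗ[ℚ] B) (dB : B →ₗ[ℚ] B)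
    (f : A →ₗ[ℚ] B) : Prop where
  map_mem : ∀ i, ∀ a ∈ 𝒜 i, f a ∈ ℬ i
  map_one : f oneA = oneB
  map_mul : ∀ a b, f (mulA a b) = mulB (f a) (f b)
  map_d : ∀ a, f (dA a) = dB (f a)

end ModDiag

namespace ModDiag

variable {L : Type u} [Lattice L] [BoundedOrder L]

/-! ### Geometric lattices -/

/-! A modular diagram is governed by the adjunction between `ι` and the trace `G ↦ ι⁻¹(G ⊓ F_ι)`.
Modularity of `F_ι` gives `trace (G ⊔ ι x) = trace G ⊔ x` and `rk G - rk (trace G) = rk (G ⊔ F_ι) -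
rk F_ι`. The first identity makes joins in a pushout explicit (`Pushout.sup_val`). The second, with
a sharpened semimodularity (`rk_sup_add_rk_inf_le`), makes `rk p₁ + rk p₂ - rk (trace p₁)` a rank
function on the pushout (`Pushout.geometric_and_rk`). Associativity and graded commutativity then
come from evident isomorphisms, and every relation passes through a pushout.

The differential is an alternating sum over the letters of a word. In a word without repetitions a
letter `H` is not a bridge precisely when it lies below the join of `F_ι` and the other letters, and
the contraction at `H` is a modular diagram exactly when `H` is neither below `F_ι` nor repeated.
Extending the class map by zero to all other triples lets the sum run over all letters of all words.
The delicate relation is the one with two letters `a`, `b` outside a modular flat `G`: unless they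
are bridges, `[a, ⊤]` and `[b, ⊤]` are both copies of `[⊥, G]`, so the two contractions agree and
cancel (`dSum_two`). The square of `d` vanishes because a double contraction depends only on the
join of the two letters (`altSum_altSum`), and the Leibniz rule holds because contracting a letter
of one factor commutes with the pushout (`dTerm_pushoutM`). A diagram with a bridge is zero, since
the bridge splits off as a direct factor along a full-rank embedding (`cls_eq_zero_of_not_spans`).

The map to the Orlik–Solomon algebra is zero unless `F_ι = ⊤`, and then it reads the word inside
`L`. Only its vanishing on `dΓ` needs an argument. A contraction can survive only if `F_ι` is a
hyperplane. Letters below it give a common factor. For atoms `a ≠ b` outside it, let `P a b` be the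
generator of the atom in which the line `a ⊔ b` meets the hyperplane. Three such atoms satisfy the
Arnold relation `P a b * P a c - P a b * P b c + P a c * P b c = 0` (`gen_trace_three`), and these
relations kill the alternating sum of the products `∏ P a b` (`altSum_prod_eq_zero`). -/

theorem covBy_sup_eq {E : Type u} [Lattice E] {x y a : E} (h : x ⋖ y) (hay : a ≤ y)
    (hax : ¬ a ≤ x) : x ⊔ a = y :=
  (h.eq_or_eq le_sup_left (sup_le h.le hay)).resolve_left fun he => hax (sup_eq_left.1 he)

section Geometric

variable {E : Type u} [Lattice E] [BoundedOrder E]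

theorem isAtomistic_of_atoms_le
    (h : ∀ x y : E, (∀ a, IsAtom a → a ≤ x → a ≤ y) → x ≤ y) : IsAtomistic E :=
  ⟨fun b => ⟨{a | IsAtom a ∧ a ≤ b}, ⟨fun _ ha => ha.2, fun y hy => h b y fun _ ha hab =>
    hy ⟨ha, hab⟩⟩, fun _ ha => ha.1⟩⟩

namespace IsGeometric

theorem rk_strictMono (h : IsGeometric E) : StrictMono (rk : E → ℕ) := by
  have := h.finite
  have hfin : ∀ x : E, Order.height x < ⊤ := by
    intro x
    by_contra hx
    rw [not_lt, top_le_iff, Order.height_eq_top_iff] at hx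
    obtain ⟨p, -, hp⟩ := hx (Nat.card E)
    have := Nat.card_le_card_of_injective _ p.strictMono.injective
    simp [hp] at this
  intro x y hxy
  have h1 := Order.height_strictMono hxy (hfin x)
  rw [← ENat.natCast_toNat (hfin x).ne, ← ENat.natCast_toNat (hfin y).ne] at h1
  exact_mod_cast h1

theorem rk_mono (h : IsGeometric E) {x y : E} (hxy : x ≤ y) : rk x ≤ rk y :=
  h.rk_strictMono.monotone hxy

theorem eq_of_le_of_rk_le (h : IsGeometric E) {x y : E} (hxy : x ≤ y) (hr : rk y ≤ rk x) :
    x = y := by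
  by_contra hne
  exact absurd (h.rk_strictMono (lt_of_le_of_ne hxy hne)) (by omega)

theorem atoms_le (h : IsGeometric E) {x y : E} (hxy : ∀ a, IsAtom a → a ≤ x → a ≤ y) :
    x ≤ y := by
  have := h.atomistic
  exact le_iff_atom_le_imp.2 hxy

theorem exists_atom (h : IsGeometric E) {x y : E} (hxy : ¬ x ≤ y) :
    ∃ a, IsAtom a ∧ a ≤ x ∧ ¬ a ≤ y := by
  by_contra! hc
  exact hxy (h.atoms_le hc)

end IsGeometric

theorem rk_bot : rk (⊥ : E) = 0 := by simp [rk]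

namespace IsGeometric

theorem rk_atom (h : IsGeometric E) {a : E} (ha : IsAtom a) : rk a = 1 := by
  rw [h.graded ⊥ a (bot_covBy_iff.2 ha), rk_bot]

theorem isAtom_iff_rk (h : IsGeometric E) {a : E} : IsAtom a ↔ rk a = 1 := by
  refine ⟨h.rk_atom, fun ha => ⟨fun hb => ?_, fun b hb => ?_⟩⟩
  · rw [hb, rk_bot] at ha
    omega
  · have h1 := h.rk_strictMono hb
    exact (h.eq_of_le_of_rk_le bot_le (by omega)).symm

theorem inf_atom (_ : IsGeometric E) {a x : E} (ha : IsAtom a) (hax : ¬ a ≤ x) : a ⊓ x = ⊥ :=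
  (ha.le_iff.1 inf_le_left).resolve_right fun h => hax (inf_eq_left.1 h)

theorem rk_atom_sup (h : IsGeometric E) {a x : E} (ha : IsAtom a) (hax : ¬ a ≤ x) :
    rk (a ⊔ x) = rk x + 1 := by
  have h1 := h.semimodular a x
  have h2 : x < a ⊔ x := right_lt_sup.2 hax
  have h3 := h.rk_strictMono h2
  rw [h.inf_atom ha hax, rk_bot, h.rk_atom ha] at h1
  omega

theorem covBy_atom_sup (h : IsGeometric E) {a x : E} (ha : IsAtom a) (hax : ¬ a ≤ x) :
    x ⋖ a ⊔ x := by
  refine ⟨right_lt_sup.2 hax, fun y hxy hy => ?_⟩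
  have h1 := h.rk_strictMono hxy
  have h2 := h.rk_strictMono hy
  rw [h.rk_atom_sup ha hax] at h2
  omega

/-- The exchange property. -/
theorem exchange (h : IsGeometric E) {a b x : E} (ha : IsAtom a) (hb : IsAtom b)
    (hax : ¬ a ≤ x) (hab : a ≤ b ⊔ x) : b ≤ a ⊔ x := by
  by_cases hbx : b ≤ x
  · exact hbx.trans le_sup_right
  have : a ⊔ x = b ⊔ x := by
    refine h.eq_of_le_of_rk_le (sup_le hab le_sup_right) ?_
    rw [h.rk_atom_sup ha hax, h.rk_atom_sup hb hbx]
  exact this ▸ le_sup_left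

end IsGeometric

/-- Recognition of geometric lattices and their rank functions. -/
theorem isGeometric_of_rank [Finite E] (r : E → ℕ)
    (hatoms : ∀ x y : E, (∀ a, IsAtom a → a ≤ x → a ≤ y) → x ≤ y) (h0 : r ⊥ = 0)
    (hmono : StrictMono r) (h1 : ∀ a, IsAtom a → r a ≤ 1)
    (hsemi : ∀ x y, r (x ⊓ y) + r (x ⊔ y) ≤ r x + r y) :
    IsGeometric E ∧ ∀ x : E, rk x = r x := by
  -- A cover adds a single atom, `y = x ⊔ a`, and semimodularity bounds `r y` by `r x + r a ≤ r x +
  -- 1`.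
  have hcov : ∀ x y : E, x ⋖ y → r y = r x + 1 := by
    intro x y hxy
    obtain ⟨a, ha, hay, hax⟩ : ∃ a, IsAtom a ∧ a ≤ y ∧ ¬ a ≤ x := by
      by_contra! hc
      exact hxy.lt.not_ge (hatoms y x hc)
    have h2 : x ⊔ a = y := covBy_sup_eq hxy hay hax
    have h3 := hsemi x a
    rw [h2] at h3
    have h4 := hmono hxy.lt
    have h5 := h1 a ha
    omega
  -- The height is at most `r` because `r` is strictly monotone, and at least `r` because descending
  -- one cover at a time gives a chain of length `r x`.
  have hfin : ∀ x : E, Order.height x ≤ r x := fun x => by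
    simpa using Order.height_le_height_apply_of_strictMono r hmono x
  have hle : ∀ x : E, (r x : ℕ∞) ≤ Order.height x := by
    intro x
    induction hn : r x generalizing x with
    | zero => simp
    | succ n ih =>
      have hx : x ≠ ⊥ := by
        rintro rfl
        omega
      obtain ⟨y, -, hy⟩ := exists_le_covBy_of_lt (bot_lt_iff_ne_bot.2 hx)
      have h2 := hcov y x hy
      have h3 := ih y (by omega)
      have h4 := Order.height_add_one_le hy.lt
      push_cast
      exact (add_le_add_left h3 1).trans h4
  have hrk : ∀ x : E, rk x = r x := fun x => by
    rw [rk, le_antisymm (hfin x) (hle x)]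
    rfl
  refine ⟨⟨inferInstance, fun x y hxy => ?_, isAtomistic_of_atoms_le hatoms, fun x y => ?_⟩, hrk⟩
  · rw [hrk, hrk, hcov x y hxy]
  · simpa only [hrk] using hsemi x y

omit [BoundedOrder E] in
theorem rk_orderIso {E' : Type u} [Lattice E'] (e : E ≃o E') (x : E) : rk (e x) = rk x := by
  rw [rk, Order.height_orderIso, rk]

theorem IsGeometric.of_orderIso {E' : Type u} [Lattice E'] [BoundedOrder E']
    (h : IsGeometric E) (e : E ≃o E') : IsGeometric E' := by
  have := h.finite
  have : Finite E' := Finite.of_equiv E e.toEquiv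
  have hr : ∀ x, rk (e.symm x) = rk x := rk_orderIso e.symm
  refine (isGeometric_of_rank rk (fun x y hxy => ?_) rk_bot (fun x y hxy => ?_)
    (fun a ha => ?_) fun x y => ?_).1
  · rw [← e.symm.le_iff_le]
    refine h.atoms_le fun a ha hax => ?_
    have := hxy (e a) ((e.isAtom_iff a).2 ha) (by simpa using e.monotone hax)
    simpa using e.symm.monotone this
  · rw [← hr, ← hr y]
    exact h.rk_strictMono (e.symm.strictMono hxy)
  · rw [← hr]
    exact (h.rk_atom ((e.symm.isAtom_iff a).2 ha)).le
  · rw [← hr, ← hr x, ← hr y, ← hr (x ⊔ y), e.symm.map_inf, e.symm.map_sup]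
    exact h.semimodular _ _

omit [BoundedOrder E] in
theorem IsModularElt.map_orderIso {E' : Type u} [Lattice E']
    (e : E ≃o E') {F : E} (h : IsModularElt F) : IsModularElt (e F) := by
  intro G
  obtain ⟨G, rfl⟩ := e.surjective G
  rw [← e.map_inf, ← e.map_sup]
  simpa only [rk_orderIso] using h G

/-! ### Intervals and products -/

theorem IsGeometric.Iic (h : IsGeometric E) (G : E) :
    IsGeometric (Set.Iic G) ∧ ∀ x : Set.Iic G, rk x = rk (x : E) := by
  have := h.finite
  refine isGeometric_of_rank (fun x : Set.Iic G => rk (x : E)) (fun x y hxy => ?_) rk_bot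
    (fun x y hxy => h.rk_strictMono hxy) (fun a ha => ?_) (fun x y => h.semimodular _ _)
  · refine h.atoms_le fun a ha hax => ?_
    exact hxy ⟨a, hax.trans x.2⟩ (ha.Iic (hax.trans x.2)) hax
  · exact (h.rk_atom (ha.of_isAtom_coe_Iic)).le

/-- The atoms of `[H, ⊤]` are the covers of `H`, that is, the `a ⊔ H` with `a` an atom not below
`H`. The additive form of the rank formula keeps truncated subtraction out of later arithmetic. -/
theorem IsGeometric.Ici (h : IsGeometric E) (H : E) :
    IsGeometric (Set.Ici H) ∧ ∀ x : Set.Ici H, rk x + rk H = rk (x : E) := by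
  have := h.finite
  have hle : ∀ x : Set.Ici H, rk H ≤ rk (x : E) := fun x => h.rk_mono x.2
  have key := isGeometric_of_rank (fun x : Set.Ici H => rk (x : E) - rk H) (fun x y hxy => ?_)
    (Nat.sub_self _) (fun x y hxy => ?_) (fun a ha => ?_) (fun x y => ?_)
  · exact ⟨key.1, fun x => by rw [key.2, Nat.sub_add_cancel (hle x)]⟩
  · refine h.atoms_le fun a ha hax => ?_
    by_cases haH : a ≤ H
    · exact haH.trans y.2
    · exact le_sup_left.trans (hxy ⟨a ⊔ H, le_sup_right⟩
        (Set.Ici.isAtom_iff.2 (h.covBy_atom_sup ha haH)) (sup_le hax x.2))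
  · have := h.rk_strictMono (show (x : E) < y from hxy)
    have := hle x
    beta_reduce
    omega
  · have := h.graded _ _ (Set.Ici.isAtom_iff.1 ha)
    omega
  · have h1 := h.semimodular (x : E) y
    have := hle x
    have := hle y
    have : rk H ≤ rk ((x : E) ⊓ y) := hle (x ⊓ y)
    have : rk H ≤ rk ((x : E) ⊔ y) := hle (x ⊔ y)
    change rk ((x : E) ⊓ y) - rk H + (rk ((x : E) ⊔ y) - rk H) ≤ _
    omega

theorem isAtom_prod_iff {A B : Type u} [Lattice A] [BoundedOrder A] [Lattice B] [BoundedOrder B]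
    {p : A × B} : IsAtom p ↔ IsAtom p.1 ∧ p.2 = ⊥ ∨ p.1 = ⊥ ∧ IsAtom p.2 := by
  obtain ⟨a, b⟩ := p
  rw [← bot_covBy_iff, ← bot_covBy_iff, ← bot_covBy_iff]
  change ((⊥, ⊥) : A × B) ⋖ _ ↔ _
  rw [Prod.mk_covBy_mk_iff]
  tauto

theorem IsGeometric.prod {A B : Type u} [Lattice A] [BoundedOrder A] [Lattice B] [BoundedOrder B]
    (hA : IsGeometric A) (hB : IsGeometric B) :
    IsGeometric (A × B) ∧ ∀ p : A × B, rk p = rk p.1 + rk p.2 := by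
  have := hA.finite
  have := hB.finite
  refine isGeometric_of_rank (fun p : A × B => rk p.1 + rk p.2) (fun x y hxy => ⟨?_, ?_⟩)
    (by simp [rk_bot]) (fun x y hxy => ?_) (fun p hp => ?_) (fun x y => ?_)
  · refine hA.atoms_le fun a ha hax => ?_
    exact (hxy (a, ⊥) (isAtom_prod_iff.2 (Or.inl ⟨ha, rfl⟩)) ⟨hax, bot_le⟩).1
  · refine hB.atoms_le fun a ha hax => ?_
    exact (hxy (⊥, a) (isAtom_prod_iff.2 (Or.inr ⟨rfl, ha⟩)) ⟨bot_le, hax⟩).2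
  · rcases Prod.lt_iff.1 hxy with h | h
    · exact add_lt_add_of_lt_of_le (hA.rk_strictMono h.1) (hB.rk_mono h.2)
    · exact add_lt_add_of_le_of_lt (hA.rk_mono h.1) (hB.rk_strictMono h.2)
  · rcases isAtom_prod_iff.1 hp with h | h
    · simp only [h.2, rk_bot, hA.rk_atom h.1]
      rfl
    · simp only [h.1, rk_bot, hB.rk_atom h.2]
      rfl
  · have h1 := hA.semimodular x.1 y.1
    have h2 := hB.semimodular x.2 y.2
    simp only [Prod.fst_inf, Prod.fst_sup, Prod.snd_inf, Prod.snd_sup]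
    omega

/-! ### Modular elements -/

namespace IsModularElt

variable {F : E}

/-- Modularity at `A` and at `A ⊔ x` shows that `(A ⊔ x) ⊓ F` exceeds `A ⊓ F` in rank by `rk (A ⊔ x)
- rk A`. Semimodularity for `A` and `(A ⊓ F) ⊔ x` shows that the smaller side already gains this
much. -/
theorem inf_sup_eq (hF : IsModularElt F) (h : IsGeometric E) {x : E} (hx : x ≤ F) (A : E) :
    (A ⊔ x) ⊓ F = (A ⊓ F) ⊔ x := by
  refine (h.eq_of_le_of_rk_le (sup_le (inf_le_inf_right _ le_sup_left) (le_inf le_sup_right hx))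
    ?_).symm
  have h1 := hF (A ⊔ x)
  have h2 := hF A
  have h3 := h.semimodular A ((A ⊓ F) ⊔ x)
  have h4 : A ⊔ (A ⊓ F ⊔ x) = A ⊔ x := by rw [← sup_assoc, sup_inf_self]
  have h5 : rk (A ⊓ F) ≤ rk (A ⊓ (A ⊓ F ⊔ x)) := h.rk_mono (le_inf inf_le_left le_sup_left)
  have h6 : F ⊔ (A ⊔ x) = F ⊔ A := by
    rw [← sup_assoc]
    exact sup_eq_left.2 (hx.trans le_sup_left)
  rw [h6] at h1
  rw [h4] at h3
  rw [inf_comm] at h1 h2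
  omega

/-- Both sides have the same meet and the same join with `F`, and modularity of `F` recovers the
rank from these two. -/
theorem inf_sup_eq_of_le (hF : IsModularElt F) (h : IsGeometric E) {H G : E} (hG : H ≤ G) :
    G ⊓ (H ⊔ F) = H ⊔ (G ⊓ F) := by
  have hle : H ⊔ G ⊓ F ≤ G ⊓ (H ⊔ F) :=
    sup_le (le_inf hG le_sup_left) (inf_le_inf_left _ le_sup_right)
  refine (h.eq_of_le_of_rk_le hle ?_).symm
  have h1 := hF (G ⊓ (H ⊔ F))
  have h2 := hF (H ⊔ G ⊓ F)
  have h3 : F ⊓ (G ⊓ (H ⊔ F)) ≤ F ⊓ (H ⊔ G ⊓ F) :=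
    le_inf inf_le_left ((le_inf (inf_le_right.trans inf_le_left) inf_le_left).trans le_sup_right)
  have h4 : F ⊔ G ⊓ (H ⊔ F) ≤ F ⊔ (H ⊔ G ⊓ F) :=
    sup_le le_sup_left (inf_le_right.trans (sup_le (le_sup_left.trans le_sup_right) le_sup_left))
  have h5 := h.rk_mono h3
  have h6 := h.rk_mono h4
  omega

end IsModularElt

theorem IsModularElt.prod_bot {A B : Type u} [Lattice A] [BoundedOrder A] [Lattice B]
    [BoundedOrder B] (hA : IsGeometric A) (hB : IsGeometric B) {a : A} (h : IsModularElt a) :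
    IsModularElt ((a, ⊥) : A × B) := by
  intro G
  have := h G.1
  simp only [(hA.prod hB).2, Prod.fst_inf, Prod.fst_sup, Prod.snd_inf, Prod.snd_sup, bot_inf_eq,
    bot_sup_eq, rk_bot]
  omega

/-! ### Embeddings -/

namespace IsEmbedding

variable {E' : Type u} [Lattice E'] [BoundedOrder E'] {φ : E → E'}

theorem le_iff (hφ : IsEmbedding φ) {x y : E} : φ x ≤ φ y ↔ x ≤ y := by
  rw [← sup_eq_right, ← hφ.map_sup, hφ.injective.eq_iff, sup_eq_right]

/-- The correction `rk (φ ⊥)` is there for a one-point `E`, where nothing forces `φ ⊥ = ⊥`. As soon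
as `E` has an atom, `φ ⊥` lies strictly below an atom and is `⊥`. -/
theorem rk_eq_add (hφ : IsEmbedding φ) (h : IsGeometric E) (h' : IsGeometric E') (x : E) :
    rk (φ x) = rk x + rk (φ ⊥) := by
  have := h.finite
  induction hn : rk x generalizing x with
  | zero =>
    rw [← h.eq_of_le_of_rk_le (bot_le : ⊥ ≤ x) (by omega)]
    simp
  | succ n ih =>
    have hx : x ≠ ⊥ := by
      rintro rfl
      rw [rk_bot] at hn
      omega
    obtain ⟨y, -, hy⟩ := exists_le_covBy_of_lt (bot_lt_iff_ne_bot.2 hx)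
    obtain ⟨a, ha, hax, hay⟩ := h.exists_atom hy.lt.not_ge
    have h1 := h.graded _ _ hy
    have h2 := ih y (by omega)
    have h3 : a ⊔ y = x := by
      rw [sup_comm]
      exact covBy_sup_eq hy hax hay
    rw [← h3, hφ.map_sup, h'.rk_atom_sup (hφ.map_atom a ha) (by rwa [hφ.le_iff]), h2]
    omega

theorem of_orderIso (e : E ≃o E') : IsEmbedding e where
  injective := e.injective
  map_sup := e.map_sup
  map_atom x hx := (e.isAtom_iff x).2 hx

end IsEmbedding

end Geometric

/-! ### Modular extensions -/

/-- Modularity of `F` is applied to `G` and to `(H ⊔ F) ⊓ G`. As `H ≤ G`, the latter has join `H ⊔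
F` and meet `F ⊓ G` with `F`, which yields the rank of the meet in the interval. -/
theorem IsModularElt.Ici {E : Type u} [Lattice E] [BoundedOrder E] {F : E} (hF : IsModularElt F)
    (h : IsGeometric E) (H : E) : IsModularElt (⟨H ⊔ F, le_sup_left⟩ : Set.Ici H) := by
  intro G
  have h0 := (h.Ici H).2
  have hG : H ≤ (G : E) := G.2
  have e1 := h0 (⟨H ⊔ F, le_sup_left⟩ ⊓ G)
  have e2 := h0 (⟨H ⊔ F, le_sup_left⟩ ⊔ G)
  have e3 : _ = rk (H ⊔ F) := h0 ⟨H ⊔ F, le_sup_left⟩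
  have e4 := h0 G
  change _ = rk ((H ⊔ F) ⊓ (G : E)) at e1
  change _ = rk ((H ⊔ F) ⊔ (G : E)) at e2
  have h1 := hF G
  have h2 := hF ((H ⊔ F) ⊓ G)
  have h3 : F ⊓ ((H ⊔ F) ⊓ G) = F ⊓ G := by
    rw [← inf_assoc, inf_eq_left.2 (le_sup_right : F ≤ H ⊔ F)]
  have h4 : F ⊔ ((H ⊔ F) ⊓ G) = H ⊔ F :=
    le_antisymm (sup_le le_sup_right inf_le_left)
      (sup_le ((le_inf le_sup_left hG).trans le_sup_right) le_sup_left)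
  have h5 : (H ⊔ F) ⊔ (G : E) = F ⊔ G := by
    rw [sup_assoc, sup_eq_right]
    exact hG.trans le_sup_right
  rw [h3, h4] at h2
  rw [h5] at e2
  omega

namespace IsModularExtension

section

variable {E : Type u} [Lattice E] [BoundedOrder E] {ι : L → E}

/-- Joins and the elements below an atom can be computed inside `[⊥, ι ⊤]`, where `ι` is onto. So an
order embedding onto a lower interval with modular top suffices. -/
theorem of_le_iff (hle : ∀ x y, ι x ≤ ι y ↔ x ≤ y) (hr : ∀ G ≤ ι ⊤, ∃ x, ι x = G)
    (hm : IsModularElt (ι ⊤)) : IsModularExtension ι where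
  embedding :=
    { injective := fun _ _ hxy => le_antisymm ((hle _ _).1 hxy.le) ((hle _ _).1 hxy.ge)
      map_sup := fun x y => by
        obtain ⟨z, hz⟩ := hr (ι x ⊔ ι y) (sup_le ((hle _ _).2 le_top) ((hle _ _).2 le_top))
        refine le_antisymm ?_ (sup_le ((hle _ _).2 le_sup_left) ((hle _ _).2 le_sup_right))
        rw [← hz, hle]
        exact sup_le ((hle _ _).1 (hz ▸ le_sup_left)) ((hle _ _).1 (hz ▸ le_sup_right))
      map_atom := fun x hx => by
        have hbot : ι ⊥ = ⊥ := by
          obtain ⟨z, hz⟩ := hr ⊥ bot_le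
          exact le_bot_iff.1 (hz ▸ (hle _ _).2 bot_le)
        refine ⟨fun h => hx.1 (le_bot_iff.1 ((hle _ _).1 (h ▸ bot_le))), fun b hb => ?_⟩
        obtain ⟨z, rfl⟩ := hr b (hb.le.trans ((hle _ _).2 le_top))
        rw [hx.2 z (lt_of_le_not_ge ((hle _ _).1 hb.le) fun h => hb.not_ge ((hle _ _).2 h)), hbot] }
  range_eq := by
    ext G
    refine ⟨?_, hr G⟩
    rintro ⟨x, rfl⟩
    exact (hle _ _).2 le_top
  modular := hm

theorem exists_eq (h : IsModularExtension ι) {G : E} (hG : G ≤ ι ⊤) : ∃ x, ι x = G := by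
  have : G ∈ Set.range ι := h.range_eq ▸ hG
  exact this

theorem le_top (h : IsModularExtension ι) (x : L) : ι x ≤ ι ⊤ := h.le_iff.2 _root_.le_top

/-- The isomorphism onto the interval below `F_ι`. -/
noncomputable def orderIso (h : IsModularExtension ι) : L ≃o Set.Iic (ι ⊤) where
  toEquiv := Equiv.ofBijective (fun x => ⟨ι x, h.le_top x⟩)
    ⟨fun _ _ hxy => h.embedding.injective (congrArg Subtype.val hxy),
      fun G => (h.exists_eq G.2).imp fun _ hx => Subtype.ext hx⟩
  map_rel_iff' := h.le_iff

theorem isGeometric (h : IsModularExtension ι) (hE : IsGeometric E) : IsGeometric L :=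
  (hE.Iic _).1.of_orderIso h.orderIso.symm

theorem rk_map (h : IsModularExtension ι) (hE : IsGeometric E) (x : L) : rk (ι x) = rk x := by
  rw [h.embedding.rk_eq_add (h.isGeometric hE) hE, h.map_bot, rk_bot, add_zero]

theorem top_ne_bot [Nontrivial L] (h : IsModularExtension ι) : ι ⊤ ≠ ⊥ := fun he =>
  _root_.top_ne_bot (h.embedding.injective (he.trans h.map_bot.symm))

/-- Meeting with `F_ι` undoes joining with an atom outside it; this is why `ι` stays injective under
contraction. -/
theorem sup_atom_inf (h : IsModularExtension ι) (hE : IsGeometric E) {H : E} (hH : IsAtom H)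
    (hHF : ¬ H ≤ ι ⊤) (x : L) : (H ⊔ ι x) ⊓ ι ⊤ = ι x := by
  rw [h.modular.inf_sup_eq hE (h.le_top x), hE.inf_atom hH hHF, bot_sup_eq]

theorem contract (h : IsModularExtension ι) (hE : IsGeometric E) {H : E} (hH : IsAtom H)
    (hHF : ¬ H ≤ ι ⊤) :
    IsModularExtension (fun x => (⟨H ⊔ ι x, le_sup_left⟩ : Set.Ici H)) := by
  refine of_le_iff (fun x y => ?_) (fun G hG => ?_) (h.modular.Ici hE H)
  · refine ⟨fun hxy => ?_, fun hxy => sup_le_sup_left (h.le_iff.2 hxy) H⟩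
    have : H ⊔ ι x ≤ H ⊔ ι y := hxy
    have := inf_le_inf_right (ι ⊤) this
    rwa [h.sup_atom_inf hE hH hHF, h.sup_atom_inf hE hH hHF, h.le_iff] at this
  · obtain ⟨x, hx⟩ := h.exists_trace (G : E)
    refine ⟨x, Subtype.ext ?_⟩
    change H ⊔ ι x = G
    rw [hx, ← h.modular.inf_sup_eq_of_le hE G.2]
    exact inf_eq_left.2 hG

theorem orderIso_comp {E' : Type u} [Lattice E'] [BoundedOrder E'] (h : IsModularExtension ι)
    (e : E ≃o E') : IsModularExtension (e ∘ ι) := by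
  refine of_le_iff (fun x y => by simp [h.le_iff]) (fun G hG => ?_) (h.modular.map_orderIso e)
  obtain ⟨x, hx⟩ := h.exists_eq (G := e.symm G) (by simpa using e.symm.monotone hG)
  exact ⟨x, by simp [hx]⟩

theorem codRestrict_Iic (h : IsModularExtension ι) (hE : IsGeometric E) {G : E} (hG : ι ⊤ ≤ G) :
    IsModularExtension (fun x => (⟨ι x, (h.le_top x).trans hG⟩ : Set.Iic G)) := by
  refine of_le_iff (fun _ _ => h.le_iff) (fun X hX => ?_) fun X => ?_
  · exact (h.exists_eq hX).imp fun _ hx => Subtype.ext hx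
  · rw [(hE.Iic G).2, (hE.Iic G).2, (hE.Iic G).2, (hE.Iic G).2]
    exact h.modular X

theorem prod_bot {B : Type u} [Lattice B] [BoundedOrder B] (h : IsModularExtension ι)
    (hE : IsGeometric E) (hB : IsGeometric B) :
    IsModularExtension (fun x => ((ι x, ⊥) : E × B)) := by
  refine of_le_iff (fun x y => ?_) (fun X hX => ?_) (h.modular.prod_bot hE hB)
  · rw [Prod.mk_le_mk, h.le_iff, and_iff_left le_rfl]
  · obtain ⟨x, hx⟩ := h.exists_eq hX.1
    exact ⟨x, Prod.ext hx (le_bot_iff.1 hX.2).symm⟩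

theorem fst {B : Type u} [Lattice B] [BoundedOrder B] (hE : IsGeometric E) (hB : IsGeometric B)
    {ι : L → E × B} (h : IsModularExtension ι) (h2 : (ι ⊤).2 = ⊥) :
    IsModularExtension (fun x => (ι x).1) := by
  have h2' : ∀ x, (ι x).2 = ⊥ := fun x => le_bot_iff.1 ((h.le_top x).2.trans h2.le)
  refine of_le_iff (fun x y => ?_) (fun X hX => ?_) fun X => ?_
  · rw [← h.le_iff, Prod.le_def, h2', h2', and_iff_left le_rfl]
  · obtain ⟨x, hx⟩ := h.exists_eq (G := (X, ⊥)) ⟨hX, bot_le⟩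
    exact ⟨x, by rw [hx]⟩
  · have := h.modular (X, ⊥)
    simpa [(hE.prod hB).2, h2, rk_bot] using this

end

end IsModularExtension

/-! ### Traces -/

namespace ModularDiagram

variable (Γ : ModularDiagram L)

/-- The trace is right adjoint to `ι`; many identities between traces below are read off from this.
-/
theorem le_trace {x : L} {G : Γ.1.E} : x ≤ Γ.trace G ↔ Γ.1.ι x ≤ G := by
  rw [← Γ.2.extension.le_iff, Γ.trace_spec, le_inf_iff, and_iff_left]
  exact Γ.2.extension.le_top x

theorem ι_trace_le (G : Γ.1.E) : Γ.1.ι (Γ.trace G) ≤ G := Γ.le_trace.1 le_rfl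

theorem trace_mono {G G' : Γ.1.E} (h : G ≤ G') : Γ.trace G ≤ Γ.trace G' :=
  Γ.le_trace.2 ((Γ.ι_trace_le G).trans h)

theorem trace_inf (G G' : Γ.1.E) : Γ.trace (G ⊓ G') = Γ.trace G ⊓ Γ.trace G' :=
  eq_of_forall_le_iff fun x => by simp [Γ.le_trace]

theorem trace_top : Γ.trace ⊤ = ⊤ := top_le_iff.1 (Γ.le_trace.2 le_top)

theorem trace_bot : Γ.trace ⊥ = ⊥ := by
  rw [← Γ.2.extension.map_bot, Γ.trace_ι]

/-- Traces need not preserve joins, but they do when one of the two flats comes from `L`, by the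
modular law for `F_ι`. Joins in a pushout are computable because of this. -/
theorem trace_sup_ι (G : Γ.1.E) (x : L) : Γ.trace (G ⊔ Γ.1.ι x) = Γ.trace G ⊔ x := by
  rw [Γ.trace_eq_iff, Γ.2.extension.embedding.map_sup, Γ.trace_spec]
  exact (Γ.2.extension.modular.inf_sup_eq Γ.2.geometric (Γ.2.extension.le_top x) G).symm

theorem trace_eq_top_iff {G : Γ.1.E} : Γ.trace G = ⊤ ↔ Γ.1.F ≤ G := by
  rw [← top_le_iff, Γ.le_trace]
  rfl

theorem trace_atom_of_not_le {H : Γ.1.E} (hH : IsAtom H) (hF : ¬ H ≤ Γ.1.F) :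
    Γ.trace H = ⊥ := by
  rw [Γ.trace_eq_iff, Γ.2.geometric.inf_atom hH hF, Γ.2.extension.map_bot]

/-- Consequently `rk G - rk (trace G) = rk (G ⊔ F_ι) - rk F_ι` is monotone in `G`, as the rank
function of a pushout requires. -/
theorem rk_add_rk_F (G : Γ.1.E) : rk G + rk Γ.1.F = rk (Γ.trace G) + rk (G ⊔ Γ.1.F) := by
  rw [← Γ.2.extension.rk_map Γ.2.geometric, Γ.trace_spec, inf_comm, sup_comm, add_comm]
  exact (Γ.2.extension.modular G).symm

theorem rk_F : rk Γ.1.F = rk (⊤ : L) := Γ.2.extension.rk_map Γ.2.geometric ⊤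

include Γ in
theorem isGeometric_base : IsGeometric L := Γ.2.extension.isGeometric Γ.2.geometric

end ModularDiagram

/-! ### Joins of words and contractions -/

namespace Diagram

omit [Lattice L] [BoundedOrder L] in
theorem join_le_iff {Γ : Diagram L} {G : Γ.E} : Γ.join ≤ G ↔ ∀ K ∈ Γ.J, K ≤ G := by
  rw [join, Multiset.sup_le]
  rfl

/-- The contraction at `H`, with a given word `J` instead of the remaining letters. -/
def contractAt (Γ : Diagram L) (H : Γ.E) (J : List Γ.E) : Diagram L where
  E := Set.Ici H
  ι x := ⟨H ⊔ Γ.ι x, le_sup_left⟩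
  J := J.map fun K => ⟨H ⊔ K, le_sup_left⟩

omit [Lattice L] [BoundedOrder L] in
theorem contract_eq (Γ : Diagram L) (i : Fin Γ.J.length) :
    Γ.contract i = Γ.contractAt (Γ.J.get i) (Γ.J.eraseIdx i) := rfl

/-- A letter below `F_ι` destroys the injectivity of `ι`, and a repeated letter becomes `⊥` in `[H,
⊤]`. These are the only obstructions, so extension by zero discards exactly such letters. -/
theorem contractAt_isModular_iff [Nontrivial L] (Γ : Diagram L) (hE : IsGeometric Γ.E)
    (hι : IsModularExtension Γ.ι) {H : Γ.E} (hH : IsAtom H) {J : List Γ.E}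
    (hJ : ∀ K ∈ J, IsAtom K) : (Γ.contractAt H J).IsModular ↔ ¬ H ≤ Γ.F ∧ H ∉ J := by
  constructor
  · intro h
    refine ⟨fun hHF => ?_, fun hHJ => ?_⟩
    · obtain ⟨x, rfl⟩ := hι.exists_eq hHF
      have h1 : (Γ.contractAt (Γ.ι x) J).ι x = (Γ.contractAt (Γ.ι x) J).ι ⊥ :=
        Subtype.ext (show Γ.ι x ⊔ Γ.ι x = Γ.ι x ⊔ Γ.ι ⊥ by
          rw [hι.map_bot, sup_idem, sup_bot_eq])
      have h2 := h.extension.embedding.injective h1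
      exact hH.1 (by rw [h2, hι.map_bot])
    · have h1 : IsAtom (⟨H ⊔ H, le_sup_left⟩ : Set.Ici H) :=
        h.atoms _ (List.mem_map.2 ⟨H, hHJ, rfl⟩)
      exact h1.1 (Subtype.ext (sup_idem H))
  · rintro ⟨hHF, hHJ⟩
    refine ⟨(hE.Ici H).1, hι.contract hE hH hHF, fun K hK => ?_⟩
    obtain ⟨K, hKJ, rfl⟩ := List.mem_map.1 hK
    have hKH : ¬ K ≤ H := fun hle => by
      rcases hH.le_iff.1 hle with h | h
      · exact (hJ K hKJ).1 h
      · exact hHJ (h ▸ hKJ)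
    exact Set.Ici.isAtom_iff.2 (by simpa [sup_comm] using hE.covBy_atom_sup (hJ K hKJ) hKH)

end Diagram

/-! ### Alternating functions of words -/

/-- Functions of words that change the sign when two neighbours are exchanged. -/
def IsAlt {α M : Type*} [AddCommGroup M] (f : List α → M) : Prop :=
  ∀ l₁ a b l₂, f (l₁ ++ a :: b :: l₂) = - f (l₁ ++ b :: a :: l₂)

namespace IsAlt

variable {α β M : Type*} [AddCommGroup M] {f : List α → M}

theorem cons (h : IsAlt f) (x : α) : IsAlt fun l => f (x :: l) :=
  fun l₁ a b l₂ => h (x :: l₁) a b l₂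

theorem map (h : IsAlt f) (φ : β → α) : IsAlt fun l => f (l.map φ) :=
  fun l₁ a b l₂ => by simpa using h (l₁.map φ) (φ a) (φ b) (l₂.map φ)

/-- The sign is left undetermined, since the lemma only serves to carry zeros along permutations. -/
theorem perm (h : IsAlt f) {l l' : List α} (hl : l.Perm l') : f l = f l' ∨ f l = - f l' := by
  induction hl generalizing f with
  | nil => exact Or.inl rfl
  | cons x _ ih => exact ih (h.cons x)
  | swap x y l => exact Or.inr (h [] y x l)
  | trans _ _ ih₁ ih₂ =>
    rcases ih₁ h with h₁ | h₁ <;> rcases ih₂ h with h₂ | h₂ <;> simp [h₁, h₂]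

theorem perm_eq_zero (h : IsAlt f) {l l' : List α} (hl : l.Perm l') (h0 : f l' = 0) :
    f l = 0 := by
  rcases h.perm hl with h | h <;> simp [h, h0]

theorem eq_zero_of_not_nodup [Module ℚ M] (h : IsAlt f) {l : List α} (hl : ¬ l.Nodup) :
    f l = 0 := by
  classical
  obtain ⟨x, hx⟩ := List.exists_duplicate_iff_not_nodup.2 hl
  obtain ⟨l', hl'⟩ : ∃ l', l.Perm (x :: x :: l') := by
    have h1 := List.duplicate_iff_two_le_count.1 hx
    have h2 : x ∈ l := List.count_pos_iff.1 (by omega)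
    have h3 : x ∈ l.erase x := List.count_pos_iff.1 (by rw [List.count_erase_self]; omega)
    exact ⟨_, (List.perm_cons_erase h2).trans ((List.perm_cons_erase h3).cons x)⟩
  refine h.perm_eq_zero hl' ?_
  have h1 : f (x :: x :: l') = - f (x :: x :: l') := h [] x x l'
  rw [eq_neg_iff_add_eq_zero, ← two_smul ℚ, smul_eq_zero] at h1
  exact h1.resolve_left two_ne_zero

theorem cons_append (h : IsAlt f) (a : α) (l s : List α) :
    f (a :: (l ++ s)) = (-1 : ℤ) ^ l.length • f (l ++ a :: s) := by
  induction l generalizing f with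
  | nil => simp
  | cons b l ih =>
    have h1 := h [] a b (l ++ s)
    have h2 := ih (h.cons b)
    simp only [List.nil_append] at h1
    rw [List.cons_append, h1, h2, List.length_cons, pow_succ]
    simp

theorem append_comm (h : IsAlt f) {l₁ l₂ : List α} {m n : ℕ} (hm : l₁.length = m)
    (hn : l₂.length = n) : f (l₁ ++ l₂) = (-1 : ℤ) ^ (m * n) • f (l₂ ++ l₁) := by
  subst hm hn
  induction l₁ generalizing f with
  | nil => simp
  | cons a l ih =>
    rw [List.cons_append, ih (h.cons a), h.cons_append a l₂ l, smul_smul, List.length_cons,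
      add_mul, one_mul, pow_add]

end IsAlt

/-! ### Linear maps on the space of modular diagrams -/

open Classical in
/-- Extension by zero of a function on modular diagrams. -/
noncomputable def extendD {M : Type*} [AddCommGroup M] (f : ModularDiagram L → M)
    (D : Diagram L) : M :=
  if h : D.IsModular then f ⟨D, h⟩ else 0

section extendD

variable {M : Type*} [AddCommGroup M] {f : ModularDiagram L → M}

theorem extendD_of_isModular {D : Diagram L} (h : D.IsModular) : extendD f D = f ⟨D, h⟩ :=
  dif_pos h

theorem extendD_of_not_isModular {D : Diagram L} (h : ¬ D.IsModular) : extendD f D = 0 :=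
  dif_neg h

theorem extendD_val (Γ : ModularDiagram L) : extendD f Γ.1 = f Γ := dif_pos Γ.2

end extendD

theorem Diagram.IsModular.withWord {Γ : Diagram L} (h : Γ.IsModular) {J : List Γ.E}
    (hJ : ∀ H ∈ J, IsAtom H) : (Γ.withWord J).IsModular :=
  ⟨h.geometric, h.extension, hJ⟩

theorem cls_eq_zero {Γ : ModularDiagram L} (h : Relator (Finsupp.single Γ 1)) : cls Γ = 0 :=
  (Submodule.Quotient.mk_eq_zero _).2 (Submodule.subset_span h)

/-- Functions of modular diagrams that are compatible with the relations. In the last relation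
the two letters may be assumed to be the first ones. -/
structure Respects {M : Type*} [AddCommGroup M] (f : ModularDiagram L → M) : Prop where
  swap (Γ Γ' : ModularDiagram L) (l₁ l₂ : List Γ.1.E) (a b : Γ.1.E)
    (hJ : Γ.1.J = l₁ ++ a :: b :: l₂)
    (hΓ' : Γ'.1 = Γ.1.withWord (l₁ ++ b :: a :: l₂)) : f Γ = - f Γ'
  embed (Γ Γ' : ModularDiagram L) (φ : Γ.1.E → Γ'.1.E) (hφ : IsEmbedding φ)
    (hrk : rk (⊤ : Γ.1.E) = rk (⊤ : Γ'.1.E)) (hι : Γ'.1.ι = φ ∘ Γ.1.ι)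
    (hJ : Γ'.1.J = Γ.1.J.map φ) : f Γ = f Γ'
  span (Γ : ModularDiagram L) (h : Γ.1.F ⊔ Γ.1.join < ⊤) : f Γ = 0
  prod (Γ : ModularDiagram L) (E₁ E₂ : Type u) [Lattice E₁] [BoundedOrder E₁] [Lattice E₂]
    [BoundedOrder E₂] [Nontrivial E₁] [Nontrivial E₂] (h₁ : IsGeometric E₁)
    (h₂ : IsGeometric E₂) (e : Γ.1.E ≃o E₁ × E₂) (h : (e Γ.1.F).2 = ⊥) : f Γ = 0
  two (Γ : ModularDiagram L) (G : Γ.1.E) (hG : IsModularElt G) (hF : Γ.1.F ≤ G)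
    (h : ∃ a b l, Γ.1.J = a :: b :: l ∧ ¬ a ≤ G ∧ ¬ b ≤ G ∧ ∀ K ∈ l, K ≤ G) : f Γ = 0

/-- Extension by zero makes the function total on words, so that sign arguments need no proof that
each intermediate word consists of atoms. -/
theorem isAlt_of_swap {M : Type*} [AddCommGroup M] {f : ModularDiagram L → M}
    (hf : ∀ (Γ Γ' : ModularDiagram L) (l₁ l₂ : List Γ.1.E) (a b : Γ.1.E),
      Γ.1.J = l₁ ++ a :: b :: l₂ → Γ'.1 = Γ.1.withWord (l₁ ++ b :: a :: l₂) → f Γ = - f Γ')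
    (D : Diagram L) : IsAlt fun J => extendD f (D.withWord J) := by
  have key : ∀ l₁ a b l₂, (D.withWord (l₁ ++ a :: b :: l₂)).IsModular →
      (D.withWord (l₁ ++ b :: a :: l₂)).IsModular := fun l₁ a b l₂ h =>
    h.withWord (J := l₁ ++ b :: a :: l₂) fun H hH => h.atoms H
      (((List.Perm.swap a b l₂).append_left l₁).mem_iff.1 hH)
  intro l₁ a b l₂
  beta_reduce
  by_cases h : (D.withWord (l₁ ++ a :: b :: l₂)).IsModular
  · rw [extendD_of_isModular h, extendD_of_isModular (key _ _ _ _ h)]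
    exact hf ⟨_, h⟩ ⟨_, key _ _ _ _ h⟩ l₁ l₂ a b rfl rfl
  · rw [extendD_of_not_isModular h,
      extendD_of_not_isModular fun h' => h (key _ _ _ _ h'), neg_zero]

theorem Respects.isAlt {M : Type*} [AddCommGroup M] {f : ModularDiagram L → M} (hf : Respects f)
    (D : Diagram L) : IsAlt fun J => extendD f (D.withWord J) :=
  isAlt_of_swap hf.swap D

theorem respects_cls : Respects (cls : ModularDiagram L → MD L) where
  swap Γ Γ' l₁ l₂ a b hJ hΓ' := by
    rw [eq_neg_iff_add_eq_zero, cls, cls, ← Submodule.Quotient.mk_add,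
      Submodule.Quotient.mk_eq_zero]
    exact Submodule.subset_span (Relator.swap Γ Γ' l₁ l₂ a b hJ hΓ')
  embed Γ Γ' φ hφ hrk hι hJ := by
    rw [← sub_eq_zero, cls, cls, ← Submodule.Quotient.mk_sub, Submodule.Quotient.mk_eq_zero]
    exact Submodule.subset_span (Relator.embed Γ Γ' φ hφ hrk hι hJ)
  span Γ h := cls_eq_zero (Relator.span Γ h)
  prod Γ E₁ E₂ _ _ _ _ _ _ h₁ h₂ e h := cls_eq_zero (Relator.prod Γ E₁ E₂ h₁ h₂ e h)
  two Γ G hG hF h := by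
    obtain ⟨a, b, l, hJ, ha, hb, hl⟩ := h
    refine cls_eq_zero (Relator.two Γ G hG hF ?_)
    rw [hJ, List.filter_cons_of_pos (by simpa using ha), List.filter_cons_of_pos (by simpa using hb),
      List.filter_eq_nil_iff.2 (by simpa using hl)]
    rfl

section lift

variable {M : Type*} [AddCommGroup M] [Module ℚ M] {f : ModularDiagram L → M}

theorem Respects.relator (hf : Respects f) {x : ModularDiagram L →₀ ℚ} (hx : Relator x) :
    Finsupp.linearCombination ℚ f x = 0 := by
  induction hx with
  | swap Γ Γ' l₁ l₂ a b hJ hΓ' => simp [hf.swap Γ Γ' l₁ l₂ a b hJ hΓ']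
  | embed Γ Γ' φ hφ hrk hι hJ => simp [hf.embed Γ Γ' φ hφ hrk hι hJ]
  | span Γ h => simp [hf.span Γ h]
  | prod Γ E₁ E₂ h₁ h₂ e h => simp [hf.prod Γ E₁ E₂ h₁ h₂ e h]
  | two Γ G hG hF h =>
    classical
    obtain ⟨a, b, hab⟩ := List.length_eq_two.1 h
    set l := Γ.1.J.filter fun H => H ≤ G with hl
    -- The two letters outside `G` are moved to the front, which changes the value at most by a
    -- sign.
    have hperm : Γ.1.J.Perm (a :: b :: l) := by
      have := (List.filter_append_perm (fun H => decide (¬ H ≤ G)) Γ.1.J).symm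
      rw [hab] at this
      simpa using this
    have hmem : ∀ H ∈ [a, b], ¬ H ≤ G := fun H hH => by
      rw [← hab] at hH
      simpa using (List.mem_filter.1 hH).2
    have hmod : (Γ.1.withWord (a :: b :: l)).IsModular :=
      Γ.2.withWord fun H hH => Γ.2.atoms H (hperm.mem_iff.2 hH)
    have := (hf.isAlt Γ.1).perm_eq_zero hperm (by
      rw [extendD_of_isModular hmod]
      refine hf.two ⟨_, hmod⟩ G hG hF ⟨a, b, l, rfl, hmem a (by simp), hmem b (by simp), ?_⟩
      intro K hK
      exact of_decide_eq_true (List.mem_filter.1 hK).2)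
    have h2 : extendD f (Γ.1.withWord Γ.1.J) = f Γ := extendD_val Γ
    rw [h2] at this
    simp [this]

/-- Maps on the space of modular diagrams from functions compatible with the relations. -/
noncomputable def MD.lift (f : ModularDiagram L → M) (hf : Respects f) : MD L →ₗ[ℚ] M :=
  Submodule.liftQ _ (Finsupp.linearCombination ℚ f) (by
    rw [Submodule.span_le]
    intro x hx
    exact hf.relator hx)

theorem MD.lift_cls (hf : Respects f) (Γ : ModularDiagram L) : MD.lift f hf (cls Γ) = f Γ := by
  rw [MD.lift, cls]
  erw [Submodule.liftQ_apply]
  simp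

theorem MD.hom_ext {φ ψ : MD L →ₗ[ℚ] M} (h : ∀ Γ, φ (cls Γ) = ψ (cls Γ)) : φ = ψ := by
  refine Submodule.linearMap_qext _ (Finsupp.lhom_ext' fun Γ => LinearMap.ext_ring ?_)
  exact h Γ

theorem MD.induction {p : MD L → Prop} (h0 : p 0) (h : ∀ Γ, p (cls Γ)) (hadd : ∀ x y, p x → p y → p (x + y))
    (hsmul : ∀ (c : ℚ) x, p x → p (c • x)) (x : MD L) : p x := by
  obtain ⟨y, rfl⟩ := Submodule.Quotient.mk_surjective _ x
  induction y using Finsupp.induction_linear with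
  | zero => exact h0
  | add a b ha hb => exact hadd _ _ ha hb
  | single Γ c =>
    have := hsmul c _ (h Γ)
    rwa [cls, ← Submodule.Quotient.mk_smul, Finsupp.smul_single, smul_eq_mul, mul_one] at this

end lift

theorem cls_eq_zero_of_not_nodup {Γ : ModularDiagram L} (h : ¬ Γ.1.J.Nodup) : cls Γ = 0 := by
  rw [← extendD_val (f := cls) Γ]
  exact (respects_cls.isAlt Γ.1).eq_zero_of_not_nodup h

/-! ### Pushouts are geometric -/

namespace ModularDiagram

variable (Γ : ModularDiagram L)

theorem rk_trace_le (G : Γ.1.E) : rk (Γ.trace G) ≤ rk G := by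
  rw [← Γ.2.extension.rk_map Γ.2.geometric]
  exact Γ.2.geometric.rk_mono (Γ.ι_trace_le G)

theorem rk_sup_ι (A : Γ.1.E) (x : L) :
    rk (A ⊔ Γ.1.ι x) + rk (Γ.trace A) = rk A + rk (Γ.trace A ⊔ x) := by
  have h1 := Γ.rk_add_rk_F A
  have h2 := Γ.rk_add_rk_F (A ⊔ Γ.1.ι x)
  rw [Γ.trace_sup_ι, sup_assoc, sup_eq_right.2 (show Γ.1.ι x ≤ Γ.1.F from
    Γ.2.extension.le_top x)] at h2
  omega

/-- With `x`, `y` the traces of `X`, `Y`, the flats `X ⊔ ι y` and `Y ⊔ ι x` still have join `X ⊔ Y`,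
while their meet contains `(X ⊓ Y) ⊔ ι (x ⊔ y)`. Semimodularity for this pair, with ranks expanded
by `rk_sup_ι`, is the sharpened inequality. -/
theorem rk_sup_add_rk_inf_le (X Y : Γ.1.E) :
    rk (X ⊔ Y) + rk (X ⊓ Y) + rk (Γ.trace X) + rk (Γ.trace Y) ≤
      rk X + rk Y + rk (Γ.trace X ⊓ Γ.trace Y) + rk (Γ.trace X ⊔ Γ.trace Y) := by
  set x := Γ.trace X
  set y := Γ.trace Y
  have h1 := Γ.rk_sup_ι X y
  have h2 := Γ.rk_sup_ι Y x
  have h3 := Γ.rk_sup_ι (X ⊓ Y) (x ⊔ y)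
  have h4 : X ⊔ Γ.1.ι y ⊔ (Y ⊔ Γ.1.ι x) = X ⊔ Y :=
    le_antisymm (sup_le (sup_le_sup_left (Γ.ι_trace_le Y) X)
      (sup_le le_sup_right ((Γ.ι_trace_le X).trans le_sup_left)))
      (sup_le_sup le_sup_left le_sup_left)
  have h5 := Γ.2.geometric.semimodular (X ⊔ Γ.1.ι y) (Y ⊔ Γ.1.ι x)
  have h6 : X ⊓ Y ⊔ Γ.1.ι (x ⊔ y) ≤ (X ⊔ Γ.1.ι y) ⊓ (Y ⊔ Γ.1.ι x) := by
    rw [Γ.2.extension.embedding.map_sup]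
    exact sup_le (inf_le_inf le_sup_left le_sup_left) (sup_le
      (le_inf ((Γ.ι_trace_le X).trans le_sup_left) le_sup_right)
      (le_inf le_sup_right ((Γ.ι_trace_le Y).trans le_sup_left)))
  have h7 := Γ.2.geometric.rk_mono h6
  have h8 : x ⊓ y ⊔ (x ⊔ y) = x ⊔ y := sup_eq_right.2 inf_le_sup
  rw [Γ.trace_inf, h8] at h3
  rw [h4] at h5
  rw [sup_comm y x] at h2
  change rk (X ⊔ Γ.1.ι y) + rk x = rk X + rk (x ⊔ y) at h1
  change rk (Y ⊔ Γ.1.ι x) + rk y = rk Y + rk (x ⊔ y) at h2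
  change rk (X ⊓ Y ⊔ Γ.1.ι (x ⊔ y)) + rk (x ⊓ y) = _ at h3
  omega

end ModularDiagram

namespace Pushout

variable {Γ₁ Γ₂ : ModularDiagram L}

theorem ext {p q : Pushout Γ₁ Γ₂} (h₁ : p.1.1 = q.1.1) (h₂ : p.1.2 = q.1.2) : p = q :=
  Subtype.ext (Prod.ext h₁ h₂)

/-- An element of the pushout from its components. -/
def mk (G : Γ₁.1.E) (G' : Γ₂.1.E) (h : Γ₁.trace G = Γ₂.trace G') : Pushout Γ₁ Γ₂ := ⟨(G, G'), h⟩

theorem le_def {p q : Pushout Γ₁ Γ₂} : p ≤ q ↔ p.1.1 ≤ q.1.1 ∧ p.1.2 ≤ q.1.2 := Iff.rfl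

theorem inf_fst (p q : Pushout Γ₁ Γ₂) : (p ⊓ q).1.1 = p.1.1 ⊓ q.1.1 := rfl

theorem inf_snd (p q : Pushout Γ₁ Γ₂) : (p ⊓ q).1.2 = p.1.2 ⊓ q.1.2 := rfl

theorem bot_fst : (⊥ : Pushout Γ₁ Γ₂).1.1 = ⊥ := rfl

theorem bot_snd : (⊥ : Pushout Γ₁ Γ₂).1.2 = ⊥ := rfl

theorem top_fst : (⊤ : Pushout Γ₁ Γ₂).1.1 = ⊤ := rfl

theorem top_snd : (⊤ : Pushout Γ₁ Γ₂).1.2 = ⊤ := rfl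

/-- The componentwise joins may have different traces. Joining both with the image of the join of
these traces repairs this at once, because by `trace_sup_ι` no further trace appears, and every
upper bound has to contain it. -/
theorem sup_val (p q : Pushout Γ₁ Γ₂) : (p ⊔ q).1 =
    (p.1.1 ⊔ q.1.1 ⊔ Γ₁.1.ι (Γ₁.trace (p.1.1 ⊔ q.1.1) ⊔ Γ₂.trace (p.1.2 ⊔ q.1.2)),
      p.1.2 ⊔ q.1.2 ⊔ Γ₂.1.ι (Γ₁.trace (p.1.1 ⊔ q.1.1) ⊔ Γ₂.trace (p.1.2 ⊔ q.1.2))) := by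
  set t := Γ₁.trace (p.1.1 ⊔ q.1.1) ⊔ Γ₂.trace (p.1.2 ⊔ q.1.2) with ht
  let r : Pushout Γ₁ Γ₂ := ⟨(p.1.1 ⊔ q.1.1 ⊔ Γ₁.1.ι t, p.1.2 ⊔ q.1.2 ⊔ Γ₂.1.ι t), by
    rw [Γ₁.trace_sup_ι, Γ₂.trace_sup_ι, sup_eq_right.2 (le_sup_left.trans ht.ge),
      sup_eq_right.2 (le_sup_right.trans ht.ge)]⟩
  suffices h : p ⊔ q = r by rw [h]
  refine le_antisymm (sup_le ?_ ?_) ?_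
  · exact ⟨le_sup_left.trans le_sup_left, le_sup_left.trans le_sup_left⟩
  · exact ⟨le_sup_right.trans le_sup_left, le_sup_right.trans le_sup_left⟩
  · have hp : p ≤ p ⊔ q := le_sup_left
    have hq : q ≤ p ⊔ q := le_sup_right
    have h1 : p.1.1 ⊔ q.1.1 ≤ (p ⊔ q).1.1 := sup_le hp.1 hq.1
    have h2 : p.1.2 ⊔ q.1.2 ≤ (p ⊔ q).1.2 := sup_le hp.2 hq.2
    have h3 : t ≤ Γ₁.trace (p ⊔ q).1.1 :=
      sup_le (Γ₁.trace_mono h1) ((Γ₂.trace_mono h2).trans (p ⊔ q).2.ge)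
    exact ⟨sup_le h1 (Γ₁.le_trace.1 h3), sup_le h2 (Γ₂.le_trace.1 (h3.trans (p ⊔ q).2.le))⟩

theorem trace_sup (p q : Pushout Γ₁ Γ₂) :
    Γ₁.trace (p ⊔ q).1.1 = Γ₁.trace (p.1.1 ⊔ q.1.1) ⊔ Γ₂.trace (p.1.2 ⊔ q.1.2) := by
  rw [sup_val, Γ₁.trace_sup_ι, ← sup_assoc, sup_idem]

/-- The join is formed componentwise if the componentwise join is in the pushout. -/
theorem sup_eq_of_trace_eq {p q : Pushout Γ₁ Γ₂}
    (h : Γ₁.trace (p.1.1 ⊔ q.1.1) = Γ₂.trace (p.1.2 ⊔ q.1.2)) :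
    p ⊔ q = mk (p.1.1 ⊔ q.1.1) (p.1.2 ⊔ q.1.2) h :=
  le_antisymm (sup_le ⟨le_sup_left, le_sup_left⟩ ⟨le_sup_right, le_sup_right⟩)
    ⟨sup_le (le_sup_left : p ≤ p ⊔ q).1 (le_sup_right : q ≤ p ⊔ q).1,
      sup_le (le_sup_left : p ≤ p ⊔ q).2 (le_sup_right : q ≤ p ⊔ q).2⟩

theorem sup_val_of_F_le {p q : Pushout Γ₁ Γ₂} (h : Γ₁.1.F ≤ p.1.1) :
    (p ⊔ q).1 = (p.1.1 ⊔ q.1.1, p.1.2 ⊔ q.1.2) := by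
  have h2 : Γ₂.1.F ≤ p.1.2 := by rwa [← Γ₂.trace_eq_top_iff, ← p.2, Γ₁.trace_eq_top_iff]
  rw [sup_eq_of_trace_eq]
  · rfl
  rw [Γ₁.trace_eq_top_iff.2 (h.trans le_sup_left), Γ₂.trace_eq_top_iff.2 (h2.trans le_sup_left)]

/-- The symmetry of the pushout. -/
def swap (Γ₁ Γ₂ : ModularDiagram L) : Pushout Γ₁ Γ₂ ≃o Pushout Γ₂ Γ₁ where
  toFun p := ⟨(p.1.2, p.1.1), p.2.symm⟩
  invFun p := ⟨(p.1.2, p.1.1), p.2.symm⟩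
  left_inv _ := rfl
  right_inv _ := rfl
  map_rel_iff' := and_comm

/-- The left adjoint inclusion of the first factor. -/
noncomputable def inl (Γ₁ Γ₂ : ModularDiagram L) (G : Γ₁.1.E) : Pushout Γ₁ Γ₂ :=
  ⟨(G, Γ₂.1.ι (Γ₁.trace G)), by simp only [ModularDiagram.trace_ι]⟩

/-- The left adjoint inclusion of the second factor. -/
noncomputable def inr (Γ₁ Γ₂ : ModularDiagram L) (G : Γ₂.1.E) : Pushout Γ₁ Γ₂ :=
  ⟨(Γ₁.1.ι (Γ₂.trace G), G), by simp only [ModularDiagram.trace_ι]⟩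

/-- The inclusion of `L`. -/
def incl (Γ₁ Γ₂ : ModularDiagram L) (x : L) : Pushout Γ₁ Γ₂ :=
  ⟨(Γ₁.1.ι x, Γ₂.1.ι x), by simp only [ModularDiagram.trace_ι]⟩

theorem inl_le_iff {G : Γ₁.1.E} {p : Pushout Γ₁ Γ₂} : inl Γ₁ Γ₂ G ≤ p ↔ G ≤ p.1.1 :=
  ⟨fun h => h.1, fun h => ⟨h, Γ₂.le_trace.1 ((Γ₁.trace_mono h).trans p.2.le)⟩⟩

theorem inr_le_iff {G : Γ₂.1.E} {p : Pushout Γ₁ Γ₂} : inr Γ₁ Γ₂ G ≤ p ↔ G ≤ p.1.2 :=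
  ⟨fun h => h.2, fun h => ⟨Γ₁.le_trace.1 ((Γ₂.trace_mono h).trans p.2.ge), h⟩⟩

theorem isAtom_inl {H : Γ₁.1.E} (hH : IsAtom H) : IsAtom (inl Γ₁ Γ₂ H) := by
  refine ⟨fun h => hH.1 (congrArg (fun p : Pushout Γ₁ Γ₂ => p.1.1) h), fun b hb => ?_⟩
  rcases hH.le_iff.1 hb.le.1 with h | h
  · obtain ⟨x, hx⟩ := Γ₂.2.extension.exists_eq (hb.le.2.trans (Γ₂.2.extension.le_top _))
    have h2 := b.2
    rw [h, Γ₁.trace_bot, ← hx, Γ₂.trace_ι] at h2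
    refine ext h ?_
    rw [← hx, ← h2, Γ₂.2.extension.map_bot]
    rfl
  · exact absurd (inl_le_iff.2 h.ge) hb.not_ge

theorem isAtom_inr {H : Γ₂.1.E} (hH : IsAtom H) : IsAtom (inr Γ₁ Γ₂ H) :=
  ((swap Γ₂ Γ₁).isAtom_iff _).2 (isAtom_inl hH)

theorem isAtom_iff {p : Pushout Γ₁ Γ₂} : IsAtom p ↔
    (∃ H, IsAtom H ∧ p = inl Γ₁ Γ₂ H) ∨ ∃ H, IsAtom H ∧ p = inr Γ₁ Γ₂ H := by
  constructor
  · intro hp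
    by_cases h1 : p.1.1 ≤ ⊥
    · by_cases h2 : p.1.2 ≤ ⊥
      · exact absurd (ext (le_bot_iff.1 h1) (le_bot_iff.1 h2)) hp.1
      · obtain ⟨H, hH, hle, -⟩ := Γ₂.2.geometric.exists_atom h2
        refine Or.inr ⟨H, hH, ?_⟩
        exact ((hp.le_iff.1 (inr_le_iff.2 hle)).resolve_left (isAtom_inr hH).1).symm
    · obtain ⟨H, hH, hle, -⟩ := Γ₁.2.geometric.exists_atom h1
      refine Or.inl ⟨H, hH, ?_⟩
      exact ((hp.le_iff.1 (inl_le_iff.2 hle)).resolve_left (isAtom_inl hH).1).symm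
  · rintro (⟨H, hH, rfl⟩ | ⟨H, hH, rfl⟩)
    · exact isAtom_inl hH
    · exact isAtom_inr hH

/-- Ranks add up under gluing, with the common trace counted once. -/
theorem geometric_and_rk (Γ₁ Γ₂ : ModularDiagram L) : IsGeometric (Pushout Γ₁ Γ₂) ∧
    ∀ p : Pushout Γ₁ Γ₂, rk p = rk p.1.1 + rk p.1.2 - rk (Γ₁.trace p.1.1) := by
  have := finite Γ₁ Γ₂
  have hE₁ := Γ₁.2.geometric
  have hE₂ := Γ₂.2.geometric
  have hL := Γ₁.isGeometric_base
  refine isGeometric_of_rank _ (fun p q hpq => ⟨?_, ?_⟩) ?_ (fun p q hpq => ?_) (fun p hp => ?_)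
    fun p q => ?_
  · refine hE₁.atoms_le fun a ha hap => ?_
    exact inl_le_iff.1 (hpq _ (isAtom_inl ha) (inl_le_iff.2 hap))
  · refine hE₂.atoms_le fun a ha hap => ?_
    exact inr_le_iff.1 (hpq _ (isAtom_inr ha) (inr_le_iff.2 hap))
  · rw [bot_fst, bot_snd, rk_bot, rk_bot, Nat.zero_sub]
  -- Strict monotonicity: `rk p₂ - rk (trace p₂)` never decreases, so a strict step in the first
  -- component suffices. If the first components agree, so do the traces, and the second component
  -- grows strictly.
  · have h1 := Γ₁.rk_trace_le p.1.1
    have h2 := Γ₁.rk_trace_le q.1.1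
    have h3 := hE₁.rk_mono hpq.le.1
    have h4 := Γ₂.rk_add_rk_F p.1.2
    have h5 := Γ₂.rk_add_rk_F q.1.2
    have h6 := hE₂.rk_mono (sup_le_sup_right hpq.le.2 Γ₂.1.F)
    rw [← p.2] at h4
    rw [← q.2] at h5
    rcases hpq.le.1.lt_or_eq with h | h
    · have := hE₁.rk_strictMono h
      omega
    · have h7 : p.1.2 < q.1.2 := lt_of_le_not_ge hpq.le.2 fun h' => hpq.not_ge ⟨h.ge, h'⟩
      have := hE₂.rk_strictMono h7
      rw [h] at h1 h3 h4 ⊢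
      omega
  · rcases isAtom_iff.1 hp with ⟨H, hH, rfl⟩ | ⟨H, hH, rfl⟩
    · change rk H + rk (Γ₂.1.ι (Γ₁.trace H)) - rk (Γ₁.trace H) ≤ 1
      rw [Γ₂.2.extension.rk_map hE₂, hE₁.rk_atom hH]
      omega
    · change rk (Γ₁.1.ι (Γ₂.trace H)) + rk H - rk (Γ₁.trace (Γ₁.1.ι (Γ₂.trace H))) ≤ 1
      rw [Γ₁.2.extension.rk_map hE₁, hE₂.rk_atom hH, Γ₁.trace_ι]
      omega
  -- Semimodularity: the sharpened inequalities of the two factors are added. Semimodularity of `L`,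
  -- at the traces of `p` and `q` and at the traces of the two componentwise joins, absorbs the
  -- remaining trace terms.
  · have a1 := Γ₁.rk_sup_add_rk_inf_le p.1.1 q.1.1
    have a2 := Γ₂.rk_sup_add_rk_inf_le p.1.2 q.1.2
    have a3 := hL.semimodular (Γ₁.trace p.1.1) (Γ₁.trace q.1.1)
    have a4 := hL.semimodular (Γ₁.trace (p.1.1 ⊔ q.1.1)) (Γ₂.trace (p.1.2 ⊔ q.1.2))
    have a5 : rk (Γ₁.trace p.1.1 ⊔ Γ₁.trace q.1.1) ≤
        rk (Γ₁.trace (p.1.1 ⊔ q.1.1) ⊓ Γ₂.trace (p.1.2 ⊔ q.1.2)) := by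
      refine hL.rk_mono (le_inf (sup_le (Γ₁.trace_mono le_sup_left) (Γ₁.trace_mono le_sup_right))
        ?_)
      rw [p.2, q.2]
      exact sup_le (Γ₂.trace_mono le_sup_left) (Γ₂.trace_mono le_sup_right)
    have a6 := Γ₁.rk_sup_ι (p.1.1 ⊔ q.1.1)
      (Γ₁.trace (p.1.1 ⊔ q.1.1) ⊔ Γ₂.trace (p.1.2 ⊔ q.1.2))
    have a7 := Γ₂.rk_sup_ι (p.1.2 ⊔ q.1.2)
      (Γ₁.trace (p.1.1 ⊔ q.1.1) ⊔ Γ₂.trace (p.1.2 ⊔ q.1.2))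
    rw [← sup_assoc, sup_idem] at a6
    rw [sup_left_comm, sup_idem] at a7
    have b1 := Γ₁.rk_trace_le p.1.1
    have b2 := Γ₁.rk_trace_le q.1.1
    have b3 := Γ₁.rk_trace_le (p ⊔ q).1.1
    have b4 := Γ₁.rk_trace_le (p ⊓ q).1.1
    rw [← p.2, ← q.2] at a2
    rw [trace_sup] at b3
    rw [inf_fst, Γ₁.trace_inf] at b4
    rw [trace_sup, inf_fst, inf_snd, Γ₁.trace_inf]
    rw [sup_val] at b3 ⊢
    dsimp only at b3 ⊢
    omega

theorem rk_add (p : Pushout Γ₁ Γ₂) : rk p + rk (Γ₁.trace p.1.1) = rk p.1.1 + rk p.1.2 := by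
  have := Γ₁.rk_trace_le p.1.1
  rw [(geometric_and_rk Γ₁ Γ₂).2]
  omega

/-- Joins with a flat above `F_ι` are componentwise and the trace corrections to the ranks cancel,
so the two modular equalities simply add. -/
theorem isModularElt_of_F_le {G : Γ₁.1.E} {G' : Γ₂.1.E} (hG : IsModularElt G)
    (hG' : IsModularElt G') (h : Γ₁.1.F ≤ G) (he : Γ₁.trace G = Γ₂.trace G') :
    IsModularElt (mk G G' he) := by
  intro p
  have h1 := rk_add (mk G G' he ⊓ p)
  have h2 := rk_add (mk G G' he ⊔ p)
  have h3 := rk_add (mk G G' he)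
  have h4 := rk_add p
  have h5 := hG p.1.1
  have h6 := hG' p.1.2
  have ht := Γ₁.trace_eq_top_iff.2 h
  rw [sup_val_of_F_le h] at h2
  change rk (mk G G' he ⊔ p) + rk (Γ₁.trace (G ⊔ p.1.1)) = rk (G ⊔ p.1.1) + rk (G' ⊔ p.1.2) at h2
  change rk (mk G G' he ⊓ p) + rk (Γ₁.trace (G ⊓ p.1.1)) = rk (G ⊓ p.1.1) + rk (G' ⊓ p.1.2) at h1
  change rk (mk G G' he) + rk (Γ₁.trace G) = rk G + rk G' at h3
  rw [Γ₁.trace_eq_top_iff.2 (h.trans le_sup_left)] at h2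
  rw [Γ₁.trace_inf, ht, top_inf_eq] at h1
  rw [ht] at h3
  omega

theorem incl_isModularExtension (Γ₁ Γ₂ : ModularDiagram L) :
    IsModularExtension (incl Γ₁ Γ₂) := by
  refine IsModularExtension.of_le_iff (fun x y => ?_) (fun p hp => ?_)
    (isModularElt_of_F_le Γ₁.2.extension.modular Γ₂.2.extension.modular le_rfl _)
  · exact ⟨fun h => Γ₁.2.extension.le_iff.1 h.1,
      fun h => ⟨Γ₁.2.extension.le_iff.2 h, Γ₂.2.extension.le_iff.2 h⟩⟩
  · refine ⟨Γ₁.trace p.1.1, ext ?_ ?_⟩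
    · exact (Γ₁.trace_spec _).trans (inf_eq_left.2 hp.1)
    · change Γ₂.1.ι (Γ₁.trace p.1.1) = _
      rw [p.2]
      exact (Γ₂.trace_spec _).trans (inf_eq_left.2 hp.2)

end Pushout

theorem pushout_isModular (Γ₁ Γ₂ : ModularDiagram L) : (pushout Γ₁ Γ₂).IsModular where
  geometric := (Pushout.geometric_and_rk Γ₁ Γ₂).1
  extension := Pushout.incl_isModularExtension Γ₁ Γ₂
  atoms H hH := by
    rcases List.mem_append.1 hH with hH | hH <;> obtain ⟨K, hK, rfl⟩ := List.mem_map.1 hH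
    · exact Pushout.isAtom_inl (Γ₁.2.atoms K hK)
    · exact Pushout.isAtom_inr (Γ₂.2.atoms K hK)

/-! ### Isomorphic diagrams -/

theorem Diagram.IsModular.of_orderIso {D D' : Diagram L} (h : D.IsModular) (e : D.E ≃o D'.E)
    (hι : ∀ x, D'.ι x = e (D.ι x)) (hJ : D'.J = D.J.map e) : D'.IsModular where
  geometric := h.geometric.of_orderIso e
  extension := by
    have : D'.ι = e ∘ D.ι := funext hι
    rw [this]
    exact h.extension.orderIso_comp e
  atoms H hH := by
    rw [hJ] at hH
    obtain ⟨K, hK, rfl⟩ := List.mem_map.1 hH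
    exact (e.isAtom_iff K).2 (h.atoms K hK)

/-- Invariance covers arbitrary triples: an isomorphism transports modularity in both directions, so
outside the modular diagrams both values are zero. -/
theorem Respects.orderIso {M : Type*} [AddCommGroup M] {f : ModularDiagram L → M}
    (hf : Respects f) {D D' : Diagram L} (e : D.E ≃o D'.E) (hι : ∀ x, D'.ι x = e (D.ι x))
    (hJ : D'.J = D.J.map e) : extendD f D = extendD f D' := by
  by_cases h : D.IsModular
  · have h' := h.of_orderIso e hι hJ
    rw [extendD_of_isModular h, extendD_of_isModular h']
    refine hf.embed ⟨D, h⟩ ⟨D', h'⟩ e (IsEmbedding.of_orderIso e) ?_ (funext hι) hJ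
    rw [← rk_orderIso e, e.map_top]
  · rw [extendD_of_not_isModular h, extendD_of_not_isModular]
    intro h'
    refine h (h'.of_orderIso e.symm (fun x => by simp [hι]) ?_)
    have he : e.symm ∘ e = id := funext e.symm_apply_apply
    rw [hJ, List.map_map, he, List.map_id]

theorem cls_eq_of_orderIso {Γ Γ' : ModularDiagram L} (e : Γ.1.E ≃o Γ'.1.E)
    (hι : ∀ x, Γ'.1.ι x = e (Γ.1.ι x)) (hJ : Γ'.1.J = Γ.1.J.map e) : cls Γ = cls Γ' := by
  have := respects_cls.orderIso (D := Γ.1) (D' := Γ'.1) e hι hJ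
  rwa [extendD_val, extendD_val] at this

/-! ### The product -/

/-- The pushout as a modular diagram. -/
noncomputable def pushoutM (Γ₁ Γ₂ : ModularDiagram L) : ModularDiagram L :=
  ⟨pushout Γ₁ Γ₂, pushout_isModular Γ₁ Γ₂⟩

theorem pushoutM_trace (Γ₁ Γ₂ : ModularDiagram L) (p : Pushout Γ₁ Γ₂) :
    (pushoutM Γ₁ Γ₂).trace p = Γ₁.trace p.1.1 := by
  refine eq_of_forall_le_iff fun x => (pushoutM Γ₁ Γ₂).le_trace.trans ?_
  have : Pushout.incl Γ₁ Γ₂ x ≤ p ↔ x ≤ Γ₁.trace p.1.1 := by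
    refine Pushout.le_def.trans ?_
    refine (and_congr Γ₁.le_trace.symm Γ₂.le_trace.symm).trans ?_
    rw [← p.2, and_self]
  exact this

theorem pushoutM_F_sup_join (Γ₁ Γ₂ : ModularDiagram L) :
    (pushoutM Γ₁ Γ₂).1.F ⊔ (pushoutM Γ₁ Γ₂).1.join =
      Pushout.mk (Γ₁.1.F ⊔ Γ₁.1.join) (Γ₂.1.F ⊔ Γ₂.1.join) (by
        rw [Γ₁.trace_eq_top_iff.2 le_sup_left, Γ₂.trace_eq_top_iff.2 le_sup_left]) := by
  refine le_antisymm (sup_le ⟨le_sup_left, le_sup_left⟩ (Diagram.join_le_iff.2 fun K hK => ?_)) ?_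
  · rcases List.mem_append.1 hK with hK | hK <;> obtain ⟨K', hK', rfl⟩ := List.mem_map.1 hK
    · exact Pushout.inl_le_iff.2 ((Diagram.join_le_iff.1 le_rfl K' hK').trans le_sup_right)
    · exact Pushout.inr_le_iff.2 ((Diagram.join_le_iff.1 le_rfl K' hK').trans le_sup_right)
  · have h1 : Pushout.incl Γ₁ Γ₂ ⊤ ≤ (pushoutM Γ₁ Γ₂).1.F ⊔ (pushoutM Γ₁ Γ₂).1.join := le_sup_left
    have h2 : ∀ K ∈ (pushoutM Γ₁ Γ₂).1.J,
        K ≤ (pushoutM Γ₁ Γ₂).1.F ⊔ (pushoutM Γ₁ Γ₂).1.join := fun K hK =>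
      (Diagram.join_le_iff.1 le_rfl K hK).trans le_sup_right
    refine ⟨sup_le h1.1 (Diagram.join_le_iff.2 fun K hK => ?_),
      sup_le h1.2 (Diagram.join_le_iff.2 fun K hK => ?_)⟩
    · exact Pushout.inl_le_iff.1 (h2 _ (List.mem_append_left _ (List.mem_map_of_mem hK)))
    · exact Pushout.inr_le_iff.1 (h2 _ (List.mem_append_right _ (List.mem_map_of_mem hK)))

/-! ### Ranks and traces under embeddings of diagrams. -/

theorem ModularDiagram.rk_embedding {Γ Γ' : ModularDiagram L} {φ : Γ.1.E → Γ'.1.E}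
    (hφ : IsEmbedding φ) (hι : Γ'.1.ι = φ ∘ Γ.1.ι) (x : Γ.1.E) : rk (φ x) = rk x := by
  have h1 : φ ⊥ = ⊥ := by
    rw [← Γ'.2.extension.map_bot, hι, Function.comp, Γ.2.extension.map_bot]
  rw [hφ.rk_eq_add Γ.2.geometric Γ'.2.geometric, h1, rk_bot, add_zero]

/-- An embedding need not preserve meets, so the comparison goes through ranks. One inequality is
formal, and the ranks agree because `φ` preserves ranks and joins with `F_ι`. -/
theorem ModularDiagram.trace_embedding {Γ Γ' : ModularDiagram L} {φ : Γ.1.E → Γ'.1.E}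
    (hφ : IsEmbedding φ) (hι : Γ'.1.ι = φ ∘ Γ.1.ι) (G : Γ.1.E) :
    Γ'.trace (φ G) = Γ.trace G := by
  have hrk := ModularDiagram.rk_embedding hφ hι
  have hF : Γ'.1.F = φ Γ.1.F := congrFun hι ⊤
  have h1 := Γ'.rk_add_rk_F (φ G)
  have h2 := Γ.rk_add_rk_F G
  rw [hF, ← hφ.map_sup, hrk, hrk, hrk] at h1
  refine (Γ.isGeometric_base.eq_of_le_of_rk_le (Γ'.le_trace.2 ?_) (by omega)).symm
  rw [hι, Function.comp, hφ.le_iff]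
  exact Γ.ι_trace_le G

/-- A full-rank embedding extends by the identity of the second component, a direct factor not
involving `L` splits off the pushout, and a modular flat `G ≥ F_ι` is replaced by `(G, ⊤)`. -/
theorem respects_pushoutM_left (Γ₂ : ModularDiagram L) :
    Respects fun Γ₁ => cls (pushoutM Γ₁ Γ₂) where
  swap Γ Γ' l₁ l₂ a b hJ hΓ' := by
    obtain ⟨D', h'⟩ := Γ'
    subst hΓ'
    refine respects_cls.swap (pushoutM Γ Γ₂) _ (l₁.map (Pushout.inl Γ Γ₂))
      (l₂.map (Pushout.inl Γ Γ₂) ++ Γ₂.1.J.map (Pushout.inr Γ Γ₂)) (Pushout.inl Γ Γ₂ a)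
      (Pushout.inl Γ Γ₂ b) ?_ ?_
    · change Γ.1.J.map (Pushout.inl Γ Γ₂) ++ _ = _
      rw [hJ]
      simp
      rfl
    · have : (l₁ ++ b :: a :: l₂).map (Pushout.inl Γ Γ₂) ++ Γ₂.1.J.map (Pushout.inr Γ Γ₂) =
        l₁.map (Pushout.inl Γ Γ₂) ++ Pushout.inl Γ Γ₂ b :: Pushout.inl Γ Γ₂ a ::
          (l₂.map (Pushout.inl Γ Γ₂) ++ Γ₂.1.J.map (Pushout.inr Γ Γ₂)) := by simp
      exact congrArg (pushoutM Γ Γ₂).1.withWord this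
  embed Γ Γ' φ hφ hrk hι hJ := by
    have htr : ∀ G, Γ'.trace (φ G) = Γ.trace G := ModularDiagram.trace_embedding hφ hι
    have hι' : ∀ x, Γ'.1.ι x = φ (Γ.1.ι x) := congrFun hι
    let ψ : Pushout Γ Γ₂ → Pushout Γ' Γ₂ := fun p =>
      Pushout.mk (φ p.1.1) p.1.2 ((htr _).trans p.2)
    have hinl : ∀ H, ψ (Pushout.inl Γ Γ₂ H) = Pushout.inl Γ' Γ₂ (φ H) := fun H =>
      Pushout.ext rfl (congrArg Γ₂.1.ι (htr H).symm)
    have hinr : ∀ H, ψ (Pushout.inr Γ Γ₂ H) = Pushout.inr Γ' Γ₂ H := fun H =>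
      Pushout.ext (hι' _).symm rfl
    have hψ : IsEmbedding ψ :=
      { injective := fun p q hpq => Pushout.ext
          (hφ.injective (congrArg (fun r : Pushout Γ' Γ₂ => r.1.1) hpq))
          (congrArg (fun r : Pushout Γ' Γ₂ => r.1.2) hpq)
        map_sup := fun p q => by
          refine Subtype.ext ?_
          rw [Pushout.sup_val]
          change (φ (p ⊔ q).1.1, (p ⊔ q).1.2) = (φ p.1.1 ⊔ φ q.1.1 ⊔ Γ'.1.ι
            (Γ'.trace (φ p.1.1 ⊔ φ q.1.1) ⊔ Γ₂.trace (p.1.2 ⊔ q.1.2)), p.1.2 ⊔ q.1.2 ⊔ Γ₂.1.ι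
            (Γ'.trace (φ p.1.1 ⊔ φ q.1.1) ⊔ Γ₂.trace (p.1.2 ⊔ q.1.2)))
          rw [Pushout.sup_val, ← hφ.map_sup, htr, hι', ← hφ.map_sup]
        map_atom := fun p hp => by
          rcases Pushout.isAtom_iff.1 hp with ⟨H, hH, rfl⟩ | ⟨H, hH, rfl⟩
          · rw [hinl]
            exact Pushout.isAtom_inl (hφ.map_atom H hH)
          · rw [hinr]
            exact Pushout.isAtom_inr hH }
    refine respects_cls.embed (pushoutM Γ Γ₂) (pushoutM Γ' Γ₂) ψ hψ ?_ ?_ ?_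
    · have h1 := Pushout.rk_add (⊤ : Pushout Γ Γ₂)
      have h2 := Pushout.rk_add (⊤ : Pushout Γ' Γ₂)
      rw [Pushout.top_fst, Pushout.top_snd, ModularDiagram.trace_top] at h1 h2
      change rk (⊤ : Pushout Γ Γ₂) = rk (⊤ : Pushout Γ' Γ₂)
      omega
    · exact funext fun x => Pushout.ext (hι' x) rfl
    · change Γ'.1.J.map (Pushout.inl Γ' Γ₂) ++ Γ₂.1.J.map (Pushout.inr Γ' Γ₂) =
        (Γ.1.J.map (Pushout.inl Γ Γ₂) ++ Γ₂.1.J.map (Pushout.inr Γ Γ₂)).map ψ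
      rw [hJ, List.map_append, List.map_map, List.map_map, List.map_map]
      congr 1
      · exact List.map_congr_left fun H _ => (hinl H).symm
      · exact List.map_congr_left fun H _ => (hinr H).symm
  span Γ h := by
    refine respects_cls.span (pushoutM Γ Γ₂) (lt_top_iff_ne_top.2 fun he => h.ne ?_)
    rw [pushoutM_F_sup_join] at he
    exact congrArg (fun p : Pushout Γ Γ₂ => p.1.1) he
  prod Γ E₁ E₂ _ _ _ _ _ _ h₁ h₂ e h := by
    have hι : IsModularExtension fun x => (e (Γ.1.ι x)).1 :=
      (Γ.2.extension.orderIso_comp e).fst h₁ h₂ h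
    -- Only the lattice and the traces of this auxiliary diagram matter, so its word is taken empty.
    let Γ' : ModularDiagram L := ⟨{ E := E₁, ι := fun x => (e (Γ.1.ι x)).1, J := [] }, h₁, hι,
      fun H hH => absurd hH List.not_mem_nil⟩
    have htr : ∀ a b, Γ.trace (e.symm (a, b)) = Γ'.trace a := fun a b => by
      refine eq_of_forall_le_iff fun x => Γ.le_trace.trans (Iff.trans ?_ Γ'.le_trace.symm)
      rw [← e.le_iff_le, e.apply_symm_apply]
      have : (e (Γ.1.ι x)).2 = ⊥ :=
        le_bot_iff.1 ((e.monotone (Γ.2.extension.le_top x)).2.trans h.le)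
      rw [Prod.le_def, this]
      exact and_iff_left bot_le
    have htr' : ∀ G, Γ'.trace (e G).1 = Γ.trace G := fun G => by
      rw [← htr _ (e G).2, Prod.mk.eta, e.symm_apply_apply]
    -- The trace of `(a, b)` depends on `a` alone, so the gluing condition does not see `E₂`.
    let ε : Pushout Γ Γ₂ ≃o Pushout Γ' Γ₂ × E₂ :=
      { toFun := fun p => (Pushout.mk (Γ₁ := Γ') (e p.1.1).1 p.1.2 ((htr' _).trans p.2),
          (e p.1.1).2)
        invFun := fun q => Pushout.mk (e.symm (q.1.1.1, q.2)) q.1.1.2 ((htr _ _).trans q.1.2)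
        left_inv := fun p => Pushout.ext (e.symm_apply_apply _) rfl
        right_inv := fun q => by
          refine Prod.ext (Pushout.ext ?_ rfl) ?_
          · change (e (e.symm (q.1.1.1, q.2))).1 = q.1.1.1
            rw [e.apply_symm_apply]
          · change (e (e.symm (q.1.1.1, q.2))).2 = q.2
            rw [e.apply_symm_apply]
        map_rel_iff' := fun {p q} => by
          change (((e p.1.1).1 ≤ (e q.1.1).1 ∧ p.1.2 ≤ q.1.2) ∧ (e p.1.1).2 ≤ (e q.1.1).2) ↔
            (p.1.1 ≤ q.1.1 ∧ p.1.2 ≤ q.1.2)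
          rw [← e.le_iff_le (x := p.1.1), Prod.le_def]
          tauto }
    have : Nontrivial (Pushout Γ' Γ₂) := ⟨⊥, ⊤, fun he =>
      bot_ne_top (α := E₁) (congrArg (fun p : Pushout Γ' Γ₂ => p.1.1) he)⟩
    exact respects_cls.prod (pushoutM Γ Γ₂) (Pushout Γ' Γ₂) E₂ (Pushout.geometric_and_rk _ _).1 h₂
      ε h
  two Γ G hG hF h := by
    obtain ⟨a, b, l, hJ, ha, hb, hl⟩ := h
    have ht : Γ.trace G = Γ₂.trace ⊤ := by rw [Γ₂.trace_top, Γ.trace_eq_top_iff.2 hF]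
    refine respects_cls.two (pushoutM Γ Γ₂) (Pushout.mk G ⊤ ht)
      (Pushout.isModularElt_of_F_le hG (fun X => by simp [add_comm]) hF _) ⟨hF, le_top⟩
      ⟨Pushout.inl Γ Γ₂ a, Pushout.inl Γ Γ₂ b,
        l.map (Pushout.inl Γ Γ₂) ++ Γ₂.1.J.map (Pushout.inr Γ Γ₂), ?_, ?_, ?_, ?_⟩
    · change Γ.1.J.map (Pushout.inl Γ Γ₂) ++ _ = _
      rw [hJ]
      rfl
    · exact fun h => ha (Pushout.inl_le_iff.1 h)
    · exact fun h => hb (Pushout.inl_le_iff.1 h)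
    · intro K hK
      rcases List.mem_append.1 hK with hK | hK <;> obtain ⟨K', hK', rfl⟩ := List.mem_map.1 hK
      · exact Pushout.inl_le_iff.2 (hl K' hK')
      · exact Pushout.inr_le_iff.2 le_top

theorem map_append_map {α₁ α₂ β γ : Type*} {a : α₁ → β} {b : α₂ → β} {c : β → γ}
    {f : α₁ → γ} {g : α₂ → γ} {l₁ : List α₁} {l₂ : List α₂} (h₁ : ∀ x, c (a x) = f x)
    (h₂ : ∀ x, c (b x) = g x) : (l₁.map a ++ l₂.map b).map c = l₁.map f ++ l₂.map g := by
  simp [Function.comp_def, h₁, h₂]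

theorem cls_pushoutM_comm (Γ₁ Γ₂ : ModularDiagram L) : cls (pushoutM Γ₁ Γ₂) =
    (-1 : ℤ) ^ (Γ₁.1.J.length * Γ₂.1.J.length) • cls (pushoutM Γ₂ Γ₁) := by
  have h1 := (respects_cls.isAlt (pushoutM Γ₂ Γ₁).1).append_comm
    (l₁ := Γ₁.1.J.map (Pushout.inr Γ₂ Γ₁)) (l₂ := Γ₂.1.J.map (Pushout.inl Γ₂ Γ₁))
    (List.length_map _) (List.length_map _)
  have h2 : extendD cls ((pushoutM Γ₂ Γ₁).1.withWord
      (Γ₂.1.J.map (Pushout.inl Γ₂ Γ₁) ++ Γ₁.1.J.map (Pushout.inr Γ₂ Γ₁))) =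
      cls (pushoutM Γ₂ Γ₁) := extendD_val (pushoutM Γ₂ Γ₁)
  rw [← h2]
  refine Eq.trans ?_ h1
  rw [← extendD_val (f := cls) (pushoutM Γ₁ Γ₂)]
  refine respects_cls.orderIso (Pushout.swap Γ₁ Γ₂) (fun _ => rfl) ?_
  exact (map_append_map (a := Pushout.inl Γ₁ Γ₂) (b := Pushout.inr Γ₁ Γ₂)
    (c := Pushout.swap Γ₁ Γ₂) (f := Pushout.inr Γ₂ Γ₁) (g := Pushout.inl Γ₂ Γ₁)
    (l₁ := Γ₁.1.J) (l₂ := Γ₂.1.J) (fun _ => rfl) fun _ => rfl).symm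

/-- Commutativity transfers everything from the first argument: the sign depends only on the lengths
of the words, which exchanges and embeddings preserve. -/
theorem respects_pushoutM_right (Γ₁ : ModularDiagram L) :
    Respects fun Γ₂ => cls (pushoutM Γ₁ Γ₂) where
  swap Γ Γ' l₁ l₂ a b hJ hΓ' := by
    have h1 := (respects_pushoutM_left Γ₁).swap Γ Γ' l₁ l₂ a b hJ hΓ'
    have h2 : Γ'.1.J.length = Γ.1.J.length := by
      rw [hΓ', hJ]
      simp [Diagram.withWord]
    beta_reduce at h1 ⊢
    rw [cls_pushoutM_comm, h1, cls_pushoutM_comm Γ₁ Γ', h2, smul_neg]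
  embed Γ Γ' φ hφ hrk hι hJ := by
    have h1 := (respects_pushoutM_left Γ₁).embed Γ Γ' φ hφ hrk hι hJ
    have h2 : Γ'.1.J.length = Γ.1.J.length := by rw [hJ, List.length_map]
    beta_reduce at h1 ⊢
    rw [cls_pushoutM_comm, h1, cls_pushoutM_comm Γ₁ Γ', h2]
  span Γ h := by
    rw [cls_pushoutM_comm, (respects_pushoutM_left Γ₁).span Γ h, smul_zero]
  prod Γ E₁ E₂ _ _ _ _ _ _ h₁ h₂ e h := by
    rw [cls_pushoutM_comm, (respects_pushoutM_left Γ₁).prod Γ E₁ E₂ h₁ h₂ e h, smul_zero]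
  two Γ G hG hF h := by
    rw [cls_pushoutM_comm, (respects_pushoutM_left Γ₁).two Γ G hG hF h, smul_zero]

theorem respects_lift {M : Type*} [AddCommGroup M] [Module ℚ M]
    {g : ModularDiagram L → ModularDiagram L → M} (hl : ∀ Γ₂, Respects fun Γ₁ => g Γ₁ Γ₂)
    (hr : ∀ Γ₁, Respects (g Γ₁)) : Respects fun Γ₁ => MD.lift (g Γ₁) (hr Γ₁) where
  swap Γ Γ' l₁ l₂ a b hJ hΓ' := MD.hom_ext fun Γ₂ => by
    rw [LinearMap.neg_apply, MD.lift_cls, MD.lift_cls]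
    exact (hl Γ₂).swap Γ Γ' l₁ l₂ a b hJ hΓ'
  embed Γ Γ' φ hφ hrk hι hJ := MD.hom_ext fun Γ₂ => by
    rw [MD.lift_cls, MD.lift_cls]
    exact (hl Γ₂).embed Γ Γ' φ hφ hrk hι hJ
  span Γ h := MD.hom_ext fun Γ₂ => by
    rw [MD.lift_cls]
    exact (hl Γ₂).span Γ h
  prod Γ E₁ E₂ _ _ _ _ _ _ h₁ h₂ e h := MD.hom_ext fun Γ₂ => by
    rw [MD.lift_cls]
    exact (hl Γ₂).prod Γ E₁ E₂ h₁ h₂ e h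
  two Γ G hG hF h := MD.hom_ext fun Γ₂ => by
    rw [MD.lift_cls]
    exact (hl Γ₂).two Γ G hG hF h

variable (L) in
/-- The product of modular diagrams. -/
noncomputable def MD.mul : MD L →ₗ[ℚ] MD L →ₗ[ℚ] MD L :=
  MD.lift _ (respects_lift (g := fun Γ₁ Γ₂ => cls (pushoutM Γ₁ Γ₂)) respects_pushoutM_left
    respects_pushoutM_right)

theorem MD.mul_cls (Γ₁ Γ₂ : ModularDiagram L) :
    MD.mul L (cls Γ₁) (cls Γ₂) = cls (pushoutM Γ₁ Γ₂) := by
  rw [MD.mul, MD.lift_cls, MD.lift_cls]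

theorem cls_unit_pushoutM (hL : IsGeometric L) (Γ : ModularDiagram L) :
    cls (pushoutM (unit hL) Γ) = cls Γ := by
  have htr : ∀ x, (unit hL).trace x = x := (unit hL).trace_ι
  let e : Pushout (unit hL) Γ ≃o Γ.1.E :=
    { toFun := fun p => p.1.2
      invFun := Pushout.inr (unit hL) Γ
      left_inv := fun p => Pushout.ext (p.2.symm.trans (htr _)) rfl
      right_inv := fun _ => rfl
      map_rel_iff' := fun {p q} => by
        refine ⟨fun h => ⟨?_, h⟩, fun h => h.2⟩
        have h1 : Γ.trace p.1.2 ≤ Γ.trace q.1.2 := Γ.trace_mono h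
        rw [← p.2, ← q.2, htr, htr] at h1
        exact h1 }
  refine cls_eq_of_orderIso (Γ := pushoutM (unit hL) Γ) e (fun _ => rfl) ?_
  change _ = ([] ++ Γ.1.J.map (Pushout.inr (unit hL) Γ)).map e
  rw [List.nil_append, List.map_map]
  exact (List.map_id Γ.1.J).symm

theorem MD.one_mul (hL : IsGeometric L) (a : MD L) : MD.mul L (cls (unit hL)) a = a := by
  have : MD.mul L (cls (unit hL)) = LinearMap.id := MD.hom_ext fun Γ => by
    rw [MD.mul_cls, cls_unit_pushoutM]
    rfl
  rw [this]
  rfl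

theorem MD.mul_one (hL : IsGeometric L) (a : MD L) : MD.mul L a (cls (unit hL)) = a := by
  have : (MD.mul L).flip (cls (unit hL)) = LinearMap.id := MD.hom_ext fun Γ => by
    rw [LinearMap.flip_apply, MD.mul_cls, cls_pushoutM_comm, cls_unit_pushoutM]
    simp [unit]
  exact congrArg (fun φ : MD L →ₗ[ℚ] MD L => φ a) this

theorem map_append_map_append {α₁ α₂ α₃ β γ δ ε : Type*} {a : α₁ → β} {b : α₂ → β} {c : β → γ}
    {d : α₃ → γ} {e : γ → δ} {f : α₁ → δ} {g : α₂ → ε} {h : α₃ → ε} {k : ε → δ}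
    {l₁ : List α₁} {l₂ : List α₂} {l₃ : List α₃} (h₁ : ∀ x, e (c (a x)) = f x)
    (h₂ : ∀ x, e (c (b x)) = k (g x)) (h₃ : ∀ x, e (d x) = k (h x)) :
    ((l₁.map a ++ l₂.map b).map c ++ l₃.map d).map e =
      l₁.map f ++ (l₂.map g ++ l₃.map h).map k := by
  simp [Function.comp_def, h₁, h₂, h₃]

/-- Both iterated pushouts consist of the triples of flats with a common trace in `L`. -/
theorem cls_pushoutM_assoc (Γ₁ Γ₂ Γ₃ : ModularDiagram L) :
    cls (pushoutM (pushoutM Γ₁ Γ₂) Γ₃) = cls (pushoutM Γ₁ (pushoutM Γ₂ Γ₃)) := by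
  have h12 := pushoutM_trace Γ₁ Γ₂
  have h23 := pushoutM_trace Γ₂ Γ₃
  have hp : ∀ p : Pushout (pushoutM Γ₁ Γ₂) Γ₃, Γ₂.trace p.1.1.1.2 = Γ₃.trace p.1.2 := fun p =>
    p.1.1.2.symm.trans ((h12 _).symm.trans p.2)
  let e : Pushout (pushoutM Γ₁ Γ₂) Γ₃ ≃o Pushout Γ₁ (pushoutM Γ₂ Γ₃) :=
    { toFun := fun p => Pushout.mk (Γ₁ := Γ₁) (Γ₂ := pushoutM Γ₂ Γ₃) p.1.1.1.1
        (Pushout.mk p.1.1.1.2 p.1.2 (hp p))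
        (p.1.1.2.trans (h23 (Pushout.mk p.1.1.1.2 p.1.2 (hp p))).symm)
      invFun := fun q => Pushout.mk (Γ₁ := pushoutM Γ₁ Γ₂) (Γ₂ := Γ₃)
        (Pushout.mk q.1.1 q.1.2.1.1 (q.2.trans (h23 _))) q.1.2.1.2
        ((h12 (Pushout.mk q.1.1 q.1.2.1.1 (q.2.trans (h23 _)))).trans
          ((q.2.trans (h23 _)).trans q.1.2.2))
      left_inv := fun _ => rfl
      right_inv := fun _ => rfl
      map_rel_iff' := and_assoc.symm }
  refine cls_eq_of_orderIso (Γ := pushoutM (pushoutM Γ₁ Γ₂) Γ₃)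
    (Γ' := pushoutM Γ₁ (pushoutM Γ₂ Γ₃)) e (fun _ => rfl) ?_
  refine (map_append_map_append (fun H => ?_) (fun H => ?_) fun H => ?_).symm
  · refine Pushout.ext rfl (Pushout.ext rfl ?_)
    exact congrArg Γ₃.1.ι (h12 (Pushout.inl Γ₁ Γ₂ H))
  · refine Pushout.ext ?_ (Pushout.ext rfl ?_)
    · exact congrArg Γ₁.1.ι (h23 (Pushout.inl Γ₂ Γ₃ H)).symm
    · exact congrArg Γ₃.1.ι ((h12 (Pushout.inr Γ₁ Γ₂ H)).trans (Γ₁.trace_ι _))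
  · refine Pushout.ext ?_ (Pushout.ext rfl rfl)
    exact congrArg Γ₁.1.ι ((h23 (Pushout.inr Γ₂ Γ₃ H)).trans (Γ₂.trace_ι _)).symm

theorem MD.mul_assoc (a b c : MD L) :
    MD.mul L (MD.mul L a b) c = MD.mul L a (MD.mul L b c) := by
  induction a using MD.induction with
  | h0 => simp
  | hadd x y hx hy => simp [hx, hy]
  | hsmul c x hx => simp [hx]
  | h Γ₁ =>
    induction b using MD.induction with
    | h0 => simp
    | hadd x y hx hy => simp [hx, hy]
    | hsmul c x hx => simp [hx]
    | h Γ₂ =>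
      induction c using MD.induction with
      | h0 => simp
      | hadd x y hx hy => simp [hx, hy]
      | hsmul c x hx => simp [hx]
      | h Γ₃ => rw [MD.mul_cls, MD.mul_cls, MD.mul_cls, MD.mul_cls, cls_pushoutM_assoc]

/-! ### The grading -/

/-- The map `π i` is the identity on the `i`-th part and kills the span of the others, so the two
meet only in zero. -/
theorem isInternal_of_projections {A : Type*} [AddCommGroup A] [Module ℚ A]
    {𝒜 : ℤ → Submodule ℚ A} (π : ℤ → A →ₗ[ℚ] A) (h1 : ∀ i, ∀ a ∈ 𝒜 i, π i a = a)
    (h2 : ∀ i j, i ≠ j → ∀ a ∈ 𝒜 j, π i a = 0) (htop : ⨆ i, 𝒜 i = ⊤) :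
    DirectSum.IsInternal 𝒜 := by
  rw [DirectSum.isInternal_submodule_iff_iSupIndep_and_iSup_eq_top]
  refine ⟨fun i => Submodule.disjoint_def.2 fun x hx hx' => ?_, htop⟩
  have hle : ⨆ j, ⨆ (_ : j ≠ i), 𝒜 j ≤ LinearMap.ker (π i) :=
    iSup₂_le fun j hj a ha => h2 i j hj.symm a ha
  rw [← h1 i x hx]
  exact hle hx'

/-- The join of the letters of a word. -/
def wsup {E : Type u} [Lattice E] [BoundedOrder E] (J : List E) : E := (J : Multiset E).sup

section wsup

variable {E : Type u} [Lattice E] [BoundedOrder E]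

theorem wsup_nil : wsup ([] : List E) = ⊥ := Multiset.sup_zero

theorem wsup_cons (a : E) (J : List E) : wsup (a :: J) = a ⊔ wsup J :=
  Multiset.sup_cons a (J : Multiset E)

theorem wsup_perm {J J' : List E} (h : J.Perm J') : wsup J = wsup J' :=
  congrArg Multiset.sup (Multiset.coe_eq_coe.2 h)

theorem wsup_le_iff {J : List E} {G : E} : wsup J ≤ G ↔ ∀ K ∈ J, K ≤ G := by
  rw [wsup, Multiset.sup_le]
  rfl

theorem le_wsup {J : List E} {K : E} (hK : K ∈ J) : K ≤ wsup J := wsup_le_iff.1 le_rfl K hK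

end wsup

namespace Diagram

theorem deg_withWord_perm (D : Diagram L) {J J' : List D.E} (h : J.Perm J') :
    (D.withWord J).deg = (D.withWord J').deg := by
  have h1 : (D.withWord J).join = (D.withWord J').join := wsup_perm h
  have h2 : (D.withWord J).J.length = (D.withWord J').J.length := h.length_eq
  unfold Diagram.deg
  rw [h2, h1]
  rfl

theorem map_F_sup_wsup {D D' : Diagram L} {φ : D.E → D'.E} (hφ : IsEmbedding φ)
    (hι : D'.ι = φ ∘ D.ι) (J : List D.E) :
    φ (D.F ⊔ wsup J) = D'.F ⊔ wsup (J.map φ) := by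
  have hF : D'.F = φ D.F := congrFun hι ⊤
  induction J with
  | nil => rw [List.map_nil, wsup_nil, wsup_nil, sup_bot_eq, sup_bot_eq, hF]
  | cons a J ih =>
    rw [List.map_cons, wsup_cons, wsup_cons, sup_left_comm, hφ.map_sup, ih, sup_left_comm]

end Diagram

namespace ModularDiagram

/-- Modularity of `F_ι` rewrites the degree through `rk (F_ι ⊔ ⋁ J)`, which is easier to follow
through pushouts, embeddings and contractions. -/
theorem deg_eq (Γ : ModularDiagram L) : Γ.1.deg =
    (Γ.1.J.length : ℤ) - 2 * ((rk (Γ.1.F ⊔ Γ.1.join) : ℤ) - rk Γ.1.F) := by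
  have h : rk (Γ.1.F ⊓ Γ.1.join) + rk (Γ.1.F ⊔ Γ.1.join) = rk Γ.1.F + rk Γ.1.join :=
    Γ.2.extension.modular Γ.1.join
  rw [Diagram.deg, inf_comm]
  omega

theorem neg_one_zpow_deg (Γ : ModularDiagram L) :
    (-1 : ℚ) ^ Γ.1.deg = (-1) ^ Γ.1.J.length := by
  rw [Γ.deg_eq, zpow_sub₀ (by norm_num), zpow_mul]
  simp

theorem deg_pushoutM (Γ₁ Γ₂ : ModularDiagram L) :
    (pushoutM Γ₁ Γ₂).1.deg = Γ₁.1.deg + Γ₂.1.deg := by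
  have h1 : rk ((pushoutM Γ₁ Γ₂).1.F ⊔ (pushoutM Γ₁ Γ₂).1.join) + rk (⊤ : L) =
      rk (Γ₁.1.F ⊔ Γ₁.1.join) + rk (Γ₂.1.F ⊔ Γ₂.1.join) := by
    have h := Pushout.rk_add (Pushout.mk (Γ₁.1.F ⊔ Γ₁.1.join) (Γ₂.1.F ⊔ Γ₂.1.join) (by
      rw [Γ₁.trace_eq_top_iff.2 le_sup_left, Γ₂.trace_eq_top_iff.2 le_sup_left]))
    change _ + rk (Γ₁.trace (Γ₁.1.F ⊔ Γ₁.1.join)) = _ at h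
    have ht : rk (Γ₁.trace (Γ₁.1.F ⊔ Γ₁.1.join)) = rk (⊤ : L) :=
      congrArg rk (Γ₁.trace_eq_top_iff.2 le_sup_left)
    rw [pushoutM_F_sup_join, ← ht]
    exact h
  have h2 : (pushoutM Γ₁ Γ₂).1.J.length = Γ₁.1.J.length + Γ₂.1.J.length := by
    change (Γ₁.1.J.map (Pushout.inl Γ₁ Γ₂) ++ Γ₂.1.J.map (Pushout.inr Γ₁ Γ₂)).length = _
    rw [List.length_append, List.length_map, List.length_map]
  rw [deg_eq, deg_eq, deg_eq, rk_F, rk_F, rk_F, h2]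
  push_cast
  omega

end ModularDiagram

theorem deg_embed {Γ Γ' : ModularDiagram L} {φ : Γ.1.E → Γ'.1.E} (hφ : IsEmbedding φ)
    (hι : Γ'.1.ι = φ ∘ Γ.1.ι) (hJ : Γ'.1.J = Γ.1.J.map φ) : Γ'.1.deg = Γ.1.deg := by
  have h1 := Diagram.map_F_sup_wsup hφ hι Γ.1.J
  rw [← hJ] at h1
  have h2 : rk (Γ'.1.F ⊔ Γ'.1.join) = rk (Γ.1.F ⊔ Γ.1.join) :=
    (congrArg rk h1.symm).trans (ModularDiagram.rk_embedding hφ hι _)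
  rw [Γ.deg_eq, Γ'.deg_eq, Γ.rk_F, Γ'.rk_F, h2, hJ, List.length_map]

/-- All relations are homogeneous: the first two compare diagrams of equal degree and the others
kill single diagrams. Hence the projection to degree `k` is well defined. -/
theorem respects_ite_deg (k : ℤ) :
    Respects fun Γ : ModularDiagram L => if Γ.1.deg = k then cls Γ else 0 where
  swap Γ Γ' l₁ l₂ a b hJ hΓ' := by
    have h1 : Γ'.1.deg = Γ.1.deg := by
      rw [hΓ']
      have h2 : Γ.1.deg = (Γ.1.withWord (l₁ ++ a :: b :: l₂)).deg := by
        rw [← hJ]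
        rfl
      rw [h2]
      exact Γ.1.deg_withWord_perm ((List.Perm.swap a b l₂).append_left l₁)
    rw [h1, respects_cls.swap Γ Γ' l₁ l₂ a b hJ hΓ']
    split_ifs <;> simp
  embed Γ Γ' φ hφ hrk hι hJ := by
    rw [deg_embed hφ hι hJ, respects_cls.embed Γ Γ' φ hφ hrk hι hJ]
  span Γ h := by
    rw [respects_cls.span Γ h, ite_self]
  prod Γ E₁ E₂ _ _ _ _ _ _ h₁ h₂ e h := by
    rw [respects_cls.prod Γ E₁ E₂ h₁ h₂ e h, ite_self]
  two Γ G hG hF h := by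
    rw [respects_cls.two Γ G hG hF h, ite_self]

theorem MD.cls_mem_grading (Γ : ModularDiagram L) : cls Γ ∈ MD.grading L Γ.1.deg :=
  Submodule.subset_span ⟨Γ, rfl, rfl⟩

theorem MD.isInternal : DirectSum.IsInternal (MD.grading L) := by
  refine isInternal_of_projections (fun k => MD.lift _ (respects_ite_deg k)) (fun i a ha => ?_)
    (fun i j hij a ha => ?_) ?_
  · induction ha using Submodule.span_induction with
    | zero => simp
    | mem a ha =>
      obtain ⟨Γ, hΓ, rfl⟩ := ha
      rw [MD.lift_cls, if_pos hΓ]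
    | add x y _ _ hx hy => rw [map_add, hx, hy]
    | smul c x _ hx => rw [map_smul, hx]
  · induction ha using Submodule.span_induction with
    | zero => simp
    | mem a ha =>
      obtain ⟨Γ, hΓ, rfl⟩ := ha
      rw [MD.lift_cls, if_neg (hΓ ▸ hij.symm)]
    | add x y _ _ hx hy => rw [map_add, hx, hy, add_zero]
    | smul c x _ hx => rw [map_smul, hx, smul_zero]
  · rw [eq_top_iff]
    rintro x -
    induction x using MD.induction with
    | h0 => exact zero_mem _
    | h Γ => exact Submodule.mem_iSup_of_mem _ (MD.cls_mem_grading Γ)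
    | hadd x y hx hy => exact add_mem hx hy
    | hsmul c x hx => exact Submodule.smul_mem _ c hx

theorem MD.mul_mem {i j : ℤ} {a b : MD L} (ha : a ∈ MD.grading L i) (hb : b ∈ MD.grading L j) :
    MD.mul L a b ∈ MD.grading L (i + j) := by
  induction ha using Submodule.span_induction with
  | zero => simp
  | add x y _ _ hx hy => simpa using add_mem hx hy
  | smul c x _ hx => simpa using Submodule.smul_mem _ c hx
  | mem a ha =>
    obtain ⟨Γ₁, h₁, rfl⟩ := ha
    induction hb using Submodule.span_induction with
    | zero => simp
    | add x y _ _ hx hy => simpa using add_mem hx hy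
    | smul c x _ hx => simpa using Submodule.smul_mem _ c hx
    | mem b hb =>
      obtain ⟨Γ₂, h₂, rfl⟩ := hb
      rw [MD.mul_cls, ← h₁, ← h₂, ← ModularDiagram.deg_pushoutM]
      exact MD.cls_mem_grading _

theorem MD.mul_comm {i j : ℤ} {a b : MD L} (ha : a ∈ MD.grading L i) (hb : b ∈ MD.grading L j) :
    MD.mul L a b = ((-1 : ℚ) ^ (i * j)) • MD.mul L b a := by
  induction ha using Submodule.span_induction with
  | zero => simp
  | add x y _ _ hx hy => simp [hx, hy]
  | smul c x _ hx => simp [hx, smul_comm c]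
  | mem a ha =>
    obtain ⟨Γ₁, h₁, rfl⟩ := ha
    induction hb using Submodule.span_induction with
    | zero => simp
    | add x y _ _ hx hy => simp [hx, hy]
    | smul c x _ hx => simp [hx, smul_comm c]
    | mem b hb =>
      obtain ⟨Γ₂, h₂, rfl⟩ := hb
      rw [MD.mul_cls, MD.mul_cls, cls_pushoutM_comm, ← h₁, ← h₂, zpow_mul,
        Γ₁.neg_one_zpow_deg, ← zpow_natCast, ← zpow_mul, _root_.mul_comm (Γ₁.1.J.length : ℤ), zpow_mul,
        Γ₂.neg_one_zpow_deg, zpow_natCast, ← pow_mul, _root_.mul_comm Γ₁.1.J.length,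
        ← Int.cast_smul_eq_zsmul ℚ]
      push_cast
      rfl

theorem deg_unit (hL : IsGeometric L) : (unit hL).1.deg = 0 := by
  have h0 : rk (⊥ : L) = 0 := rk_bot
  have h1 : rk (unit hL).1.join = 0 := h0
  have h2 : (unit hL).1.J.length = 0 := rfl
  have h3 : rk ((unit hL).1.join ⊓ (unit hL).1.F) = 0 :=
    (congrArg rk (bot_inf_eq (⊤ : L))).trans h0
  rw [Diagram.deg, h1, h2, h3]
  simp

/-! ### Alternating sums over the letters of a word -/

/-- The alternating sum of `c a l'` over the letters `a` of a word, with `l'` the word of the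
remaining letters. -/
def altSum {α M : Type*} [AddCommGroup M] (c : α → List α → M) : List α → M
  | [] => 0
  | a :: l => c a l - altSum (fun b l' => c b (a :: l')) l

section altSum

variable {α β M N : Type*} [AddCommGroup M] [AddCommGroup N] {c c' : α → List α → M}

theorem altSum_nil : altSum c [] = 0 := rfl

theorem altSum_cons (a : α) (l : List α) :
    altSum c (a :: l) = c a l - altSum (fun b l' => c b (a :: l')) l := rfl

theorem altSum_eq_sum [Module ℚ M] (l : List α) : altSum c l =
    ∑ i : Fin l.length, (-1 : ℚ) ^ (i : ℕ) • c (l.get i) (l.eraseIdx i) := by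
  induction l generalizing c with
  | nil => simp [altSum_nil]
  | cons a l ih =>
    refine Eq.trans ?_ (Fin.sum_univ_succ (n := l.length) _).symm
    rw [altSum_cons, ih, sub_eq_add_neg, ← Finset.sum_neg_distrib]
    simp [pow_succ]

theorem altSum_congr {l : List α} (h : ∀ a l', (a :: l').Perm l → c a l' = c' a l') :
    altSum c l = altSum c' l := by
  induction l generalizing c c' with
  | nil => rfl
  | cons a l ih =>
    rw [altSum_cons, altSum_cons, h a l (List.Perm.refl _),
      ih fun b l' hl => h b (a :: l') ((List.Perm.swap a b l').trans (hl.cons a))]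

theorem altSum_zero (l : List α) : altSum (fun _ _ => (0 : M)) l = 0 := by
  induction l with
  | nil => rfl
  | cons a l ih => rw [altSum_cons, ih, sub_zero]

theorem altSum_eq_zero {l : List α} (h : ∀ a l', (a :: l').Perm l → c a l' = 0) :
    altSum c l = 0 := (altSum_congr h).trans (altSum_zero l)

theorem altSum_sub (l : List α) :
    altSum (fun a l' => c a l' - c' a l') l = altSum c l - altSum c' l := by
  induction l generalizing c c' with
  | nil => simp [altSum_nil]
  | cons a l ih =>
    rw [altSum_cons, altSum_cons, altSum_cons, ih]
    abel

theorem map_altSum (φ : M →+ N) (l : List α) :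
    φ (altSum c l) = altSum (fun a l' => φ (c a l')) l := by
  induction l generalizing c with
  | nil => simp [altSum_nil]
  | cons a l ih => rw [altSum_cons, altSum_cons, map_sub, ih]

theorem altSum_map {c : β → List β → M} (φ : α → β) (l : List α) :
    altSum c (l.map φ) = altSum (fun a l' => c (φ a) (l'.map φ)) l := by
  induction l generalizing c with
  | nil => rfl
  | cons a l ih =>
    rw [List.map_cons, altSum_cons, altSum_cons, ih]
    rfl

theorem altSum_append (l₁ l₂ : List α) : altSum c (l₁ ++ l₂) =
    altSum (fun a l => c a (l ++ l₂)) l₁ +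
      (-1 : ℤ) ^ l₁.length • altSum (fun a l => c a (l₁ ++ l)) l₂ := by
  induction l₁ generalizing c with
  | nil => simp [altSum_nil]
  | cons a l ih =>
    rw [List.cons_append, altSum_cons, ih, altSum_cons, List.length_cons, pow_succ]
    simp only [List.cons_append, mul_neg, mul_one, neg_smul]
    abel

/-- Exchanging two neighbours exchanges the two terms selecting one of them, which carry opposite
signs; all other terms change sign by hypothesis. -/
theorem IsAlt.altSum (h : ∀ a, IsAlt (c a)) : IsAlt (altSum c) := by
  intro l₁ a b l₂
  induction l₁ generalizing c with
  | nil =>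
    rw [List.nil_append, List.nil_append, altSum_cons, altSum_cons, altSum_cons, altSum_cons]
    have : altSum (fun x l' => c x (a :: b :: l')) l₂ =
        - altSum (fun x l' => c x (b :: a :: l')) l₂ := by
      rw [← zero_sub, ← altSum_zero l₂, ← altSum_sub]
      exact altSum_congr fun x l' _ => by simpa using h x [] a b l'
    rw [this]
    abel
  | cons x l ih =>
    rw [List.cons_append, List.cons_append, altSum_cons, altSum_cons, h x,
      ih fun y => (h y).cons x]
    abel

/-- Selecting `a` and then `b` has the opposite sign to selecting `b` and then `a`. This is the
combinatorial core of `d² = 0`. -/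
theorem altSum_altSum {c : α → α → List α → M} (h : ∀ a b l, c a b l = c b a l) (l : List α) :
    altSum (fun a l' => altSum (c a) l') l = 0 := by
  induction l generalizing c with
  | nil => rfl
  | cons a l ih =>
    simp only [altSum_cons]
    rw [altSum_sub, ih fun x y l' => h x y (a :: l'), sub_zero, sub_eq_zero]
    exact altSum_congr fun b l' _ => h a b l'

end altSum

/-! ### Bridges -/

/-- `H` is spanned by `F_ι` and the letters of `J`. -/
def Diagram.Spans (D : Diagram L) (H : D.E) (J : List D.E) : Prop := H ≤ D.F ⊔ wsup J

/-- Among the flats above `F_ι` and all letters of `J` there is a least one, so the search for a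
flat exhibiting a bridge becomes a single inequality. -/
theorem Diagram.spans_iff {D : Diagram L} {H : D.E} {J : List D.E} :
    D.Spans H J ↔ ∀ G, D.F ≤ G → (∀ K ∈ J, K ≤ G) → H ≤ G :=
  ⟨fun h _ hF hJ => h.trans (sup_le hF (wsup_le_iff.2 hJ)),
    fun h => h _ le_sup_left fun _ hK => (le_wsup hK).trans le_sup_right⟩

theorem Diagram.spans_perm {D : Diagram L} {H : D.E} {J J' : List D.E} (h : J.Perm J') :
    D.Spans H J ↔ D.Spans H J' := by
  rw [Spans, Spans, wsup_perm h]

/-- Let `G` be the join of `F_ι` and the letters other than `H`. Unless the span relation applies,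
`H ⊔ G = ⊤`, and joining embeds `[⊥, G] × [⊥, H]` into `E` with full rank. The diagram thus comes
from a product whose second factor does not meet `F_ι`. -/
theorem cls_eq_zero_of_not_spans [Nontrivial L] (Γ : ModularDiagram L) {H : Γ.1.E}
    {J : List Γ.1.E} (hJ : Γ.1.J.Perm (H :: J)) (hH : ¬ Γ.1.Spans H J) : cls Γ = 0 := by
  have hE := Γ.2.geometric
  have hHa : IsAtom H := Γ.2.atoms H (hJ.mem_iff.2 List.mem_cons_self)
  by_cases hspan : Γ.1.F ⊔ Γ.1.join < ⊤
  · exact respects_cls.span Γ hspan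
  rw [not_lt_top_iff] at hspan
  set G := Γ.1.F ⊔ wsup J with hG
  have hF : Γ.1.F ≤ G := le_sup_left
  have htop : H ⊔ G = ⊤ := by
    rw [← hspan, hG, sup_left_comm, ← wsup_cons, ← wsup_perm hJ]
    rfl
  have hinf : ∀ x, x ≤ G → (H ⊔ x) ⊓ G = x := fun x hx => by
    refine (hE.eq_of_le_of_rk_le (le_inf le_sup_right hx) ?_).symm
    have h1 := hE.rk_atom_sup hHa fun h => hH (h.trans hx)
    have h2 : (H ⊔ x) ⊓ G < H ⊔ x := inf_lt_left.2 fun h => hH (le_sup_left.trans h)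
    have := hE.rk_strictMono h2
    omega
  let φ : Set.Iic G × Set.Iic H → Γ.1.E := fun p => p.2 ⊔ p.1
  have hcases : ∀ y : Set.Iic H, (y : Γ.1.E) = ⊥ ∨ (y : Γ.1.E) = H := fun y => hHa.le_iff.1 y.2
  have hval : ∀ p, φ p ⊓ G = p.1 := fun p => by
    rcases hcases p.2 with h | h
    · change (p.2 ⊔ p.1 : Γ.1.E) ⊓ G = p.1
      rw [h, bot_sup_eq]
      exact inf_eq_left.2 p.1.2
    · change (p.2 ⊔ p.1 : Γ.1.E) ⊓ G = p.1
      rw [h]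
      exact hinf _ p.1.2
  have hval2 : ∀ p, (p.2 : Γ.1.E) = H ↔ H ≤ φ p := fun p => by
    refine ⟨fun h => h.ge.trans le_sup_left, fun h => ?_⟩
    refine (hcases p.2).resolve_left fun h' => hH ?_
    have h2 : H ≤ (p.2 ⊔ p.1 : Γ.1.E) := h
    rw [h', bot_sup_eq] at h2
    exact h2.trans p.1.2
  have hφ : IsEmbedding φ :=
    { injective := fun p q hpq => by
        refine Prod.ext (Subtype.ext ?_) (Subtype.ext ?_)
        · rw [← hval p, hpq, hval]
        · have h := hval2 p
          rw [hpq, ← hval2 q] at h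
          rcases hcases p.2 with hp | hp <;> rcases hcases q.2 with hq | hq
          · rw [hp, hq]
          · exact (h.2 hq).trans hq.symm
          · exact hp.trans (h.1 hp).symm
          · rw [hp, hq]
      map_sup := fun p q => sup_sup_sup_comm _ _ _ _
      map_atom := fun p hp => by
        rcases isAtom_prod_iff.1 hp with ⟨h1, h2⟩ | ⟨h1, h2⟩
        · have : φ p = p.1 := by
            change (p.2 ⊔ p.1 : Γ.1.E) = p.1
            rw [h2]
            exact bot_sup_eq _
          rw [this]
          exact h1.of_isAtom_coe_Iic
        · have : φ p = p.2 := by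
            change (p.2 ⊔ p.1 : Γ.1.E) = p.2
            rw [h1]
            exact sup_bot_eq _
          rw [this]
          exact h2.of_isAtom_coe_Iic }
  have hA := (hE.Iic G).1
  have hB := (hE.Iic H).1
  have hι := (Γ.2.extension.codRestrict_Iic hE hF).prod_bot hA hB
  classical
  -- Every letter other than `H` lies below `G`, so the word lifts to the product.
  let ψ : Γ.1.E → Set.Iic G × Set.Iic H := fun K =>
    if h : K ≤ G then (⟨K, h⟩, ⊥) else (⊥, ⟨H, le_rfl⟩)
  have hψ : ∀ K ∈ Γ.1.J, φ (ψ K) = K ∧ IsAtom (ψ K) := fun K hK => by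
    by_cases h : K ≤ G
    · have : ψ K = (⟨K, h⟩, ⊥) := dif_pos h
      rw [this]
      exact ⟨bot_sup_eq _, isAtom_prod_iff.2 (Or.inl ⟨(Γ.2.atoms K hK).Iic h, rfl⟩)⟩
    · have hKH : K = H := by
        refine (List.mem_cons.1 (hJ.mem_iff.1 hK)).resolve_right fun hKJ => h ?_
        exact (le_wsup hKJ).trans le_sup_right
      have : ψ K = (⊥, ⟨H, le_rfl⟩) := dif_neg h
      rw [this, hKH]
      exact ⟨sup_bot_eq _, isAtom_prod_iff.2 (Or.inr ⟨rfl, hHa.Iic le_rfl⟩)⟩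
  let Γ' : ModularDiagram L := ⟨{ E := Set.Iic G × Set.Iic H, ι := _, J := Γ.1.J.map ψ },
    (hA.prod hB).1, hι, fun K hK => by
      obtain ⟨K', hK', rfl⟩ := List.mem_map.1 hK
      exact (hψ K' hK').2⟩
  have h1 : cls Γ' = cls Γ := by
    refine respects_cls.embed Γ' Γ φ hφ ?_ (funext fun x => (bot_sup_eq (Γ.1.ι x)).symm) ?_
    · change rk (⊤ : Set.Iic G × Set.Iic H) = rk (⊤ : Γ.1.E)
      rw [(hA.prod hB).2, ← htop, hE.rk_atom_sup hHa hH, ← hE.rk_atom hHa]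
      exact congrArg₂ (· + ·) ((hE.Iic G).2 _) ((hE.Iic H).2 _)
    · change Γ.1.J = (Γ.1.J.map ψ).map φ
      rw [List.map_map]
      conv_lhs => rw [← List.map_id Γ.1.J]
      exact List.map_congr_left fun K hK => (hψ K hK).1.symm
  have : Nontrivial (Set.Iic G) := ⟨⟨⟨Γ.1.F, hF⟩, ⊥, fun h =>
    Γ.2.extension.top_ne_bot (congrArg Subtype.val h)⟩⟩
  have : Nontrivial (Set.Iic H) := ⟨⟨⟨H, le_rfl⟩, ⊥, fun h => hHa.1 (congrArg Subtype.val h)⟩⟩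
  rw [← h1]
  exact respects_cls.prod Γ' (Set.Iic G) (Set.Iic H) hA hB (OrderIso.refl _) rfl

/-! ### The differential -/

open Classical in
/-- The contribution of the letter `H` to the differential, with `J` the word of the remaining
letters. -/
noncomputable def Diagram.dTerm (D : Diagram L) (H : D.E) (J : List D.E) : MD L :=
  if D.Spans H J then extendD cls (D.contractAt H J) else 0

theorem Diagram.dTerm_of_spans {D : Diagram L} {H : D.E} {J : List D.E} (h : D.Spans H J) :
    D.dTerm H J = extendD cls (D.contractAt H J) := if_pos h

theorem Diagram.dTerm_of_not_spans {D : Diagram L} {H : D.E} {J : List D.E} (h : ¬ D.Spans H J) :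
    D.dTerm H J = 0 := if_neg h

theorem Diagram.isAlt_dTerm (D : Diagram L) (H : D.E) : IsAlt (D.dTerm H) := by
  intro l₁ a b l₂
  have h1 := Diagram.spans_perm (D := D) (H := H) ((List.Perm.swap a b l₂).append_left l₁)
  by_cases h : D.Spans H (l₁ ++ a :: b :: l₂)
  · rw [dTerm_of_spans h, dTerm_of_spans (h1.2 h)]
    exact (((respects_cls.isAlt (D.contractAt H [])).map fun K => ⟨H ⊔ K, le_sup_left⟩) l₁ a b l₂)
  · rw [dTerm_of_not_spans h, dTerm_of_not_spans (fun h' => h (h1.1 h')), neg_zero]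

/-- The differential of a diagram. -/
noncomputable def Diagram.dSum (D : Diagram L) : MD L := altSum D.dTerm D.J

theorem Diagram.isAlt_dSum (D : Diagram L) : IsAlt fun J => (D.withWord J).dSum :=
  IsAlt.altSum D.isAlt_dTerm

/-! ### Compatibility of the differential with the relations. -/

theorem Diagram.dTerm_embed [Nontrivial L] {Γ Γ' : ModularDiagram L} {φ : Γ.1.E → Γ'.1.E}
    (hφ : IsEmbedding φ) (hrk : rk (⊤ : Γ.1.E) = rk (⊤ : Γ'.1.E)) (hι : Γ'.1.ι = φ ∘ Γ.1.ι)
    {H : Γ.1.E} {J : List Γ.1.E} (hH : IsAtom H) (hJ : ∀ K ∈ J, IsAtom K) :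
    Γ.1.dTerm H J = Γ'.1.dTerm (φ H) (J.map φ) := by
  have hE := Γ.2.geometric
  have hE' := Γ'.2.geometric
  have h1 : Γ'.1.Spans (φ H) (J.map φ) ↔ Γ.1.Spans H J := by
    rw [Spans, Spans, ← Diagram.map_F_sup_wsup hφ hι, hφ.le_iff]
  by_cases hs : Γ.1.Spans H J
  swap
  · rw [dTerm_of_not_spans hs, dTerm_of_not_spans fun h => hs (h1.1 h)]
  rw [dTerm_of_spans hs, dTerm_of_spans (h1.2 hs)]
  have hF : Γ'.1.F = φ Γ.1.F := congrFun hι ⊤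
  have hJ' : ∀ K ∈ J.map φ, IsAtom K := fun K hK => by
    obtain ⟨K', hK', rfl⟩ := List.mem_map.1 hK
    exact hφ.map_atom K' (hJ K' hK')
  have h2 : (Γ'.1.contractAt (φ H) (J.map φ)).IsModular ↔ (Γ.1.contractAt H J).IsModular := by
    rw [contractAt_isModular_iff _ hE Γ.2.extension hH hJ,
      contractAt_isModular_iff _ hE' Γ'.2.extension (hφ.map_atom H hH) hJ', hF, hφ.le_iff,
      List.mem_map_of_injective hφ.injective]
  by_cases hm : (Γ.1.contractAt H J).IsModular
  swap
  · rw [extendD_of_not_isModular hm, extendD_of_not_isModular fun h => hm (h2.1 h)]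
  rw [extendD_of_isModular hm, extendD_of_isModular (h2.2 hm)]
  -- The embedding restricts to the intervals above `H` and `φ H`. Both ranks drop by `rk H = rk (φ
  -- H)`, so full rank is kept.
  let ψ : Set.Ici H → Set.Ici (φ H) := fun x => ⟨φ x, hφ.le_iff.2 x.2⟩
  have hψ : IsEmbedding ψ := by
    refine ⟨fun x y hxy => Subtype.ext (hφ.injective (congrArg Subtype.val hxy)),
      fun x y => Subtype.ext (hφ.map_sup _ _), fun x hx => ?_⟩
    have h3 := Set.Ici.isAtom_iff.1 hx
    obtain ⟨a, ha, hax, haH⟩ := hE.exists_atom h3.lt.not_ge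
    have h4 : (x : Γ.1.E) = a ⊔ H := by rw [sup_comm, covBy_sup_eq h3 hax haH]
    refine Set.Ici.isAtom_iff.2 ?_
    change φ H ⋖ φ x
    rw [h4, hφ.map_sup]
    exact hE'.covBy_atom_sup (hφ.map_atom a ha) fun h => haH (hφ.le_iff.1 h)
  refine respects_cls.embed ⟨_, hm⟩ ⟨_, h2.2 hm⟩ ψ hψ ?_ ?_ ?_
  · have h3 := (hE.Ici H).2 ⊤
    have h4 := (hE'.Ici (φ H)).2 ⊤
    have h5 := ModularDiagram.rk_embedding hφ hι H
    change rk (⊤ : Set.Ici H) + _ = rk (⊤ : Γ.1.E) at h3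
    change rk (⊤ : Set.Ici (φ H)) + _ = rk (⊤ : Γ'.1.E) at h4
    change rk (⊤ : Set.Ici H) = rk (⊤ : Set.Ici (φ H))
    omega
  · refine funext fun x => Subtype.ext ?_
    change φ H ⊔ Γ'.1.ι x = φ (H ⊔ Γ.1.ι x)
    rw [hφ.map_sup, hι]
    rfl
  · change (J.map φ).map _ = (J.map _).map ψ
    rw [List.map_map, List.map_map]
    exact List.map_congr_left fun K _ => Subtype.ext (hφ.map_sup H K).symm

theorem Diagram.dTerm_orderIso [Nontrivial L] {Γ Γ' : ModularDiagram L} (e : Γ.1.E ≃o Γ'.1.E)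
    (hι : ∀ x, Γ'.1.ι x = e (Γ.1.ι x)) {H : Γ.1.E} {J : List Γ.1.E} (hH : IsAtom H)
    (hJ : ∀ K ∈ J, IsAtom K) : Γ.1.dTerm H J = Γ'.1.dTerm (e H) (J.map e) :=
  dTerm_embed (IsEmbedding.of_orderIso e) (by rw [← rk_orderIso e, e.map_top]) (funext hι) hH hJ

/-- The interval above an element of a product. -/
def IciProd {A B C : Type u} [Lattice A] [Lattice B] [Lattice C] (e : A ≃o B × C) (H : A) :
    Set.Ici H ≃o Set.Ici (e H).1 × Set.Ici (e H).2 where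
  toFun x := (⟨(e x).1, (e.monotone x.2).1⟩, ⟨(e x).2, (e.monotone x.2).2⟩)
  invFun p := ⟨e.symm (p.1, p.2), by
    have : e H ≤ (p.1.1, p.2.1) := ⟨p.1.2, p.2.2⟩
    rwa [← e.le_symm_apply] at this⟩
  left_inv x := Subtype.ext (by simp)
  right_inv p := by simp
  map_rel_iff' {x y} := by
    change ((e x).1 ≤ (e y).1 ∧ (e x).2 ≤ (e y).2) ↔ x ≤ y
    rw [← Prod.le_def, e.le_iff_le]
    rfl

theorem dSum_span (Γ : ModularDiagram L) (h : Γ.1.F ⊔ Γ.1.join < ⊤) : Γ.1.dSum = 0 := by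
  refine altSum_eq_zero fun H J hJ => ?_
  by_cases hs : Γ.1.Spans H J
  swap
  · exact Diagram.dTerm_of_not_spans hs
  rw [Diagram.dTerm_of_spans hs]
  by_cases hm : (Γ.1.contractAt H J).IsModular
  swap
  · exact extendD_of_not_isModular hm
  rw [extendD_of_isModular hm]
  have hle : ∀ K ∈ H :: J, K ≤ Γ.1.F ⊔ Γ.1.join := fun K hK =>
    (Diagram.join_le_iff.1 le_rfl K (hJ.mem_iff.1 hK)).trans le_sup_right
  have hH := hle H List.mem_cons_self
  let G : Set.Ici H := ⟨Γ.1.F ⊔ Γ.1.join, hH⟩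
  have hG : (⟨H ⊔ Γ.1.F, le_sup_left⟩ : Set.Ici H) ⊔ (Γ.1.contractAt H J).join ≤ G := by
    refine sup_le (sup_le hH le_sup_left) (Diagram.join_le_iff.2 fun K hK => ?_)
    obtain ⟨K', hK', rfl⟩ := List.mem_map.1 hK
    exact sup_le hH (hle K' (List.mem_cons_of_mem H hK'))
  exact respects_cls.span ⟨_, hm⟩ (hG.trans_lt h)

theorem dSum_prod [Nontrivial L] (Γ : ModularDiagram L) (E₁ E₂ : Type u) [Lattice E₁]
    [BoundedOrder E₁] [Lattice E₂] [BoundedOrder E₂] [Nontrivial E₁] [Nontrivial E₂]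
    (h₁ : IsGeometric E₁) (h₂ : IsGeometric E₂) (e : Γ.1.E ≃o E₁ × E₂) (h : (e Γ.1.F).2 = ⊥) :
    Γ.1.dSum = 0 := by
  refine altSum_eq_zero fun H J hJ => ?_
  by_cases hs : Γ.1.Spans H J
  swap
  · exact Diagram.dTerm_of_not_spans hs
  rw [Diagram.dTerm_of_spans hs]
  by_cases hm : (Γ.1.contractAt H J).IsModular
  swap
  · exact extendD_of_not_isModular hm
  rw [extendD_of_isModular hm]
  have hat : ∀ K ∈ H :: J, IsAtom K := fun K hK => Γ.2.atoms K (hJ.mem_iff.1 hK)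
  have hHa := hat H List.mem_cons_self
  have hJa : ∀ K ∈ J, IsAtom K := fun K hK => hat K (List.mem_cons_of_mem H hK)
  obtain ⟨hHF, hHJ⟩ := (Γ.1.contractAt_isModular_iff Γ.2.geometric Γ.2.extension hHa hJa).1 hm
  have hF : Γ.1.F ≠ ⊥ := Γ.2.extension.top_ne_bot
  -- The contracted factors must stay non-trivial. If `H` filled the first factor, `F_ι ≠ ⊥` would
  -- fill it too, and `H` would lie below `F_ι`.
  have hne1 : (e H).1 ≠ ⊤ := by
    intro he
    rcases isAtom_prod_iff.1 ((e.isAtom_iff H).2 hHa) with h1 | h1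
    · have h2 : (e Γ.1.F).1 ≠ ⊥ := fun h3 => hF (by
        rw [← map_eq_bot_iff e]
        exact Prod.ext h3 h)
      have h3 : (e Γ.1.F).1 = ⊤ :=
        (((he ▸ h1.1 : IsAtom (⊤ : E₁)).le_iff.1 le_top).resolve_left h2)
      refine hHF (e.le_iff_le.1 ⟨?_, ?_⟩)
      · rw [h3]
        exact le_top
      · rw [h1.2]
        exact bot_le
    · exact bot_ne_top (h1.1.symm.trans he)
  -- If `H` filled the second factor, all other letters would lie in the first one, and `H` would be
  -- a bridge.
  have hne2 : (e H).2 ≠ ⊤ := by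
    intro he
    rcases isAtom_prod_iff.1 ((e.isAtom_iff H).2 hHa) with h1 | h1
    · exact bot_ne_top (h1.2.symm.trans he)
    · have h4 : H ≤ e.symm (⊤, ⊥) := by
        refine Diagram.spans_iff.1 hs _ ?_ fun K hK => ?_
        · rw [← e.le_iff_le, e.apply_symm_apply]
          exact ⟨le_top, h.le⟩
        · rw [← e.le_iff_le, e.apply_symm_apply]
          refine ⟨le_top, ?_⟩
          rcases isAtom_prod_iff.1 ((e.isAtom_iff K).2 (hJa K hK)) with h2 | h2
          · exact h2.2.le
          · refine absurd (e.injective (Prod.ext (h1.1.trans h2.1.symm) ?_) : H = K)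
              fun hHK => hHJ (hHK ▸ hK)
            rw [he]
            exact (((he ▸ h1.2 : IsAtom (⊤ : E₂)).le_iff.1 le_top).resolve_left h2.2.1).symm
      rw [← e.le_iff_le, e.apply_symm_apply] at h4
      exact h1.2.1 (le_bot_iff.1 h4.2)
  have : Nontrivial (Set.Ici (e H).1) := ⟨⊤, ⊥, fun h => hne1 (congrArg Subtype.val h).symm⟩
  have : Nontrivial (Set.Ici (e H).2) := ⟨⊤, ⊥, fun h => hne2 (congrArg Subtype.val h).symm⟩
  refine respects_cls.prod ⟨_, hm⟩ (Set.Ici (e H).1) (Set.Ici (e H).2) (h₁.Ici _).1 (h₂.Ici _).1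
    (IciProd e H) (Subtype.ext ?_)
  change (e (H ⊔ Γ.1.F)).2 = (e H).2
  rw [e.map_sup, Prod.snd_sup, h, sup_bot_eq]

/-- The restriction to the interval below `G ≥ F_ι`, with the traces on `G` of a given word. -/
def Diagram.restrict (D : Diagram L) (G : D.E) (hG : ∀ x, D.ι x ≤ G) (J : List D.E) :
    Diagram L where
  E := Set.Iic G
  ι x := ⟨D.ι x, hG x⟩
  J := J.map fun K => ⟨G ⊓ K, inf_le_left⟩

/-- The modular flat `G` is a complement of the atom `a`, so `x ↦ a ⊔ x` identifies `[⊥, G]` with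
`[a, ⊤]`. The result involves `a` and `b` only through `a ⊔ b`, hence symmetrically. -/
theorem ModularDiagram.contractAt_eq_restrict (Γ : ModularDiagram L) {G a : Γ.1.E}
    (hG : IsModularElt G) (hF : ∀ x, Γ.1.ι x ≤ G) (ha : IsAtom a) (haG : ¬ a ≤ G)
    (htop : a ⊔ G = ⊤) (b : Γ.1.E) {l : List Γ.1.E} (hl : ∀ K ∈ l, K ≤ G) :
    extendD cls (Γ.1.contractAt a (b :: l)) =
      extendD cls (Γ.1.restrict G hF ((a ⊔ b) :: l)) := by
  have hE := Γ.2.geometric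
  have hleft : ∀ x, x ≤ G → (a ⊔ x) ⊓ G = x := fun x hx => by
    rw [hG.inf_sup_eq hE hx, hE.inf_atom ha haG, bot_sup_eq]
  have hright : ∀ y, a ≤ y → a ⊔ y ⊓ G = y := fun y hy => by
    rw [← hG.inf_sup_eq_of_le hE hy, htop, inf_top_eq]
  let e : Set.Iic G ≃o Set.Ici a :=
    { toFun := fun x => ⟨a ⊔ x, le_sup_left⟩
      invFun := fun y => ⟨y ⊓ G, inf_le_right⟩
      left_inv := fun x => Subtype.ext (hleft x x.2)
      right_inv := fun y => Subtype.ext (hright y y.2)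
      map_rel_iff' := fun {x y} => by
        refine ⟨fun h => ?_, fun h => sup_le_sup_left (show (x : Γ.1.E) ≤ y from h) a⟩
        have h1 : (a ⊔ x : Γ.1.E) ≤ a ⊔ y := h
        have h2 := inf_le_inf_right G h1
        rwa [hleft x x.2, hleft y y.2] at h2 }
  refine (respects_cls.orderIso (D := Γ.1.restrict G hF ((a ⊔ b) :: l))
    (D' := Γ.1.contractAt a (b :: l)) e (fun _ => rfl) ?_).symm
  refine Eq.trans ?_ (List.map_map (f := fun K => (⟨G ⊓ K, inf_le_left⟩ : Set.Iic G)) (g := e)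
    (l := (a ⊔ b) :: l)).symm
  refine congrArg₂ List.cons (Subtype.ext ?_) (List.map_congr_left fun K hK => Subtype.ext ?_)
  · change a ⊔ b = a ⊔ G ⊓ (a ⊔ b)
    rw [inf_comm, hright _ le_sup_left]
  · change a ⊔ K = a ⊔ G ⊓ K
    rw [inf_eq_right.2 (hl K hK)]

/-- The terms of `a` and `b` agree and carry opposite signs. Contracting a letter `c` below `G`
leaves exactly two letters outside the modular flat `c ⊔ G`, so that term is zero by the same
relation. -/
theorem dSum_two [Nontrivial L] (Γ : ModularDiagram L) (G : Γ.1.E) (hG : IsModularElt G)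
    (hF : Γ.1.F ≤ G)
    (h : ∃ a b l, Γ.1.J = a :: b :: l ∧ ¬ a ≤ G ∧ ¬ b ≤ G ∧ ∀ K ∈ l, K ≤ G) :
    Γ.1.dSum = 0 := by
  obtain ⟨a, b, l, hJ, ha, hb, hl⟩ := h
  have hE := Γ.2.geometric
  have haa : IsAtom a := Γ.2.atoms a (by simp [hJ])
  have hba : IsAtom b := Γ.2.atoms b (by simp [hJ])
  by_cases hspan : Γ.1.F ⊔ Γ.1.join < ⊤
  · exact dSum_span Γ hspan
  rw [not_lt_top_iff] at hspan
  have hX : Γ.1.F ⊔ wsup l ≤ G := sup_le hF (wsup_le_iff.2 hl)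
  have htop : a ⊔ (b ⊔ (Γ.1.F ⊔ wsup l)) = ⊤ := by
    rw [← hspan, sup_left_comm b, ← wsup_cons, sup_left_comm a, ← wsup_cons, ← hJ]
    rfl
  -- Neither letter is below the join of `F_ι` and `l`, so by exchange both are spanned or neither
  -- is.
  have hab : Γ.1.Spans a (b :: l) ↔ Γ.1.Spans b (a :: l) := by
    rw [Diagram.Spans, Diagram.Spans, wsup_cons, wsup_cons, sup_left_comm, sup_left_comm _ a]
    exact ⟨hE.exchange haa hba fun h => ha (h.trans hX), hE.exchange hba haa fun h =>
      hb (h.trans hX)⟩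
  have h1 : Γ.1.dTerm a (b :: l) = Γ.1.dTerm b (a :: l) := by
    by_cases hs : Γ.1.Spans a (b :: l)
    swap
    · rw [Diagram.dTerm_of_not_spans hs, Diagram.dTerm_of_not_spans fun h => hs (hab.2 h)]
    have hs' := hab.1 hs
    have htb : b ⊔ G = ⊤ := by
      rw [Diagram.Spans, wsup_cons, sup_left_comm] at hs
      rw [← top_le_iff, ← htop]
      exact (sup_le hs le_rfl).trans (sup_le_sup_left hX b)
    have hta : a ⊔ G = ⊤ := by
      rw [Diagram.Spans, wsup_cons, sup_left_comm] at hs'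
      rw [← top_le_iff, ← htop, sup_left_comm]
      exact (sup_le hs' le_rfl).trans (sup_le_sup_left hX a)
    have hι : ∀ x, Γ.1.ι x ≤ G := fun x => (Γ.2.extension.le_top x).trans hF
    rw [Diagram.dTerm_of_spans hs, Diagram.dTerm_of_spans hs',
      Γ.contractAt_eq_restrict hG hι haa ha hta b hl,
      Γ.contractAt_eq_restrict hG hι hba hb htb a hl, sup_comm]
  have h2 : altSum (fun c l' => Γ.1.dTerm c (a :: b :: l')) l = 0 := by
    refine altSum_eq_zero fun c l' hc => ?_
    by_cases hs : Γ.1.Spans c (a :: b :: l')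
    swap
    · exact Diagram.dTerm_of_not_spans hs
    rw [Diagram.dTerm_of_spans hs]
    by_cases hm : (Γ.1.contractAt c (a :: b :: l')).IsModular
    swap
    · exact extendD_of_not_isModular hm
    have hle : ∀ K ∈ c :: l', K ≤ G := fun K hK => hl K (hc.mem_iff.1 hK)
    rw [extendD_of_isModular hm]
    refine respects_cls.two ⟨_, hm⟩ (⟨c ⊔ G, le_sup_left⟩ : Set.Ici c) (hG.Ici hE c)
      (sup_le_sup_left hF c) ⟨_, _, _, rfl, fun h => ?_, fun h => ?_, fun K hK => ?_⟩
    · exact ha ((le_sup_right.trans h).trans (sup_le (hle c List.mem_cons_self) le_rfl))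
    · exact hb ((le_sup_right.trans h).trans (sup_le (hle c List.mem_cons_self) le_rfl))
    · obtain ⟨K', hK', rfl⟩ := List.mem_map.1 hK
      exact sup_le_sup_left (hle K' (List.mem_cons_of_mem c hK')) c
  rw [Diagram.dSum, hJ, altSum_cons, altSum_cons, h1, h2, sub_zero, sub_self]

theorem respects_dSum [Nontrivial L] : Respects fun Γ : ModularDiagram L => Γ.1.dSum where
  swap Γ Γ' l₁ l₂ a b hJ hΓ' := by
    have h1 : (Γ.1.withWord (l₁ ++ a :: b :: l₂)).dSum =
        -(Γ.1.withWord (l₁ ++ b :: a :: l₂)).dSum := Γ.1.isAlt_dSum l₁ a b l₂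
    rw [← hJ, ← hΓ'] at h1
    exact h1
  embed Γ Γ' φ hφ hrk hι hJ := by
    rw [Diagram.dSum, Diagram.dSum, hJ, altSum_map]
    refine altSum_congr fun H J hHJ => ?_
    have hat : ∀ K ∈ H :: J, IsAtom K := fun K hK => Γ.2.atoms K (hHJ.mem_iff.1 hK)
    exact Diagram.dTerm_embed hφ hrk hι (hat H List.mem_cons_self) fun K hK =>
      hat K (List.mem_cons_of_mem H hK)
  span := dSum_span
  prod := dSum_prod
  two := dSum_two

variable (L) in
/-- The differential on the space of modular diagrams. -/
noncomputable def MD.d [Nontrivial L] : MD L →ₗ[ℚ] MD L := MD.lift _ respects_dSum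

theorem MD.d_cls [Nontrivial L] (Γ : ModularDiagram L) : MD.d L (cls Γ) = Γ.1.dSum :=
  MD.lift_cls respects_dSum Γ

/-! ### Comparison with the contractible letters -/

section Contractible

variable {Γ : ModularDiagram L}

theorem Diagram.isContractible_iff (hΓ : Γ.1.J.Nodup) {H : Γ.1.E} {J : List Γ.1.E}
    (hJ : (H :: J).Perm Γ.1.J) :
    Γ.1.IsContractible H ↔ Γ.1.Spans H J ∧ ¬ H ≤ Γ.1.F := by
  have hmem : H ∈ Γ.1.J := hJ.mem_iff.1 List.mem_cons_self
  have hHJ : H ∉ J := (List.nodup_cons.1 (hJ.nodup_iff.2 hΓ)).1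
  have h1 : Γ.1.IsBridge H ↔ ¬ Γ.1.Spans H J := by
    rw [Diagram.spans_iff, Diagram.IsBridge]
    push Not
    refine (and_iff_right hmem).trans (exists_congr fun G => and_congr_right fun _ => ?_)
    rw [and_comm]
    refine and_congr_left fun _ => ⟨fun h K hK => ?_, fun h K hK hne => ?_⟩
    · exact h K (hJ.mem_iff.1 (List.mem_cons_of_mem H hK)) fun he => hHJ (he ▸ hK)
    · exact h K ((List.mem_cons.1 (hJ.mem_iff.2 hK)).resolve_left hne)
  rw [Diagram.IsContractible, h1, not_not, and_iff_right hmem]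

theorem contract_isModular [Nontrivial L] (hΓ : Γ.1.J.Nodup) {i : Fin Γ.1.J.length}
    (hi : Γ.1.IsContractible (Γ.1.J.get i)) : (Γ.1.contract i).IsModular := by
  have hp : (Γ.1.J.get i :: Γ.1.J.eraseIdx i).Perm Γ.1.J :=
    List.getElem_cons_eraseIdx_perm i.2
  have hat : ∀ K ∈ Γ.1.J.get i :: Γ.1.J.eraseIdx i, IsAtom K := fun K hK =>
    Γ.2.atoms K (hp.mem_iff.1 hK)
  exact (Diagram.contractAt_isModular_iff Γ.1 Γ.2.geometric Γ.2.extension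
    (hat _ List.mem_cons_self) fun K hK => hat K (List.mem_cons_of_mem _ hK)).2
    ⟨hi.2.2, (List.nodup_cons.1 (hp.nodup_iff.2 hΓ)).1⟩

-- The non-contractible letters contribute nothing: bridges by the definition of `dTerm`, letters
-- below `F_ι` because the contraction there is not a modular diagram.
open Classical in
theorem MD.d_cls_eq_sum [Nontrivial L] (hΓ : Γ.1.J.Nodup) : MD.d L (cls Γ) =
    ∑ i : Fin Γ.1.J.length, if h : Γ.1.IsContractible (Γ.1.J.get i) then
      ((-1 : ℚ) ^ (i : ℕ)) • cls ⟨Γ.1.contract i, contract_isModular hΓ h⟩ else 0 := by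
  rw [MD.d_cls, Diagram.dSum, altSum_eq_sum]
  refine Finset.sum_congr rfl fun i _ => ?_
  have hp : (Γ.1.J.get i :: Γ.1.J.eraseIdx i).Perm Γ.1.J :=
    List.getElem_cons_eraseIdx_perm i.2
  have hiff := Diagram.isContractible_iff hΓ hp
  split_ifs with h
  · rw [Diagram.dTerm_of_spans (hiff.1 h).1, ← Diagram.contract_eq,
      extendD_of_isModular (contract_isModular hΓ h)]
  · by_cases hs : Γ.1.Spans (Γ.1.J.get i) (Γ.1.J.eraseIdx i)
    · rw [Diagram.dTerm_of_spans hs, extendD_of_not_isModular, smul_zero]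
      have hat : ∀ K ∈ Γ.1.J.get i :: Γ.1.J.eraseIdx i, IsAtom K := fun K hK =>
        Γ.2.atoms K (hp.mem_iff.1 hK)
      rw [Diagram.contractAt_isModular_iff Γ.1 Γ.2.geometric Γ.2.extension
        (hat _ List.mem_cons_self) fun K hK => hat K (List.mem_cons_of_mem _ hK)]
      exact fun h' => h (hiff.2 ⟨hs, h'.1⟩)
    · rw [Diagram.dTerm_of_not_spans hs, smul_zero]

/-- A letter not below `F_ι` would have to be a bridge. If all letters are below `F_ι`, then `F_ι`
and `J` do not generate `⊤`. -/
theorem cls_eq_zero_of_not_isContractible [Nontrivial L] (hc : ¬ ∃ H, Γ.1.IsContractible H)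
    (hF : Γ.1.F ≠ ⊤) : cls Γ = 0 := by
  by_cases hΓ : Γ.1.J.Nodup
  swap
  · exact cls_eq_zero_of_not_nodup hΓ
  by_cases hle : ∀ H ∈ Γ.1.J, H ≤ Γ.1.F
  · refine respects_cls.span Γ ?_
    rw [sup_eq_left.2 (Diagram.join_le_iff.2 hle)]
    exact hF.lt_top
  · push Not at hle
    obtain ⟨H, hH, hHF⟩ := hle
    obtain ⟨l₁, l₂, hl⟩ := List.append_of_mem hH
    have hp : Γ.1.J.Perm (H :: (l₁ ++ l₂)) := hl ▸ List.perm_middle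
    refine cls_eq_zero_of_not_spans Γ hp fun hs => hc ⟨H, ?_⟩
    exact (Diagram.isContractible_iff hΓ hp.symm).2 ⟨hs, hHF⟩

end Contractible

/-! ### The differential has degree one -/

theorem Diagram.contractAt_F_sup_join (D : Diagram L) (H : D.E) (J : List D.E) :
    ((D.contractAt H J).F ⊔ (D.contractAt H J).join : (D.contractAt H J).E) =
      (⟨D.F ⊔ wsup (H :: J), by
        rw [wsup_cons]
        exact le_sup_left.trans le_sup_right⟩ : Set.Ici H) := by
  have hH : H ≤ D.F ⊔ wsup (H :: J) := by
    rw [wsup_cons]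
    exact le_sup_left.trans le_sup_right
  let G : Set.Ici H := ⟨D.F ⊔ wsup (H :: J), hH⟩
  let X : Set.Ici H := (⟨H ⊔ D.F, le_sup_left⟩ : Set.Ici H) ⊔ (D.contractAt H J).join
  have h1 : X ≤ G := by
    refine sup_le (sup_le hH le_sup_left) (Diagram.join_le_iff.2 fun K hK => ?_)
    obtain ⟨K', hK', rfl⟩ := List.mem_map.1 hK
    exact sup_le hH ((le_wsup (List.mem_cons_of_mem H hK')).trans le_sup_right)
  have h2 : (⟨H ⊔ D.F, le_sup_left⟩ : Set.Ici H) ≤ X := le_sup_left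
  have h3 : ((D.contractAt H J).join : Set.Ici H) ≤ X := le_sup_right
  have h4 : D.F ⊔ wsup (H :: J) ≤ X := by
    refine sup_le (le_sup_right.trans h2) (wsup_le_iff.2 fun K hK => ?_)
    rcases List.mem_cons.1 hK with rfl | hK
    · exact X.2
    · exact le_sup_right.trans (Diagram.join_le_iff.1 h3 _ (List.mem_map_of_mem hK))
  exact le_antisymm h1 h4

/-- One letter is lost, and `rk (F_ι ⊔ ⋁ J)`, which counts with weight `-2`, drops by one; the
change is `-1 + 2`. -/
theorem ModularDiagram.deg_contractAt (Γ : ModularDiagram L) {H : Γ.1.E} {J : List Γ.1.E}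
    (hJ : (H :: J).Perm Γ.1.J) (hm : (Γ.1.contractAt H J).IsModular) :
    (Γ.1.contractAt H J).deg = Γ.1.deg + 1 := by
  have h1 := ModularDiagram.deg_eq ⟨_, hm⟩
  have h2 : rk ((Γ.1.contractAt H J).F ⊔ (Γ.1.contractAt H J).join) + rk H =
      rk (Γ.1.F ⊔ Γ.1.join) := by
    rw [Diagram.contractAt_F_sup_join]
    refine ((Γ.2.geometric.Ici H).2 _).trans ?_
    exact congrArg (fun s => rk (Γ.1.F ⊔ s)) (wsup_perm hJ)
  have h3 := ModularDiagram.rk_F ⟨_, hm⟩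
  have h4 : (Γ.1.contractAt H J).J.length + 1 = Γ.1.J.length := by
    rw [← hJ.length_eq]
    exact congrArg (· + 1) (List.length_map _)
  have h5 := Γ.2.geometric.rk_atom (Γ.2.atoms H (hJ.mem_iff.1 List.mem_cons_self))
  have h6 := Γ.rk_F
  dsimp only at h1 h3
  rw [h1, Γ.deg_eq]
  omega

theorem MD.d_mem [Nontrivial L] {i : ℤ} {a : MD L} (ha : a ∈ MD.grading L i) :
    MD.d L a ∈ MD.grading L (i + 1) := by
  induction ha using Submodule.span_induction with
  | zero => simp
  | add x y _ _ hx hy => simpa using add_mem hx hy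
  | smul c x _ hx => simpa using Submodule.smul_mem _ c hx
  | mem a ha =>
    obtain ⟨Γ, rfl, rfl⟩ := ha
    rw [MD.d_cls, Diagram.dSum, altSum_eq_sum]
    refine Submodule.sum_mem _ fun i _ => Submodule.smul_mem _ _ ?_
    have hp : (Γ.1.J.get i :: Γ.1.J.eraseIdx i).Perm Γ.1.J :=
      List.getElem_cons_eraseIdx_perm i.2
    rw [Diagram.dTerm]
    split_ifs
    · by_cases hm : (Γ.1.contractAt (Γ.1.J.get i) (Γ.1.J.eraseIdx i)).IsModular
      · rw [extendD_of_isModular hm, ← Γ.deg_contractAt hp hm]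
        exact MD.cls_mem_grading ⟨_, hm⟩
      · rw [extendD_of_not_isModular hm]
        exact zero_mem _
    · exact zero_mem _

/-! ### The differential squares to zero -/

theorem Diagram.contractAt_not_isModular [Nontrivial L] (D : Diagram L)
    (hι : IsModularExtension D.ι) {H X : D.E} (hH : IsAtom H) (hHF : H ≤ D.F) (hHX : H ≤ X)
    (J : List D.E) : ¬ (D.contractAt X J).IsModular := by
  intro h
  obtain ⟨x, rfl⟩ := hι.exists_eq hHF
  have h1 : (D.contractAt X J).ι x = (D.contractAt X J).ι ⊥ :=
    Subtype.ext (show X ⊔ D.ι x = X ⊔ D.ι ⊥ by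
      rw [hι.map_bot, sup_bot_eq, sup_eq_left.2 hHX])
  have h2 := h.extension.embedding.injective h1
  exact hH.1 (by rw [h2, hι.map_bot])

theorem Diagram.extendD_contractAt_contractAt (D : Diagram L) (H K : D.E) (J : List D.E) :
    extendD cls ((D.contractAt H []).contractAt (⟨H ⊔ K, le_sup_left⟩ : Set.Ici H)
      (J.map fun X => (⟨H ⊔ X, le_sup_left⟩ : Set.Ici H))) =
    extendD cls (D.contractAt (H ⊔ K) J) := by
  let e : Set.Ici (⟨H ⊔ K, le_sup_left⟩ : Set.Ici H) ≃o Set.Ici (H ⊔ K) :=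
    { toFun := fun x => ⟨x.1.1, x.2⟩
      invFun := fun x => ⟨⟨x.1, le_sup_left.trans x.2⟩, x.2⟩
      left_inv := fun _ => rfl
      right_inv := fun _ => rfl
      map_rel_iff' := Iff.rfl }
  have hsup : ∀ X : D.E, H ⊔ K ⊔ X = H ⊔ K ⊔ (H ⊔ X) := fun X => by
    rw [sup_sup_sup_comm, sup_idem, sup_assoc]
  refine respects_cls.orderIso e (fun x => Subtype.ext (hsup (D.ι x))) ?_
  refine Eq.trans ?_ (congrArg (List.map e) (List.map_map
    (f := fun X => (⟨H ⊔ X, le_sup_left⟩ : Set.Ici H))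
    (g := fun X => (⟨⟨H ⊔ K, le_sup_left⟩ ⊔ X, le_sup_left⟩ :
      Set.Ici (⟨H ⊔ K, le_sup_left⟩ : Set.Ici H))) (l := J)).symm)
  refine Eq.trans ?_ (List.map_map (g := e) (l := J)).symm
  exact List.map_congr_left fun X _ => Subtype.ext (hsup X)

theorem MD.d_d [Nontrivial L] (a : MD L) : MD.d L (MD.d L a) = 0 := by
  induction a using MD.induction with
  | h0 => simp
  | hadd x y hx hy => simp [hx, hy]
  | hsmul c x hx => simp [hx]
  | h Γ =>
    by_cases hΓ : Γ.1.J.Nodup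
    swap
    · rw [cls_eq_zero_of_not_nodup hΓ, map_zero, map_zero]
    classical
    -- Contracting `H` and then `K` gives the contraction at `H ⊔ K`. It is allowed when `H` is
    -- spanned by the rest and `K` is spanned after adjoining `H`, a condition symmetric in `H` and
    -- `K`.
    let c : Γ.1.E → Γ.1.E → List Γ.1.E → MD L := fun H K J =>
      if Γ.1.Spans H (K :: J) ∧ Γ.1.Spans K (H :: J) then extendD cls (Γ.1.contractAt (H ⊔ K) J)
      else 0
    have hc : ∀ H K J, c H K J = c K H J := fun H K J => by
      change ite _ _ _ = ite _ _ _
      rw [sup_comm]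
      exact if_congr and_comm rfl rfl
    rw [MD.d_cls, Diagram.dSum]
    refine (map_altSum (MD.d L).toAddMonoidHom Γ.1.J).trans ?_
    refine Eq.trans (altSum_congr fun H J hJ => ?_) (altSum_altSum hc Γ.1.J)
    have hat : ∀ K ∈ H :: J, IsAtom K := fun K hK => Γ.2.atoms K (hJ.mem_iff.1 hK)
    have hH := hat H List.mem_cons_self
    have hHJ : H ∉ J := (List.nodup_cons.1 (hJ.nodup_iff.2 hΓ)).1
    change MD.d L (Γ.1.dTerm H J) = altSum (c H) J
    by_cases hs : Γ.1.Spans H J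
    swap
    · rw [Diagram.dTerm_of_not_spans hs, map_zero]
      refine (altSum_eq_zero fun K J' hJ' => if_neg fun h => hs ?_).symm
      exact (Diagram.spans_perm hJ').1 h.1
    rw [Diagram.dTerm_of_spans hs]
    by_cases hHF : H ≤ Γ.1.F
    · rw [extendD_of_not_isModular
        (Γ.1.contractAt_not_isModular Γ.2.extension hH hHF le_rfl J), map_zero]
      refine (altSum_eq_zero fun K J' _ => ?_).symm
      simp only [c]
      rw [extendD_of_not_isModular
        (Γ.1.contractAt_not_isModular Γ.2.extension hH hHF le_sup_left J'), ite_self]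
    have hm : (Γ.1.contractAt H J).IsModular :=
      (Γ.1.contractAt_isModular_iff Γ.2.geometric Γ.2.extension hH
        fun K hK => hat K (List.mem_cons_of_mem H hK)).2 ⟨hHF, hHJ⟩
    rw [extendD_of_isModular hm]
    refine (MD.d_cls ⟨_, hm⟩).trans ?_
    refine (altSum_map (c := (Γ.1.contractAt H []).dTerm)
      (fun K => (⟨H ⊔ K, le_sup_left⟩ : Set.Ici H)) J).trans ?_
    refine altSum_congr fun K J' hJ' => ?_
    have h1 : (Γ.1.contractAt H []).Spans (⟨H ⊔ K, le_sup_left⟩ : Set.Ici H)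
        (J'.map fun X => (⟨H ⊔ X, le_sup_left⟩ : Set.Ici H)) ↔ Γ.1.Spans K (H :: J') := by
      refine Diagram.spans_iff.trans (Iff.trans ?_ Diagram.spans_iff.symm)
      constructor
      · intro h G hF hG
        have hHG := hG H List.mem_cons_self
        refine le_sup_right.trans (h (⟨G, hHG⟩ : Set.Ici H) (sup_le hHG hF) fun X hX => ?_)
        obtain ⟨X', hX', rfl⟩ := List.mem_map.1 hX
        exact sup_le hHG (hG X' (List.mem_cons_of_mem H hX'))
      · intro h G hF hG
        have hF' : H ⊔ Γ.1.F ≤ G.1 := hF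
        refine sup_le G.2 (h G.1 (le_sup_right.trans hF') fun X hX => ?_)
        rcases List.mem_cons.1 hX with rfl | hX
        · exact G.2
        · exact le_sup_right.trans (hG _ (List.mem_map_of_mem hX))
    have h2 : Γ.1.Spans H (K :: J') := (Diagram.spans_perm hJ').2 hs
    by_cases hs' : Γ.1.Spans K (H :: J')
    · rw [Diagram.dTerm_of_spans (h1.2 hs'), Diagram.extendD_contractAt_contractAt]
      exact (if_pos ⟨h2, hs'⟩).symm
    · rw [Diagram.dTerm_of_not_spans fun h => hs' (h1.1 h)]
      exact (if_neg fun h => hs' h.2).symm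

/-! ### The Leibniz rule -/

/-- A diagram known to be modular, as a modular diagram. -/
def Diagram.IsModular.diagram {D : Diagram L} (h : D.IsModular) : ModularDiagram L := ⟨D, h⟩

section Leibniz

variable (Γ₁ Γ₂ : ModularDiagram L)

/-- Testing with the flats `(G, ⊤)` shows that letters of the second factor never help to span a
letter of the first. -/
theorem spans_pushoutM {H : Γ₁.1.E} {J : List Γ₁.1.E} :
    (pushoutM Γ₁ Γ₂).1.Spans (Pushout.inl Γ₁ Γ₂ H)
      (J.map (Pushout.inl Γ₁ Γ₂) ++ Γ₂.1.J.map (Pushout.inr Γ₁ Γ₂)) ↔ Γ₁.1.Spans H J := by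
  refine Diagram.spans_iff.trans (Iff.trans ?_ Diagram.spans_iff.symm)
  constructor
  · intro h G hF hG
    refine Pushout.inl_le_iff.1 (h (Pushout.mk G ⊤ ?_) ⟨hF, le_top⟩ fun K hK => ?_)
    · rw [Γ₁.trace_eq_top_iff.2 hF, Γ₂.trace_top]
    · rcases List.mem_append.1 hK with hK | hK <;> obtain ⟨K', hK', rfl⟩ := List.mem_map.1 hK
      · exact Pushout.inl_le_iff.2 (hG K' hK')
      · exact Pushout.inr_le_iff.2 le_top
  · intro h p hF hp
    refine Pushout.inl_le_iff.2 (h p.1.1 hF.1 fun K hK => Pushout.inl_le_iff.1 (hp _ ?_))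
    exact List.mem_append_left _ (List.mem_map_of_mem hK)

theorem ModularDiagram.trace_contractAt {Γ : ModularDiagram L} {H : Γ.1.E} {J : List Γ.1.E}
    (hm : (Γ.1.contractAt H J).IsModular) (X : Set.Ici H) : hm.diagram.trace X = Γ.trace X := by
  refine eq_of_forall_le_iff fun y => hm.diagram.le_trace.trans ?_
  rw [Γ.le_trace]
  exact ⟨fun h => le_sup_right.trans h, fun h => sup_le X.2 h⟩

/-- The interval of a pushout above an element of the first factor. -/
def IciPushout {H : Γ₁.1.E} {J : List Γ₁.1.E} (hm : (Γ₁.1.contractAt H J).IsModular) :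
    Set.Ici (Pushout.inl Γ₁ Γ₂ H) ≃o Pushout hm.diagram Γ₂ :=
  have htr := ModularDiagram.trace_contractAt hm
  { toFun := fun p => Pushout.mk (Γ₁ := hm.diagram) (⟨p.1.1.1, Pushout.inl_le_iff.1 p.2⟩ : Set.Ici H)
      p.1.1.2 ((htr _).trans p.1.2)
    invFun := fun q => ⟨Pushout.mk (q.1.1 : Set.Ici H).1 q.1.2 ((htr _).symm.trans q.2),
      Pushout.inl_le_iff.2 (q.1.1 : Set.Ici H).2⟩
    left_inv := fun _ => rfl
    right_inv := fun _ => rfl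
    map_rel_iff' := Iff.rfl }

/-- The flats of the pushout above `inl H` are the pairs with first component above `H`, which form
the pushout of the contraction. The letters are matched by comparing their upper bounds through the
adjunctions of `inl` and `inr`. -/
theorem contractAt_pushoutM {H : Γ₁.1.E} {J : List Γ₁.1.E}
    (hm : (Γ₁.1.contractAt H J).IsModular) :
    extendD cls ((pushoutM Γ₁ Γ₂).1.contractAt (Pushout.inl Γ₁ Γ₂ H)
      (J.map (Pushout.inl Γ₁ Γ₂) ++ Γ₂.1.J.map (Pushout.inr Γ₁ Γ₂))) =
      cls (pushoutM hm.diagram Γ₂) := by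
  rw [← extendD_val (f := cls) (pushoutM hm.diagram Γ₂)]
  let e := IciPushout Γ₁ Γ₂ hm
  let s : Pushout Γ₁ Γ₂ → Set.Ici (Pushout.inl Γ₁ Γ₂ H) := fun p =>
    ⟨Pushout.inl Γ₁ Γ₂ H ⊔ p, show Pushout.inl Γ₁ Γ₂ H ≤ Pushout.inl Γ₁ Γ₂ H ⊔ p from le_sup_left⟩
  have hs : ∀ p q, e (s p) ≤ q ↔ p ≤ (e.symm q).1 := fun p q => by
    rw [← e.le_symm_apply]
    have h1 : Pushout.inl Γ₁ Γ₂ H ≤ (e.symm q).1 := (e.symm q).2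
    exact (sup_le_iff (a := Pushout.inl Γ₁ Γ₂ H)).trans (and_iff_right h1)
  have hi : ∀ K, e (s (Pushout.inl Γ₁ Γ₂ K)) =
      Pushout.inl hm.diagram Γ₂ (⟨H ⊔ K, le_sup_left⟩ : Set.Ici H) := fun K => by
    refine eq_of_forall_ge_iff fun q => (hs _ q).trans ?_
    refine Pushout.inl_le_iff.trans (Iff.trans ?_ Pushout.inl_le_iff.symm)
    exact ⟨fun h => sup_le (q.1.1 : Set.Ici H).2 h, fun h => le_sup_right.trans h⟩
  have hr : ∀ K, e (s (Pushout.inr Γ₁ Γ₂ K)) =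
      Pushout.inr hm.diagram Γ₂ K := fun K => by
    refine eq_of_forall_ge_iff fun q => (hs _ q).trans ?_
    exact Pushout.inr_le_iff.trans (Pushout.inr_le_iff (Γ₁ := hm.diagram) (Γ₂ := Γ₂) (p := q)).symm
  refine respects_cls.orderIso e (fun x => ?_) ?_
  · refine (eq_of_forall_ge_iff fun q => (hs (Pushout.incl Γ₁ Γ₂ x) q).trans ?_).symm
    exact and_congr ⟨fun h => sup_le (q.1.1 : Set.Ici H).2 h, fun h => le_sup_right.trans h⟩ Iff.rfl
  · refine Eq.symm ?_
    refine (List.map_map (f := s) (g := e)).trans ?_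
    refine (map_append_map (c := e ∘ s) hi hr).trans ?_
    refine congrArg₂ (· ++ ·) ?_ rfl
    exact (List.map_map (f := fun K => (⟨H ⊔ K, le_sup_left⟩ : Set.Ici H))
      (g := Pushout.inl hm.diagram Γ₂)).symm

theorem dTerm_pushoutM [Nontrivial L] {H : Γ₁.1.E} {J : List Γ₁.1.E} (hH : IsAtom H)
    (hJ : ∀ K ∈ J, IsAtom K) :
    (pushoutM Γ₁ Γ₂).1.dTerm (Pushout.inl Γ₁ Γ₂ H)
      (J.map (Pushout.inl Γ₁ Γ₂) ++ Γ₂.1.J.map (Pushout.inr Γ₁ Γ₂)) =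
    MD.mul L (Γ₁.1.dTerm H J) (cls Γ₂) := by
  by_cases hs : Γ₁.1.Spans H J
  swap
  · rw [Diagram.dTerm_of_not_spans hs, map_zero, LinearMap.zero_apply]
    exact Diagram.dTerm_of_not_spans fun h => hs ((spans_pushoutM Γ₁ Γ₂).1 h)
  rw [Diagram.dTerm_of_spans hs]
  refine (Diagram.dTerm_of_spans ((spans_pushoutM Γ₁ Γ₂).2 hs)).trans ?_
  by_cases hm : (Γ₁.1.contractAt H J).IsModular
  · rw [extendD_of_isModular hm]
    exact (contractAt_pushoutM Γ₁ Γ₂ hm).trans (MD.mul_cls hm.diagram Γ₂).symm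
  rw [extendD_of_not_isModular hm, map_zero, LinearMap.zero_apply]
  refine extendD_of_not_isModular fun h => hm ?_
  rw [Diagram.contractAt_isModular_iff _ Γ₁.2.geometric Γ₁.2.extension hH hJ]
  have h' := (Diagram.contractAt_isModular_iff _ (pushoutM Γ₁ Γ₂).2.geometric
    (pushoutM Γ₁ Γ₂).2.extension (Pushout.isAtom_inl hH) ?_).1 h
  · exact ⟨fun hF => h'.1 (Pushout.inl_le_iff.2 hF), fun hHJ =>
      h'.2 (List.mem_append_left _ (List.mem_map_of_mem hHJ))⟩
  · intro K hK
    rcases List.mem_append.1 hK with hK | hK <;> obtain ⟨K', hK', rfl⟩ := List.mem_map.1 hK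
    · exact Pushout.isAtom_inl (hJ K' hK')
    · exact Pushout.isAtom_inr (Γ₂.2.atoms K' hK')

theorem mul_dTerm_comm {H : Γ₁.1.E} {J : List Γ₁.1.E} :
    MD.mul L (Γ₁.1.dTerm H J) (cls Γ₂) =
      (-1 : ℤ) ^ (J.length * Γ₂.1.J.length) • MD.mul L (cls Γ₂) (Γ₁.1.dTerm H J) := by
  by_cases hs : Γ₁.1.Spans H J
  swap
  · rw [Diagram.dTerm_of_not_spans hs, map_zero, map_zero, LinearMap.zero_apply, smul_zero]
  rw [Diagram.dTerm_of_spans hs]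
  by_cases hm : (Γ₁.1.contractAt H J).IsModular
  · rw [extendD_of_isModular hm]
    refine (MD.mul_cls hm.diagram Γ₂).trans ((cls_pushoutM_comm _ _).trans ?_)
    have h1 : hm.diagram.1.J.length = J.length := List.length_map _
    rw [h1, ← MD.mul_cls]
    rfl
  · rw [extendD_of_not_isModular hm, map_zero, map_zero, LinearMap.zero_apply, smul_zero]

/-- The symmetry of the pushout reduces this to the first factor. The sign of moving one word past
the other occurs twice and cancels. -/
theorem dTerm_pushoutM' [Nontrivial L] {H : Γ₂.1.E} {J : List Γ₂.1.E} (hH : IsAtom H)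
    (hJ : ∀ K ∈ J, IsAtom K) :
    (pushoutM Γ₁ Γ₂).1.dTerm (Pushout.inr Γ₁ Γ₂ H)
      (Γ₁.1.J.map (Pushout.inl Γ₁ Γ₂) ++ J.map (Pushout.inr Γ₁ Γ₂)) =
    MD.mul L (cls Γ₁) (Γ₂.1.dTerm H J) := by
  have hat : ∀ K ∈ Γ₁.1.J.map (Pushout.inl Γ₁ Γ₂) ++ J.map (Pushout.inr Γ₁ Γ₂),
      IsAtom K := fun K hK => by
    rcases List.mem_append.1 hK with hK | hK <;> obtain ⟨K', hK', rfl⟩ := List.mem_map.1 hK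
    · exact Pushout.isAtom_inl (Γ₁.2.atoms K' hK')
    · exact Pushout.isAtom_inr (hJ K' hK')
  refine (Diagram.dTerm_orderIso (Γ := pushoutM Γ₁ Γ₂) (Γ' := pushoutM Γ₂ Γ₁)
    (Pushout.swap Γ₁ Γ₂) (fun _ => rfl) (Pushout.isAtom_inr hH) hat).trans ?_
  have h1 : (Γ₁.1.J.map (Pushout.inl Γ₁ Γ₂) ++ J.map (Pushout.inr Γ₁ Γ₂)).map
      (Pushout.swap Γ₁ Γ₂) = Γ₁.1.J.map (Pushout.inr Γ₂ Γ₁) ++ J.map (Pushout.inl Γ₂ Γ₁) :=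
    map_append_map (fun _ => rfl) fun _ => rfl
  refine (congrArg ((pushoutM Γ₂ Γ₁).1.dTerm (Pushout.inl Γ₂ Γ₁ H)) h1).trans ?_
  refine (((pushoutM Γ₂ Γ₁).1.isAlt_dTerm _).append_comm (List.length_map _)
    (List.length_map _)).trans ?_
  refine (congrArg _ ((dTerm_pushoutM Γ₂ Γ₁ hH hJ).trans (mul_dTerm_comm _ _))).trans ?_
  rw [smul_smul, _root_.mul_comm J.length, ← mul_pow]
  simp

theorem dSum_pushoutM [Nontrivial L] : (pushoutM Γ₁ Γ₂).1.dSum =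
    MD.mul L Γ₁.1.dSum (cls Γ₂) + (-1 : ℤ) ^ Γ₁.1.J.length • MD.mul L (cls Γ₁) Γ₂.1.dSum := by
  refine (altSum_append (c := (pushoutM Γ₁ Γ₂).1.dTerm) (Γ₁.1.J.map (Pushout.inl Γ₁ Γ₂))
    (Γ₂.1.J.map (Pushout.inr Γ₁ Γ₂))).trans ?_
  refine congrArg₂ (· + ·) ((altSum_map _ _).trans ?_)
    (congrArg₂ (fun (n : ℕ) (x : MD L) => (-1 : ℤ) ^ n • x) (List.length_map _)
      ((altSum_map _ _).trans ?_))
  · refine Eq.trans (altSum_congr fun H J hJ => ?_)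
      (map_altSum ((MD.mul L).flip (cls Γ₂)).toAddMonoidHom Γ₁.1.J).symm
    have hat : ∀ K ∈ H :: J, IsAtom K := fun K hK => Γ₁.2.atoms K (hJ.mem_iff.1 hK)
    exact dTerm_pushoutM Γ₁ Γ₂ (hat H List.mem_cons_self) fun K hK =>
      hat K (List.mem_cons_of_mem H hK)
  · refine Eq.trans (altSum_congr fun H J hJ => ?_)
      (map_altSum (MD.mul L (cls Γ₁)).toAddMonoidHom Γ₂.1.J).symm
    have hat : ∀ K ∈ H :: J, IsAtom K := fun K hK => Γ₂.2.atoms K (hJ.mem_iff.1 hK)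
    exact dTerm_pushoutM' Γ₁ Γ₂ (hat H List.mem_cons_self) fun K hK =>
      hat K (List.mem_cons_of_mem H hK)

end Leibniz

theorem MD.leibniz [Nontrivial L] {i : ℤ} {a : MD L} (ha : a ∈ MD.grading L i) (b : MD L) :
    MD.d L (MD.mul L a b) =
      MD.mul L (MD.d L a) b + ((-1 : ℚ) ^ i) • MD.mul L a (MD.d L b) := by
  induction ha using Submodule.span_induction with
  | zero => simp
  | add x y _ _ hx hy =>
    simp only [map_add, LinearMap.add_apply, hx, hy, smul_add]
    abel
  | smul c x _ hx => simp only [map_smul, LinearMap.smul_apply, hx, smul_add, smul_comm c]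
  | mem a ha =>
    obtain ⟨Γ₁, rfl, rfl⟩ := ha
    induction b using MD.induction with
    | h0 => simp
    | hadd x y hx hy =>
      simp only [map_add, hx, hy, smul_add]
      abel
    | hsmul c x hx => simp only [map_smul, hx, smul_add, smul_comm c]
    | h Γ₂ =>
      rw [MD.mul_cls, MD.d_cls, MD.d_cls, MD.d_cls, dSum_pushoutM, Γ₁.neg_one_zpow_deg,
        ← Int.cast_smul_eq_zsmul ℚ]
      push_cast
      rfl

theorem MD.isCDGA [Nontrivial L] (hL : IsGeometric L) :
    IsCDGA (MD.grading L) (cls (unit hL)) (MD.mul L) (MD.d L) where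
  internal := MD.isInternal
  one_mem := by
    rw [← deg_unit hL]
    exact MD.cls_mem_grading _
  mul_mem _ _ _ ha _ hb := MD.mul_mem ha hb
  d_mem _ _ ha := MD.d_mem ha
  one_mul := MD.one_mul hL
  mul_one := MD.mul_one hL
  mul_assoc := MD.mul_assoc
  mul_comm _ _ _ ha _ hb := MD.mul_comm ha hb
  d_d := MD.d_d
  leibniz _ _ ha b := MD.leibniz ha b

/-! ### The Orlik–Solomon algebra -/

theorem isAlt_prod {α A : Type*} [Ring A] {f : α → A} (hf : ∀ a b, f a * f b = -(f b * f a)) :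
    IsAlt fun l : List α => (l.map f).prod := by
  intro l₁ a b l₂
  simp only [List.map_append, List.map_cons, List.prod_append, List.prod_cons]
  rw [← _root_.mul_assoc (f a), hf a b, neg_mul, mul_neg, _root_.mul_assoc]

namespace Ext

theorem e_nil : Ext.e ([] : List (At L)) = 1 := rfl

theorem e_cons (a : At L) (J : List (At L)) :
    Ext.e (a :: J) = ExteriorAlgebra.ι ℚ (Finsupp.single a (1 : ℚ)) * Ext.e J := by
  rw [Ext.e, List.map_cons, List.prod_cons, ← Ext.e]

theorem isAlt_e : IsAlt (Ext.e : List (At L) → Ext L) :=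
  isAlt_prod fun _ _ => eq_neg_of_add_eq_zero_left (ExteriorAlgebra.ι_add_mul_swap _ _)

theorem δ_e (J : List (At L)) : Ext.δ L (Ext.e J) = altSum (fun _ l => Ext.e l) J := by
  induction J with
  | nil => exact CliffordAlgebra.contractLeft_one (Q := (0 : QuadraticForm ℚ (At L →₀ ℚ))) _
  | cons a J ih =>
    rw [e_cons, altSum_cons]
    refine (CliffordAlgebra.contractLeft_ι_mul _ _ _).trans ?_
    refine congrArg₂ (· - ·) ?_ ?_
    · rw [Finsupp.linearCombination_single, smul_eq_mul, _root_.mul_one, one_smul]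
    · let φ : Ext L →+ Ext L :=
        AddMonoidHom.mulLeft (ExteriorAlgebra.ι ℚ (Finsupp.single a (1 : ℚ)))
      refine (congrArg φ ih).trans ((map_altSum φ J).trans ?_)
      exact altSum_congr fun b l _ => (e_cons a l).symm

end Ext

namespace OS

theorem e_nil : OS.e ([] : List (At L)) = 1 := by
  rw [OS.e, Ext.e_nil, map_one]

theorem e_append (J J' : List (At L)) : OS.e (J ++ J') = OS.e J * OS.e J' := by
  rw [OS.e, Ext.e, List.map_append, List.prod_append, map_mul]
  rfl

theorem e_cons (a : At L) (J : List (At L)) : OS.e (a :: J) = OS.e [a] * OS.e J :=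
  e_append [a] J

theorem isAlt_e : IsAlt (OS.e : List (At L) → OS L) := fun l₁ a b l₂ => by
  rw [OS.e, Ext.isAlt_e, map_neg]
  rfl

theorem e_mem_grading (J : List (At L)) : OS.e J ∈ OS.grading L J.length :=
  Submodule.subset_span ⟨J, rfl, rfl⟩

theorem mul_mem {i j : ℤ} {a b : OS L} (ha : a ∈ OS.grading L i) (hb : b ∈ OS.grading L j) :
    a * b ∈ OS.grading L (i + j) := by
  induction ha using Submodule.span_induction with
  | zero => simp
  | add x y _ _ hx hy => simpa [add_mul] using add_mem hx hy
  | smul c x _ hx => simpa using Submodule.smul_mem _ c hx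
  | mem a ha =>
    obtain ⟨J, rfl, rfl⟩ := ha
    induction hb using Submodule.span_induction with
    | zero => simp
    | add x y _ _ hx hy => simpa [mul_add] using add_mem hx hy
    | smul c x _ hx => simpa using Submodule.smul_mem _ c hx
    | mem b hb =>
      obtain ⟨J', rfl, rfl⟩ := hb
      rw [← e_append]
      simpa using e_mem_grading (J ++ J')

theorem mul_comm {i j : ℤ} {a b : OS L} (ha : a ∈ OS.grading L i) (hb : b ∈ OS.grading L j) :
    a * b = ((-1 : ℚ) ^ (i * j)) • (b * a) := by
  induction ha using Submodule.span_induction with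
  | zero => simp
  | add x y _ _ hx hy => rw [add_mul, mul_add, hx, hy, smul_add]
  | smul c x _ hx => rw [smul_mul_assoc, mul_smul_comm, hx, smul_comm c]
  | mem a ha =>
    obtain ⟨J, rfl, rfl⟩ := ha
    induction hb using Submodule.span_induction with
    | zero => simp
    | add x y _ _ hx hy => rw [add_mul, mul_add, hx, hy, smul_add]
    | smul c x _ hx => rw [smul_mul_assoc, mul_smul_comm, hx, smul_comm c]
    | mem b hb =>
      obtain ⟨J', rfl, rfl⟩ := hb
      rw [← e_append, ← e_append, isAlt_e.append_comm rfl rfl, ← Int.cast_smul_eq_zsmul ℚ,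
        ← Nat.cast_mul, zpow_natCast]
      push_cast
      rfl

/-- The span of the homogeneous parts. -/
theorem iSup_grading : ⨆ k, OS.grading L k = ⊤ := by
  have hmul : ∀ a ∈ ⨆ k, OS.grading L k, ∀ b ∈ ⨆ k, OS.grading L k,
      a * b ∈ ⨆ k, OS.grading L k := by
    intro a ha b hb
    induction ha using Submodule.iSup_induction' with
    | zero => simp
    | add x y _ _ hx hy => simpa [add_mul] using add_mem hx hy
    | mem i a ha =>
      induction hb using Submodule.iSup_induction' with
      | zero => simp
      | add x y _ _ hx hy => simpa [mul_add] using add_mem hx hy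
      | mem j b hb => exact Submodule.mem_iSup_of_mem _ (mul_mem ha hb)
  have he : ∀ J : List (At L), OS.e J ∈ ⨆ k, OS.grading L k := fun J =>
    Submodule.mem_iSup_of_mem _ (e_mem_grading J)
  rw [eq_top_iff]
  rintro a -
  obtain ⟨a, rfl⟩ := RingQuot.mkAlgHom_surjective ℚ OSRel a
  induction a using ExteriorAlgebra.induction with
  | algebraMap r =>
    rw [AlgHom.commutes, Algebra.algebraMap_eq_smul_one]
    have := he []
    rw [e_nil] at this
    exact Submodule.smul_mem _ r this
  | add a b ha hb => simpa using add_mem ha hb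
  | mul a b ha hb => simpa using hmul _ ha _ hb
  | ι v =>
    induction v using Finsupp.induction_linear with
    | zero => simp
    | add v w hv hw => simpa using add_mem hv hw
    | single H c =>
      have h1 : Finsupp.single H c = c • Finsupp.single H (1 : ℚ) := by simp
      rw [h1, map_smul, map_smul]
      refine Submodule.smul_mem _ c ?_
      have := he [H]
      simpa [OS.e, Ext.e] using this

/-- The product of generators over the polynomial ring, recording the degree. -/
theorem exists_degree_hom : ∃ φ : OS L →ₐ[ℚ] Polynomial (OS L),
    ∀ J, φ (OS.e J) = Polynomial.monomial J.length (OS.e J) := by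
  let f : (At L →₀ ℚ) →ₗ[ℚ] Polynomial (OS L) :=
    ((Polynomial.monomial 1).restrictScalars ℚ) ∘ₗ
      (RingQuot.mkAlgHom ℚ OSRel).toLinearMap ∘ₗ ExteriorAlgebra.ι ℚ
  have hf : ∀ v, f v = Polynomial.monomial 1 (RingQuot.mkAlgHom ℚ OSRel (ExteriorAlgebra.ι ℚ v)) :=
    fun _ => rfl
  let ψ : Ext L →ₐ[ℚ] Polynomial (OS L) := ExteriorAlgebra.lift ℚ ⟨f, fun v => by
    rw [hf, Polynomial.monomial_mul_monomial, ← map_mul, ExteriorAlgebra.ι_sq_zero, map_zero,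
      map_zero]⟩
  have hψ : ∀ J, ψ (Ext.e J) = Polynomial.monomial J.length (OS.e J) := by
    intro J
    induction J with
    | nil =>
      rw [Ext.e_nil, e_nil, map_one]
      rfl
    | cons a J ih =>
      rw [Ext.e_cons, map_mul, ih, ExteriorAlgebra.lift_ι_apply, hf,
        Polynomial.monomial_mul_monomial, e_cons, List.length_cons, add_comm 1]
      simp [OS.e, Ext.e]
  -- The relations are homogeneous because `δ` lowers the degree by one. For the empty word the
  -- truncated subtraction is harmless, as the sum is empty.
  have hδ : ∀ J, ψ (Ext.δ L (Ext.e J)) = Polynomial.monomial (J.length - 1)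
      (RingQuot.mkAlgHom ℚ OSRel (Ext.δ L (Ext.e J))) := by
    intro J
    rw [Ext.δ_e]
    refine (map_altSum ψ.toLinearMap.toAddMonoidHom J).trans (Eq.trans ?_
      (congrArg _ (map_altSum (RingQuot.mkAlgHom ℚ OSRel).toLinearMap.toAddMonoidHom J)).symm)
    refine Eq.trans (altSum_congr fun a l hl => ?_)
      (map_altSum (Polynomial.monomial (R := OS L) (J.length - 1)).toAddMonoidHom J).symm
    have h1 : J.length - 1 = l.length := by
      rw [← hl.length_eq]
      rfl
    rw [h1]
    exact hψ l
  refine ⟨RingQuot.liftAlgHom ℚ ⟨ψ, fun x y h => ?_⟩, fun J => ?_⟩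
  · obtain ⟨C, hC⟩ := h
    rw [hδ, RingQuot.mkAlgHom_rel ℚ (OSRel.circuit C hC), map_zero, map_zero, map_zero]
  · rw [OS.e, RingQuot.liftAlgHom_mkAlgHom_apply]
    exact hψ J

theorem isInternal : DirectSum.IsInternal (OS.grading L) := by
  obtain ⟨φ, hφ⟩ := exists_degree_hom (L := L)
  -- Negative degrees are excluded by hand, since `toNat` would send them to `0`.
  let π : ℤ → OS L →ₗ[ℚ] OS L := fun k =>
    { toFun := fun a => if 0 ≤ k then (φ a).coeff k.toNat else 0
      map_add' := fun a b => by split_ifs <;> simp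
      map_smul' := fun c a => by split_ifs <;> simp }
  have hπ : ∀ k J, π k (OS.e J) = if (J.length : ℤ) = k then OS.e J else 0 := by
    intro k J
    change (if 0 ≤ k then (φ (OS.e J)).coeff k.toNat else 0) = _
    rw [hφ, Polynomial.coeff_monomial]
    split_ifs <;> first | rfl | omega
  refine isInternal_of_projections π (fun i a ha => ?_) (fun i j hij a ha => ?_) iSup_grading
  · induction ha using Submodule.span_induction with
    | zero => simp
    | mem a ha =>
      obtain ⟨J, hJ, rfl⟩ := ha
      rw [hπ, if_pos hJ]
    | add x y _ _ hx hy => rw [map_add, hx, hy]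
    | smul c x _ hx => rw [map_smul, hx]
  · induction ha using Submodule.span_induction with
    | zero => simp
    | mem a ha =>
      obtain ⟨J, hJ, rfl⟩ := ha
      rw [hπ, if_neg (hJ ▸ hij.symm)]
    | add x y _ _ hx hy => rw [map_add, hx, hy, add_zero]
    | smul c x _ hx => rw [map_smul, hx, smul_zero]

theorem isCDGA : IsCDGA (OS.grading L) 1 (LinearMap.mul ℚ (OS L)) 0 where
  internal := isInternal
  one_mem := by
    rw [← e_nil]
    exact e_mem_grading []
  mul_mem _ _ _ ha _ hb := mul_mem ha hb
  d_mem _ _ _ := zero_mem _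
  one_mul a := _root_.one_mul a
  mul_one a := _root_.mul_one a
  mul_assoc a b c := _root_.mul_assoc a b c
  mul_comm _ _ _ ha _ hb := OS.mul_comm ha hb
  d_d _ := rfl
  leibniz _ _ _ _ := by simp

end OS

/-! ### Words in the Orlik–Solomon algebra -/

namespace OS

open Classical in
/-- The generator of an atom, and zero for all other elements of the lattice. -/
noncomputable def gen (x : L) : OS L := if h : IsAtom x then OS.e [⟨x, h⟩] else 0

/-- The product of the generators along a word in the lattice. -/
noncomputable def word (l : List L) : OS L := (l.map gen).prod

theorem gen_val (a : At L) : gen (a : L) = OS.e [a] := dif_pos a.2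

theorem gen_of_not_isAtom {x : L} (h : ¬ IsAtom x) : gen x = 0 := dif_neg h

theorem gen_mul_gen (x y : L) : gen x * gen y = -(gen y * gen x) := by
  by_cases hx : IsAtom x
  swap
  · simp [gen_of_not_isAtom hx]
  by_cases hy : IsAtom y
  swap
  · simp [gen_of_not_isAtom hy]
  have h1 : OS.e ([⟨x, hx⟩] ++ [⟨y, hy⟩] : List (At L)) = -OS.e ([⟨y, hy⟩] ++ [⟨x, hx⟩]) :=
    isAlt_e [] (⟨x, hx⟩ : At L) ⟨y, hy⟩ []
  rwa [e_append, e_append, ← gen_val, ← gen_val] at h1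

theorem gen_mul_self (x : L) : gen x * gen x = 0 := by
  have h1 := gen_mul_gen x x
  rw [eq_neg_iff_add_eq_zero, ← two_smul ℚ, smul_eq_zero] at h1
  exact h1.resolve_left two_ne_zero

theorem isAlt_word : IsAlt (word : List L → OS L) := isAlt_prod gen_mul_gen

theorem word_append (l l' : List L) : word (l ++ l') = word l * word l' := by
  rw [word, List.map_append, List.prod_append, ← word, ← word]

theorem word_map_val (K : List (At L)) : word (K.map Subtype.val) = OS.e K := by
  induction K with
  | nil => exact e_nil.symm
  | cons a K ih => rw [e_cons, ← ih, ← gen_val, word, word, List.map_cons, List.map_cons,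
      List.prod_cons]

/-- Three distinct atoms of a line form a circuit, and this is its relation. -/
theorem e_three (hL : IsGeometric L) {x y z : At L} (hxy : x ≠ y) (hxz : x ≠ z) (hyz : y ≠ z)
    (hr : rk ((x : L) ⊔ (y ⊔ z)) ≤ 2) : OS.e [x, y] - OS.e [x, z] + OS.e [y, z] = 0 := by
  classical
  have hr2 : ∀ a b : At L, a ≠ b → rk ((a : L) ⊔ b) = 2 := fun a b hab => by
    rw [hL.rk_atom_sup a.2, hL.rk_atom b.2]
    exact fun h => hab (Subtype.ext ((b.2.le_iff_eq a.2.1).1 h))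
  have hsup : ∀ a b : At L, ({a, b} : Finset (At L)).sup (fun H => (H : L)) = (a : L) ⊔ b := by simp
  have hC : IsCircuit {x, y, z} := by
    have h3 : ({x, y, z} : Finset (At L)).card = 3 := Finset.card_eq_three.2
      ⟨x, y, z, hxy, hxz, hyz, rfl⟩
    have hx : ({x, y, z} : Finset (At L)).erase x = {y, z} := by
      ext a
      simp only [Finset.mem_erase, Finset.mem_insert, Finset.mem_singleton]
      grind
    have hy : ({x, y, z} : Finset (At L)).erase y = {x, z} := by
      ext a
      simp only [Finset.mem_erase, Finset.mem_insert, Finset.mem_singleton]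
      grind
    have hz : ({x, y, z} : Finset (At L)).erase z = {x, y} := by
      ext a
      simp only [Finset.mem_erase, Finset.mem_insert, Finset.mem_singleton]
      grind
    refine ⟨?_, fun c hc => ?_⟩
    · rw [rkSet, h3, Finset.sup_insert, hsup]
      have := hL.rk_mono (le_sup_right : (y : L) ⊔ z ≤ (x : L) ⊔ (y ⊔ z))
      rw [hr2 y z hyz] at this
      omega
    · rw [h3]
      simp only [Finset.mem_insert, Finset.mem_singleton] at hc
      rcases hc with rfl | rfl | rfl
      · rw [hx, rkSet, hsup, hr2 _ _ hyz]
      · rw [hy, rkSet, hsup, hr2 _ _ hxz]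
      · rw [hz, rkSet, hsup, hr2 _ _ hxy]
  -- The order of `C.toList` is unspecified, but another order changes the relation at most by a
  -- sign.
  have halt : IsAlt fun l : List (At L) => RingQuot.mkAlgHom ℚ OSRel (Ext.δ L (Ext.e l)) :=
    fun l₁ a b l₂ => by
      beta_reduce
      rw [Ext.isAlt_e, map_neg, map_neg]
  have hnd : [x, y, z].Nodup := by simp [hxy, hxz, hyz]
  have hp : [x, y, z].Perm ({x, y, z} : Finset (At L)).toList := by
    refine List.perm_of_nodup_nodup_toFinset_eq hnd (Finset.nodup_toList _) ?_
    rw [Finset.toList_toFinset]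
    simp
  have h0 := halt.perm_eq_zero hp (by
    rw [RingQuot.mkAlgHom_rel ℚ (OSRel.circuit _ hC), map_zero])
  rw [Ext.δ_e, altSum_cons, altSum_cons, altSum_cons, altSum_nil, sub_zero, map_sub, map_sub] at h0
  change OS.e [y, z] - (OS.e [x, z] - OS.e [x, y]) = 0 at h0
  rw [← h0]
  abel

theorem gen_three (hL : IsGeometric L) {x y z : L} (hx : IsAtom x) (hy : IsAtom y) (hz : IsAtom z)
    (hxy : x ≠ y) (hxz : x ≠ z) (hyz : y ≠ z) (hr : rk (x ⊔ (y ⊔ z)) ≤ 2) :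
    gen x * gen y - gen x * gen z + gen y * gen z = 0 := by
  have := e_three hL (x := ⟨x, hx⟩) (y := ⟨y, hy⟩) (z := ⟨z, hz⟩)
    (fun h => hxy (congrArg Subtype.val h)) (fun h => hxz (congrArg Subtype.val h))
    (fun h => hyz (congrArg Subtype.val h)) hr
  rwa [e_cons, e_cons ⟨x, hx⟩ [⟨z, hz⟩], e_cons ⟨y, hy⟩ [⟨z, hz⟩], ← gen_val, ← gen_val,
    ← gen_val] at this

end OS

/-- An identity in algebras generated by elements `P a b` subject to the Arnold relations. -/
theorem altSum_prod_eq_zero {α A : Type*} [Ring A] {P : α → α → A} (hs : ∀ a b, P a b = P b a)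
    {a : α} {l : List α} (h : ∀ a' ∈ a :: l, ∀ b ∈ a :: l, ∀ c ∈ a :: l,
      P a' b * P a' c - P a' b * P b c + P a' c * P b c = 0) (hl : l ≠ []) :
    altSum (fun x l' => (l'.map (P x)).prod) (a :: l) = 0 := by
  induction l generalizing a with
  | nil => exact absurd rfl hl
  | cons b l ih =>
    -- Each term selecting some `i` in `l` contains `P i a * P i b`, which the Arnold relation turns
    -- into `P a b * (P i b - P i a)`. So `P a b` divides the whole sum, and two shorter sums
    -- remain.
    have h1 : altSum (fun i l' => ((a :: b :: l').map (P i)).prod) l =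
        P a b * (altSum (fun i l' => ((b :: l').map (P i)).prod) l -
          altSum (fun i l' => ((a :: l').map (P i)).prod) l) := by
      rw [← altSum_sub]
      refine Eq.trans (altSum_congr fun i l' hi => ?_) (map_altSum (AddMonoidHom.mulLeft (P a b)) l).symm
      have hil : i ∈ a :: b :: l := by simp [hi.mem_iff.1 List.mem_cons_self]
      have h2 := h a (by simp) b (by simp) i hil
      rw [hs a i, hs b i] at h2
      have h3 : P i a * P i b = P a b * P i b - P a b * P i a := by
        rw [← sub_eq_zero, ← h2]
        abel
      change _ = P a b * (_ - _)
      simp only [List.map_cons, List.prod_cons]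
      rw [← _root_.mul_assoc, h3, mul_sub, sub_mul, _root_.mul_assoc, _root_.mul_assoc]
    have h2 : altSum (fun x l' => (l'.map (P x)).prod) (a :: b :: l) =
        P a b * (altSum (fun x l' => (l'.map (P x)).prod) (a :: l) -
          altSum (fun x l' => (l'.map (P x)).prod) (b :: l)) := by
      rw [altSum_cons, altSum_cons, h1, altSum_cons, altSum_cons, List.map_cons, List.map_cons,
        List.prod_cons, List.prod_cons, hs b a]
      simp only [mul_sub]
      abel
    rw [h2]
    -- For `l = []` the shorter sums do not vanish: both are the empty product `1`, and their
    -- difference is zero.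
    rcases eq_or_ne l [] with rfl | hl'
    · simp [altSum_cons, altSum_nil]
    · have hsub1 : ∀ x ∈ a :: l, x ∈ a :: b :: l := by grind
      have hsub2 : ∀ x ∈ b :: l, x ∈ a :: b :: l := by grind
      rw [ih (fun x hx y hy z hz => h x (hsub1 x hx) y (hsub1 y hy) z (hsub1 z hz)) hl',
        ih (fun x hx y hy z hz => h x (hsub2 x hx) y (hsub2 y hy) z (hsub2 z hz)) hl', sub_zero,
        mul_zero]

/-! ### The map to the Orlik–Solomon algebra -/

namespace ModularDiagram

open Classical in
/-- The value of the map to the Orlik–Solomon algebra. -/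
noncomputable def os (Γ : ModularDiagram L) : OS L :=
  if Γ.1.F = ⊤ then OS.word (Γ.1.J.map Γ.trace) else 0

theorem os_of_eq {Γ : ModularDiagram L} (h : Γ.1.F = ⊤) : Γ.os = OS.word (Γ.1.J.map Γ.trace) :=
  if_pos h

theorem os_of_ne {Γ : ModularDiagram L} (h : Γ.1.F ≠ ⊤) : Γ.os = 0 := if_neg h

/-- The last three relations concern only diagrams with `F_ι ≠ ⊤`, where the value is zero by
definition. -/
theorem respects_os : Respects (os : ModularDiagram L → OS L) where
  swap Γ Γ' l₁ l₂ a b hJ hΓ' := by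
    obtain ⟨D', h'⟩ := Γ'
    subst hΓ'
    by_cases hF : Γ.1.F = ⊤
    · refine (os_of_eq hF).trans
        (Eq.trans ?_ (congrArg Neg.neg (os_of_eq (Γ := ⟨_, h'⟩) hF).symm))
      rw [hJ]
      exact OS.isAlt_word.map Γ.trace l₁ a b l₂
    · rw [os_of_ne hF]
      exact (neg_eq_zero.2 (os_of_ne (Γ := ⟨_, h'⟩) hF)).symm
  embed Γ Γ' φ hφ hrk hι hJ := by
    have htop : φ ⊤ = ⊤ := Γ'.2.geometric.eq_of_le_of_rk_le le_top
      (by rw [← hrk, rk_embedding hφ hι])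
    have hF : Γ'.1.F = φ Γ.1.F := congrFun hι ⊤
    have hiff : Γ'.1.F = ⊤ ↔ Γ.1.F = ⊤ := by rw [hF, ← htop, hφ.injective.eq_iff]
    by_cases h : Γ.1.F = ⊤
    · rw [os_of_eq h, os_of_eq (hiff.2 h), hJ, List.map_map]
      exact congrArg OS.word (List.map_congr_left fun K _ => (trace_embedding hφ hι K).symm)
    · rw [os_of_ne h, os_of_ne fun h' => h (hiff.1 h')]
  span Γ h := os_of_ne fun h' => h.not_ge (h'.ge.trans le_sup_left)
  prod Γ E₁ E₂ _ _ _ _ _ _ h₁ h₂ e h := os_of_ne fun h' => by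
    rw [h', e.map_top] at h
    exact bot_ne_top h.symm
  two Γ G hG hF h := by
    obtain ⟨a, b, l, -, ha, -⟩ := h
    exact os_of_ne fun h' => ha (le_top.trans (h'.ge.trans hF))

end ModularDiagram

variable (L) in
/-- The morphism to the Orlik–Solomon algebra. -/
noncomputable def MD.toOS : MD L →ₗ[ℚ] OS L := MD.lift _ ModularDiagram.respects_os

theorem MD.toOS_cls (Γ : ModularDiagram L) : MD.toOS L (cls Γ) = Γ.os :=
  MD.lift_cls ModularDiagram.respects_os Γ

namespace ModularDiagram

variable (Γ : ModularDiagram L)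

theorem exists_word (h : Γ.1.F = ⊤) : ∃ K : List (At L),
    Γ.1.J = K.map (fun H : At L => Γ.1.ι H.1) ∧ Γ.os = OS.e K := by
  have hι : ∀ G, Γ.1.ι (Γ.trace G) = G := fun G => by rw [Γ.trace_spec, h, inf_top_eq]
  have hat : ∀ x ∈ Γ.1.J.map Γ.trace, IsAtom x := fun x hx => by
    obtain ⟨H, hH, rfl⟩ := List.mem_map.1 hx
    rw [Γ.isGeometric_base.isAtom_iff_rk, ← Γ.2.extension.rk_map Γ.2.geometric, hι,
      Γ.2.geometric.rk_atom (Γ.2.atoms H hH)]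
  obtain ⟨K, hK⟩ : ∃ K : List (At L), K.map Subtype.val = Γ.1.J.map Γ.trace :=
    CanLift.prf _ hat
  refine ⟨K, ?_, ?_⟩
  · have h1 : K.map (fun H : At L => Γ.1.ι H.1) = (K.map Subtype.val).map Γ.1.ι :=
      (List.map_map ..).symm
    rw [h1, hK, List.map_map]
    exact (List.map_id _).symm.trans (List.map_congr_left fun G _ => (hι G).symm)
  · rw [os_of_eq h, ← hK, OS.word_map_val]

theorem deg_of_eq (h : Γ.1.F = ⊤) : Γ.1.deg = Γ.1.J.length := by
  rw [Diagram.deg, h, inf_top_eq]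
  simp

theorem os_pushoutM (Γ₁ Γ₂ : ModularDiagram L) : (pushoutM Γ₁ Γ₂).os = Γ₁.os * Γ₂.os := by
  have hF : (pushoutM Γ₁ Γ₂).1.F = ⊤ ↔ Γ₁.1.F = ⊤ ∧ Γ₂.1.F = ⊤ := by
    refine ⟨fun h => ⟨congrArg (fun p : Pushout Γ₁ Γ₂ => p.1.1) h,
      congrArg (fun p : Pushout Γ₁ Γ₂ => p.1.2) h⟩, fun h => Pushout.ext h.1 h.2⟩
  by_cases h₁ : Γ₁.1.F = ⊤
  swap
  · rw [os_of_ne h₁, zero_mul, os_of_ne fun h => h₁ (hF.1 h).1]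
  by_cases h₂ : Γ₂.1.F = ⊤
  swap
  · rw [os_of_ne h₂, mul_zero, os_of_ne fun h => h₂ (hF.1 h).2]
  rw [os_of_eq h₁, os_of_eq h₂, os_of_eq (hF.2 ⟨h₁, h₂⟩), ← OS.word_append]
  refine congrArg OS.word (map_append_map (fun H => ?_) fun H => ?_)
  · exact pushoutM_trace Γ₁ Γ₂ _
  · exact (pushoutM_trace Γ₁ Γ₂ _).trans (Γ₁.trace_ι _)

theorem os_contractAt {Γ : ModularDiagram L} {H : Γ.1.E} {J : List Γ.1.E}
    (hm : (Γ.1.contractAt H J).IsModular) (h : H ⊔ Γ.1.F = ⊤) :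
    hm.diagram.os = OS.word (J.map fun K => Γ.trace (H ⊔ K)) := by
  refine (os_of_eq (Γ := hm.diagram) (Subtype.ext h)).trans (congrArg OS.word ?_)
  refine (List.map_map (f := fun K => (⟨H ⊔ K, le_sup_left⟩ : Set.Ici H))
    (g := hm.diagram.trace) (l := J)).trans ?_
  exact List.map_congr_left fun K _ => trace_contractAt hm _

/-! ### The map to the Orlik–Solomon algebra on boundaries; the essential case is a hyperplane
`F_ι`. -/

section Corank

variable {Γ}

theorem os_dTerm [Nontrivial L] (hΓ : Γ.1.J.Nodup) {H : Γ.1.E} {J : List Γ.1.E}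
    (hJ : (H :: J).Perm Γ.1.J) (hs : Γ.1.Spans H J) (hHF : ¬ H ≤ Γ.1.F) (h : H ⊔ Γ.1.F = ⊤) :
    MD.toOS L (Γ.1.dTerm H J) = OS.word (J.map fun K => Γ.trace (H ⊔ K)) := by
  have hat : ∀ K ∈ H :: J, IsAtom K := fun K hK => Γ.2.atoms K (hJ.mem_iff.1 hK)
  have hm := (Γ.1.contractAt_isModular_iff Γ.2.geometric Γ.2.extension (hat H List.mem_cons_self)
    fun K hK => hat K (List.mem_cons_of_mem H hK)).2
    ⟨hHF, (List.nodup_cons.1 (hJ.nodup_iff.2 hΓ)).1⟩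
  rw [Diagram.dTerm_of_spans hs, extendD_of_isModular hm]
  exact (MD.toOS_cls hm.diagram).trans (os_contractAt hm h)

theorem os_dTerm_eq_zero [Nontrivial L] {H : Γ.1.E} {J : List Γ.1.E}
    (hJ : (H :: J).Perm Γ.1.J) (h : Γ.1.Spans H J → H ⊔ Γ.1.F = ⊤ → H ≤ Γ.1.F) :
    MD.toOS L (Γ.1.dTerm H J) = 0 := by
  by_cases hs : Γ.1.Spans H J
  swap
  · rw [Diagram.dTerm_of_not_spans hs, map_zero]
  rw [Diagram.dTerm_of_spans hs]
  by_cases hm : (Γ.1.contractAt H J).IsModular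
  swap
  · rw [extendD_of_not_isModular hm, map_zero]
  rw [extendD_of_isModular hm]
  have hat : ∀ K ∈ H :: J, IsAtom K := fun K hK => Γ.2.atoms K (hJ.mem_iff.1 hK)
  refine (MD.toOS_cls hm.diagram).trans (os_of_ne fun htop => ?_)
  exact ((Γ.1.contractAt_isModular_iff Γ.2.geometric Γ.2.extension (hat H List.mem_cons_self)
    fun K hK => hat K (List.mem_cons_of_mem H hK)).1 hm).1 (h hs (congrArg Subtype.val htop))

/-- When `a` is an atom outside a hyperplane, a flat through `a` is thus recovered from its trace,
and lines through `a` with the same trace coincide. -/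
theorem sup_ι_trace {a G : Γ.1.E} (ha : a ⊔ Γ.1.F = ⊤) (hG : a ≤ G) :
    a ⊔ Γ.1.ι (Γ.trace G) = G := by
  rw [Γ.trace_spec]
  have h1 := Γ.2.extension.modular.inf_sup_eq_of_le Γ.2.geometric hG
  change G ⊓ (a ⊔ Γ.1.F) = a ⊔ G ⊓ Γ.1.F at h1
  rw [← h1, ha, inf_top_eq]

/-- The Arnold relation for the traces of the lines through three atoms. -/
theorem gen_trace_three (hrk : rk (⊤ : Γ.1.E) = rk Γ.1.F + 1) {a b c : Γ.1.E} (ha : IsAtom a)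
    (hb : IsAtom b) (hc : IsAtom c) (haF : a ⊔ Γ.1.F = ⊤) (hbF : b ⊔ Γ.1.F = ⊤)
    (hcF : c ⊔ Γ.1.F = ⊤) :
    OS.gen (Γ.trace (a ⊔ b)) * OS.gen (Γ.trace (a ⊔ c)) -
      OS.gen (Γ.trace (a ⊔ b)) * OS.gen (Γ.trace (b ⊔ c)) +
      OS.gen (Γ.trace (a ⊔ c)) * OS.gen (Γ.trace (b ⊔ c)) = 0 := by
  have hE := Γ.2.geometric
  have hnF : ∀ x : Γ.1.E, x ⊔ Γ.1.F = ⊤ → ¬ x ≤ Γ.1.F := fun x hx hle => by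
    rw [sup_eq_right.2 hle] at hx
    rw [hx] at hrk
    omega
  have hself : ∀ x : Γ.1.E, IsAtom x → x ⊔ Γ.1.F = ⊤ → OS.gen (Γ.trace (x ⊔ x)) = 0 :=
    fun x hx hxF => by
      rw [sup_idem, Γ.trace_atom_of_not_le hx (hnF x hxF)]
      exact OS.gen_of_not_isAtom fun h => h.1 rfl
  have hrk2 : ∀ x y : Γ.1.E, IsAtom x → IsAtom y → x ≠ y → rk (x ⊔ y) = 2 :=
    fun x y hx hy hxy => by
      rw [hE.rk_atom_sup hx, hE.rk_atom hy]
      exact fun h => hxy ((hy.le_iff_eq hx.1).1 h)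
  have htr : ∀ x G : Γ.1.E, x ⊔ Γ.1.F = ⊤ → x ≤ G → rk (Γ.trace G) + 1 = rk G :=
    fun x G hx hG => by
      have h1 := Γ.rk_add_rk_F G
      rw [top_le_iff.1 (hx.ge.trans (sup_le_sup_right hG Γ.1.F))] at h1
      omega
  have hatom : ∀ x y : Γ.1.E, IsAtom x → IsAtom y → x ≠ y → x ⊔ Γ.1.F = ⊤ →
      IsAtom (Γ.trace (x ⊔ y)) := fun x y hx hy hxy hxF => by
    rw [Γ.isGeometric_base.isAtom_iff_rk]
    have h1 := htr x (x ⊔ y) hxF le_sup_left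
    rw [hrk2 x y hx hy hxy] at h1
    omega
  by_cases hab : a = b
  · subst hab
    rw [hself a ha haF, OS.gen_mul_self]
    simp
  by_cases hac : a = c
  · subst hac
    rw [hself a ha haF, sup_comm b a, OS.gen_mul_self]
    simp
  by_cases hbc : b = c
  · subst hbc
    rw [hself b hb hbF, OS.gen_mul_self]
    simp
  have hline : ∀ x y z : Γ.1.E, IsAtom x → IsAtom y → IsAtom z → x ≠ y → y ≠ z →
      x ⊔ Γ.1.F = ⊤ → Γ.trace (x ⊔ y) = Γ.trace (x ⊔ z) → Γ.trace (y ⊔ z) = Γ.trace (x ⊔ y) :=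
    fun x y z hx hy hz hxy hyz hxF h => by
      have h1 : x ⊔ y = x ⊔ z := by
        rw [← sup_ι_trace hxF (le_sup_left : x ≤ x ⊔ y), h, sup_ι_trace hxF le_sup_left]
      have h2 : y ⊔ z ≤ x ⊔ y := sup_le le_sup_right (le_sup_right.trans h1.ge)
      rw [hE.eq_of_le_of_rk_le h2 (by rw [hrk2 x y hx hy hxy, hrk2 y z hy hz hyz])]
  -- If two traces agree, the two lines agree, so `a`, `b`, `c` are collinear and all three traces
  -- coincide. The products are then squares of a generator, hence zero.
  by_cases h1 : Γ.trace (a ⊔ b) = Γ.trace (a ⊔ c)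
  · have h2 := hline a b c ha hb hc hab hbc haF h1
    rw [h2, ← h1]
    simp [OS.gen_mul_self]
  by_cases h2 : Γ.trace (a ⊔ b) = Γ.trace (b ⊔ c)
  · have h3 := hline b a c hb ha hc (Ne.symm hab) hac hbF (by rw [sup_comm b a, h2])
    exact absurd ((congrArg Γ.trace (sup_comm a b)).trans h3.symm) h1
  by_cases h3 : Γ.trace (a ⊔ c) = Γ.trace (b ⊔ c)
  · have h4 := hline c a b hc ha hb (Ne.symm hac) hab hcF (by rw [sup_comm c a, sup_comm c b, h3])
    exact absurd (h4.trans (congrArg Γ.trace (sup_comm c a))) h1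
  refine OS.gen_three Γ.isGeometric_base (hatom a b ha hb hab haF) (hatom a c ha hc hac haF)
    (hatom b c hb hc hbc hbF) h1 h2 h3 ?_
  -- The three traces lie in the trace of `a ⊔ b ⊔ c`, a flat of rank at most three, which meets the
  -- hyperplane in rank at most two.
  have h4 : Γ.trace (a ⊔ b) ⊔ (Γ.trace (a ⊔ c) ⊔ Γ.trace (b ⊔ c)) ≤ Γ.trace (a ⊔ (b ⊔ c)) :=
    sup_le (Γ.trace_mono (sup_le_sup_left le_sup_left a))
      (sup_le (Γ.trace_mono (sup_le_sup_left le_sup_right a)) (Γ.trace_mono le_sup_right))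
  have h5 := Γ.isGeometric_base.rk_mono h4
  have h6 := htr a (a ⊔ (b ⊔ c)) haF le_sup_left
  have h7 := hE.semimodular a (b ⊔ c)
  rw [hE.rk_atom ha, hrk2 b c hb hc hbc] at h7
  omega

theorem os_dSum [Nontrivial L] (hΓ : Γ.1.J.Nodup) : MD.toOS L Γ.1.dSum = 0 := by
  classical
  have hE := Γ.2.geometric
  refine (map_altSum (MD.toOS L).toAddMonoidHom Γ.1.J).trans ?_
  -- A term survives only if its contraction has `F_ι = ⊤`. Without a letter outside `F_ι` that
  -- generates `⊤` with it, every term vanishes; with one, `F_ι` is a hyperplane.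
  by_cases hex : ∃ H ∈ Γ.1.J, ¬ H ≤ Γ.1.F ∧ H ⊔ Γ.1.F = ⊤
  swap
  · refine altSum_eq_zero fun H J hJ => os_dTerm_eq_zero hJ fun _ htop => ?_
    by_contra hHF
    exact hex ⟨H, hJ.mem_iff.1 List.mem_cons_self, hHF, htop⟩
  obtain ⟨H₀, hH₀, hH₀F, htop₀⟩ := hex
  have hrk : rk (⊤ : Γ.1.E) = rk Γ.1.F + 1 := by
    rw [← htop₀, hE.rk_atom_sup (Γ.2.atoms H₀ hH₀) hH₀F]
  have htop : ∀ H : Γ.1.E, IsAtom H → ¬ H ≤ Γ.1.F → H ⊔ Γ.1.F = ⊤ := fun H hH hHF =>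
    hE.eq_of_le_of_rk_le le_top (by rw [hrk, hE.rk_atom_sup hH hHF])
  let R := Γ.1.J.filter fun H => ¬ H ≤ Γ.1.F
  let S := Γ.1.J.filter fun H => H ≤ Γ.1.F
  have hRS : Γ.1.J.Perm (R ++ S) := by
    have := (List.filter_append_perm (fun H => decide (¬ H ≤ Γ.1.F)) Γ.1.J).symm
    simpa [R, S] using this
  have hR : ∀ H ∈ R, IsAtom H ∧ ¬ H ≤ Γ.1.F := fun H hH =>
    ⟨Γ.2.atoms H (List.mem_filter.1 hH).1, by simpa using (List.mem_filter.1 hH).2⟩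
  have hS : ∀ H ∈ S, H ≤ Γ.1.F := fun H hH => by simpa using (List.mem_filter.1 hH).2
  -- Over a hyperplane any second letter outside it already generates `⊤`, so a letter of `R` fails
  -- to be spanned only if it is alone in `R`.
  have hspans : ∀ H J, (H :: J).Perm Γ.1.J → ¬ H ≤ Γ.1.F → (Γ.1.Spans H J ↔ 2 ≤ R.length) := by
    intro H J hJ hHF
    have h1 : R.length = (J.filter fun H => ¬ H ≤ Γ.1.F).length + 1 := by
      rw [← (hJ.filter _).length_eq, List.filter_cons_of_pos (by simpa using hHF),
        List.length_cons]
    have h2 : 2 ≤ R.length ↔ ∃ K ∈ J, ¬ K ≤ Γ.1.F := by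
      rw [h1, Nat.succ_le_succ_iff, Nat.one_le_iff_ne_zero, Ne, List.length_eq_zero_iff,
        List.filter_eq_nil_iff]
      simp
    rw [h2]
    constructor
    · intro hs
      by_contra! hle
      exact hHF (hs.trans (sup_le le_rfl (wsup_le_iff.2 hle)))
    · rintro ⟨K, hK, hKF⟩
      have h3 := htop K (Γ.2.atoms K (hJ.mem_iff.1 (List.mem_cons_of_mem H hK))) hKF
      exact le_top.trans (h3.ge.trans (sup_le ((le_wsup hK).trans le_sup_right) le_sup_left))
  let c : Γ.1.E → List Γ.1.E → OS L := fun H J =>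
    if H ≤ Γ.1.F then 0 else OS.word (J.map fun K => Γ.trace (H ⊔ K))
  by_cases hlen : 2 ≤ R.length
  swap
  · exact altSum_eq_zero fun H J hJ => os_dTerm_eq_zero hJ fun hs _ => by
      by_contra hHF
      exact hlen ((hspans H J hJ hHF).1 hs)
  have hc : altSum (fun H J => MD.toOS L (Γ.1.dTerm H J)) Γ.1.J = altSum c Γ.1.J := by
    refine altSum_congr fun H J hJ => ?_
    by_cases hHF : H ≤ Γ.1.F
    · rw [os_dTerm_eq_zero hJ fun _ _ => hHF]
      exact (if_pos hHF).symm
    · rw [os_dTerm hΓ hJ ((hspans H J hJ hHF).2 hlen) hHF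
        (htop H (Γ.2.atoms H (hJ.mem_iff.1 List.mem_cons_self)) hHF)]
      exact (if_neg hHF).symm
  have halt : IsAlt (altSum c) := IsAlt.altSum fun H => by
    by_cases hHF : H ≤ Γ.1.F
    · intro l₁ a b l₂
      simp [c, hHF]
    · have := OS.isAlt_word.map fun K => Γ.trace (H ⊔ K)
      intro l₁ a b l₂
      simp only [c, if_neg hHF]
      exact this l₁ a b l₂
  refine hc.trans (halt.perm_eq_zero hRS ?_)
  rw [altSum_append, altSum_eq_zero (l := S) fun H J hJ =>
    if_pos (hS H (hJ.mem_iff.1 List.mem_cons_self)), smul_zero, add_zero]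
  -- Letters below `F_ι` keep their traces under contraction at `H`, so they contribute a common
  -- right factor.
  have h1 : altSum (fun H J => c H (J ++ S)) R =
      altSum (fun H J => (J.map fun K => OS.gen (Γ.trace (H ⊔ K))).prod) R *
        OS.word (S.map Γ.trace) := by
    refine Eq.trans (altSum_congr fun H J hJ => ?_)
      (map_altSum (AddMonoidHom.mulRight (OS.word (S.map Γ.trace))) R).symm
    obtain ⟨hHa, hHF⟩ := hR H (hJ.mem_iff.1 List.mem_cons_self)
    have h2 : S.map (fun K => Γ.trace (H ⊔ K)) = S.map Γ.trace := by
      refine List.map_congr_left fun K hK => ?_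
      obtain ⟨x, hx⟩ := Γ.2.extension.exists_eq (hS K hK)
      rw [← hx, Γ.trace_sup_ι, Γ.trace_ι, Γ.trace_atom_of_not_le hHa hHF, bot_sup_eq]
    refine (if_neg hHF).trans ?_
    rw [List.map_append, h2, OS.word_append, OS.word, List.map_map]
    rfl
  rw [h1]
  obtain ⟨a, l, hal⟩ : ∃ a l, R = a :: l := List.exists_cons_of_ne_nil fun h => by
    rw [h] at hlen
    simp at hlen
  rw [hal] at hR hlen ⊢
  rw [altSum_prod_eq_zero (P := fun a b => OS.gen (Γ.trace (a ⊔ b)))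
    (fun a b => by rw [sup_comm]), zero_mul]
  · intro x hx y hy z hz
    exact gen_trace_three hrk (hR x hx).1 (hR y hy).1 (hR z hz).1 (htop x (hR x hx).1 (hR x hx).2)
      (htop y (hR y hy).1 (hR y hy).2) (htop z (hR z hz).1 (hR z hz).2)
  · rintro rfl
    simp at hlen

end Corank

end ModularDiagram

theorem MD.toOS_d [Nontrivial L] (a : MD L) : MD.toOS L (MD.d L a) = 0 := by
  induction a using MD.induction with
  | h0 => simp
  | hadd x y hx hy => simp [hx, hy]
  | hsmul c x hx => simp [hx]
  | h Γ =>
    by_cases hΓ : Γ.1.J.Nodup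
    · rw [MD.d_cls, ModularDiagram.os_dSum hΓ]
    · rw [cls_eq_zero_of_not_nodup hΓ, map_zero, map_zero]

theorem MD.toOS_isCDGAHom [Nontrivial L] (hL : IsGeometric L) :
    IsCDGAHom (MD.grading L) (cls (unit hL)) (MD.mul L) (MD.d L) (OS.grading L) 1
      (LinearMap.mul ℚ (OS L)) 0 (MD.toOS L) where
  map_mem i a ha := by
    induction ha using Submodule.span_induction with
    | zero => simp
    | add x y _ _ hx hy => simpa using add_mem hx hy
    | smul c x _ hx => simpa using Submodule.smul_mem _ c hx
    | mem a ha =>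
      obtain ⟨Γ, rfl, rfl⟩ := ha
      rw [MD.toOS_cls]
      by_cases hF : Γ.1.F = ⊤
      · obtain ⟨K, hK, hos⟩ := Γ.exists_word hF
        rw [hos, Γ.deg_of_eq hF, hK, List.length_map]
        exact OS.e_mem_grading K
      · rw [ModularDiagram.os_of_ne hF]
        exact zero_mem _
  map_one := by
    rw [MD.toOS_cls]
    exact ModularDiagram.os_of_eq (Γ := unit hL) rfl
  map_mul a b := by
    induction a using MD.induction with
    | h0 => simp
    | hadd x y hx hy => simp only [map_add, LinearMap.add_apply, hx, hy]
    | hsmul c x hx => simp only [map_smul, LinearMap.smul_apply, hx]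
    | h Γ₁ =>
      induction b using MD.induction with
      | h0 => simp
      | hadd x y hx hy => simp only [map_add, hx, hy]
      | hsmul c x hx => simp only [map_smul, hx]
      | h Γ₂ =>
        rw [MD.mul_cls, MD.toOS_cls, MD.toOS_cls, MD.toOS_cls, ModularDiagram.os_pushoutM]
        rfl
  map_d a := MD.toOS_d a

end ModDiag

open Classical in
theorem mainTheorem2 {L : Type u} [Lattice L] [BoundedOrder L] [Nontrivial L]
    (hL : ModDiag.IsGeometric L) :
    -- contractions at contractible atoms and pushouts of modular diagrams are modular diagrams
    ∃ (hcontr : ∀ Γ : ModDiag.ModularDiagram L, Γ.1.J.Nodup →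
        ∀ i : Fin Γ.1.J.length, Γ.1.IsContractible (Γ.1.J.get i) → (Γ.1.contract i).IsModular)
      (hpush : ∀ Γ₁ Γ₂ : ModDiag.ModularDiagram L, (ModDiag.pushout Γ₁ Γ₂).IsModular)
      (mul : ModDiag.MD L →ₗ[ℚ] ModDiag.MD L →ₗ[ℚ] ModDiag.MD L)
      (d : ModDiag.MD L →ₗ[ℚ] ModDiag.MD L)
      (I : ModDiag.MD L →ₗ[ℚ] ModDiag.OS L),
      -- diagrams whose word has a repeated letter vanish
      (∀ Γ : ModDiag.ModularDiagram L, ¬ Γ.1.J.Nodup → ModDiag.cls Γ = 0) ∧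
      -- the differential is the signed sum of the contractions at contractible atoms
      (∀ (Γ : ModDiag.ModularDiagram L) (hΓ : Γ.1.J.Nodup),
        d (ModDiag.cls Γ) = ∑ i : Fin Γ.1.J.length,
          if h : Γ.1.IsContractible (Γ.1.J.get i) then
            ((-1 : ℚ) ^ (i : ℕ)) • ModDiag.cls ⟨Γ.1.contract i, hcontr Γ hΓ i h⟩
          else 0) ∧
      -- the product is the pushout along `L`
      (∀ Γ₁ Γ₂ : ModDiag.ModularDiagram L,
        mul (ModDiag.cls Γ₁) (ModDiag.cls Γ₂) =
          ModDiag.cls ⟨ModDiag.pushout Γ₁ Γ₂, hpush Γ₁ Γ₂⟩) ∧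
      -- these make the modular diagrams a cdga
      ModDiag.IsCDGA (ModDiag.MD.grading L) (ModDiag.cls (ModDiag.unit hL)) mul d ∧
      -- the Orlik–Solomon algebra is a cdga with zero differential, and `I` is a morphism to it
      ModDiag.IsCDGA (ModDiag.OS.grading L) 1 (LinearMap.mul ℚ (ModDiag.OS L)) 0 ∧
      ModDiag.IsCDGAHom (ModDiag.MD.grading L) (ModDiag.cls (ModDiag.unit hL)) mul d
        (ModDiag.OS.grading L) 1 (LinearMap.mul ℚ (ModDiag.OS L)) 0 I ∧
      -- `I` kills the diagrams with a contractible atom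
      (∀ Γ : ModDiag.ModularDiagram L, (∃ H, Γ.1.IsContractible H) → I (ModDiag.cls Γ) = 0) ∧
      -- a diagram without contractible atom either vanishes already, or has `F_ι = ⊤`; in the
      -- latter case `J` is the image of a word `K` in the atoms of `L` and goes to `e_K`
      (∀ Γ : ModDiag.ModularDiagram L, (¬ ∃ H, Γ.1.IsContractible H) → Γ.1.F ≠ ⊤ →
        ModDiag.cls Γ = 0) ∧
      (∀ Γ : ModDiag.ModularDiagram L, (¬ ∃ H, Γ.1.IsContractible H) → Γ.1.F = ⊤ →
        ∃ K : List (ModDiag.At L),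
          Γ.1.J = K.map (fun H : ModDiag.At L => Γ.1.ι H.1) ∧ I (ModDiag.cls Γ) = ModDiag.OS.e K) := by
  exact ⟨fun Γ hΓ i hi => ModDiag.contract_isModular hΓ hi, ModDiag.pushout_isModular,
    ModDiag.MD.mul L, ModDiag.MD.d L, ModDiag.MD.toOS L,
    fun Γ hΓ => ModDiag.cls_eq_zero_of_not_nodup hΓ, fun Γ hΓ => ModDiag.MD.d_cls_eq_sum hΓ,
    ModDiag.MD.mul_cls, ModDiag.MD.isCDGA hL, ModDiag.OS.isCDGA, ModDiag.MD.toOS_isCDGAHom hL,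
    -- A contractible atom is not below `F_ι`, so `F_ι ≠ ⊤`.
    fun Γ ⟨H, hH⟩ => (ModDiag.MD.toOS_cls Γ).trans
      (ModDiag.ModularDiagram.os_of_ne fun h => hH.2.2 (le_top.trans h.ge)),
    fun Γ hc hF => ModDiag.cls_eq_zero_of_not_isContractible hc hF,
    fun Γ _ hF => by
      rw [ModDiag.MD.toOS_cls]
      exact Γ.exists_word hF⟩
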